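/- There are a program $P$ for a random access machine and a constant $C$ such that the following holds. Let $G$ be a finite connected simple graph with vertex set $\{0,\dots,n-1\}$ and $m$ edges that is $C_4$-free (no four vertices of $G$ induce a cycle of length four) and Helly (every family of pairwise intersecting balls $N^r[v]=\{u : \mathrm{dist}(u,v)\le r\}$, $r\ge 0$, has a nonempty common intersection). Then $P$, given adjacency lists of $G$ with the neighbours of each vertex in any order, halts after at most $C\,(n+m)$ time units and outputs a diametral pair of $G$, i.e. vertices $x,y$ with $\mathrm{dist}(x,y)=\mathrm{diam}(G)=\max_{a,b}\mathrm{dist}(a,b)$, together with the number $\mathrm{diam}(G)$. In short: for a $C_4$-free Helly graph, a diametral pair, and hence $\mathrm{diam}(G)$, can be computed in linear time. Here the random access machine has finitely many variables and arrays (memory outside the input is initially zero); addition, truncated subtraction, comparison, assignment, and reading and writing of an array cell each take constant time; and all numbers that are stored and all addresses that are written to are at most $C\,(n+m)$, so that words have $\log_2(n+m)+O(1)$ bits. -/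

import Mathlib

/-! ### Graph notions -/

/-- The closed ball `N^r[v]`: all vertices at distance at most `r` from `v`. -/
def SimpleGraph.closedBall {V : Type*} (G : SimpleGraph V) (v : V) (r : ℕ) : Set V :=
  {u | G.edist v u ≤ (r : ℕ∞)}

/-- A graph is Helly if every family `F` of pairwise intersecting balls (a ball being given by its
centre and radius) has a nonempty common intersection. -/
def SimpleGraph.IsHelly {V : Type*} (G : SimpleGraph V) : Prop :=
  ∀ F : Set (V × ℕ),
    (∀ p ∈ F, ∀ q ∈ F, (G.closedBall p.1 p.2 ∩ G.closedBall q.1 q.2).Nonempty) →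
    (⋂ p ∈ F, G.closedBall p.1 p.2).Nonempty

/-- `G` is `C₄`-free if it has no *induced* subgraph isomorphic to the cycle on four vertices. -/
def SimpleGraph.IsC4Free {V : Type*} (G : SimpleGraph V) : Prop :=
  IsEmpty (SimpleGraph.cycleGraph 4 ↪g G)

/-- `(x, y)` is a diametral pair of `G` if its distance is the diameter (for connected `G`). -/
def SimpleGraph.IsDiametralPair {V : Type*} (G : SimpleGraph V) (x y : V) : Prop :=
  G.dist x y = G.diam

/-! ### A random access machine with unit-cost operations and bounded words

Programs are structured (assignments, array writes, branches, loops) over finitely many integer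
variables and finitely many arrays with random access; the only arithmetic is addition and
(truncated) subtraction. Every operation in an expression, every assignment, array write and test
costs at least one unit. The word bound `W` limits every value that is stored and every address
that is written; a program that would exceed it has no execution. The intermediate values within
an expression thus exceed `W` and the constants of the program by at most the constant factor given
by the size of that expression. -/

namespace RAM

/-- The memory: variable `x` holds `var x`, cell `i` of array `a` holds `arr a i`. -/
structure Mem where
  var : ℕ → ℕ
  arr : ℕ → ℕ → ℕ

/-- The memory after storing `k` in variable `x`. -/
def Mem.setVar (s : Mem) (x k : ℕ) : Mem :=
  { s with var := Function.update s.var x k }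

/-- The memory after storing `k` in cell `i` of array `a`. -/
def Mem.setArr (s : Mem) (a i k : ℕ) : Mem :=
  { s with arr := Function.update s.arr a (Function.update (s.arr a) i k) }

/-- Expressions: constants, variables, array reads `a[e]`, sums and truncated differences. -/
inductive Expr where
  | const (k : ℕ)
  | var (x : ℕ)
  | read (a : ℕ) (e : Expr)
  | add (e f : Expr)
  | sub (e f : Expr)

/-- The value of an expression. -/
def Expr.eval (s : Mem) : Expr → ℕ
  | .const k => k
  | .var x => s.var x
  | .read a e => s.arr a (e.eval s)
  | .add e f => e.eval s + f.eval s
  | .sub e f => e.eval s - f.eval s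

/-- The cost of evaluating an expression: its number of nodes. -/
def Expr.cost : Expr → ℕ
  | .const _ => 1
  | .var _ => 1
  | .read _ e => e.cost + 1
  | .add e f => e.cost + f.cost + 1
  | .sub e f => e.cost + f.cost + 1

/-- Tests: comparisons of expressions, negations and conjunctions. -/
inductive Test where
  | lt (e f : Expr)
  | eq (e f : Expr)
  | not (b : Test)
  | and (b c : Test)

/-- The truth value of a test. -/
def Test.holds (s : Mem) : Test → Prop
  | .lt e f => e.eval s < f.eval s
  | .eq e f => e.eval s = f.eval s
  | .not b => ¬ b.holds s
  | .and b c => b.holds s ∧ c.holds s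

/-- The cost of a test: its number of nodes. -/
def Test.cost : Test → ℕ
  | .lt e f => e.cost + f.cost + 1
  | .eq e f => e.cost + f.cost + 1
  | .not b => b.cost + 1
  | .and b c => b.cost + c.cost + 1

/-- Programs. -/
inductive Prog where
  | skip
  | assign (x : ℕ) (e : Expr)
  | write (a : ℕ) (i e : Expr)
  | seq (p q : Prog)
  | ite (b : Test) (p q : Prog)
  | loop (b : Test) (p : Prog)

/-- `Exec W p s t s'`: with word bound `W`, the program `p` started in memory `s` halts after
exactly `t` time units in memory `s'`. At most one rule applies to each `p` and `s`; in particular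
the execution is deterministic. The program `loop b p` repeats `p` while `b` holds. -/
inductive Exec (W : ℕ) : Prog → Mem → ℕ → Mem → Prop
  | skip (s : Mem) : Exec W .skip s 1 s
  | assign (s : Mem) (x : ℕ) (e : Expr) (he : e.eval s ≤ W) :
      Exec W (.assign x e) s (e.cost + 1) (s.setVar x (e.eval s))
  | write (s : Mem) (a : ℕ) (i e : Expr) (hi : i.eval s ≤ W) (he : e.eval s ≤ W) :
      Exec W (.write a i e) s (i.cost + e.cost + 1) (s.setArr a (i.eval s) (e.eval s))
  | seq {p q : Prog} {s s' s'' : Mem} {t t' : ℕ} (hp : Exec W p s t s')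
      (hq : Exec W q s' t' s'') : Exec W (.seq p q) s (t + t') s''
  | iteTrue {b : Test} {p q : Prog} {s s' : Mem} {t : ℕ} (hb : b.holds s)
      (hp : Exec W p s t s') : Exec W (.ite b p q) s (b.cost + t) s'
  | iteFalse {b : Test} {p q : Prog} {s s' : Mem} {t : ℕ} (hb : ¬ b.holds s)
      (hq : Exec W q s t s') : Exec W (.ite b p q) s (b.cost + t) s'
  | loopDone {b : Test} {p : Prog} {s : Mem} (hb : ¬ b.holds s) :
      Exec W (.loop b p) s b.cost s
  | loopStep {b : Test} {p : Prog} {s s' s'' : Mem} {t t' : ℕ} (hb : b.holds s)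
      (hp : Exec W p s t s') (hl : Exec W (.loop b p) s' t' s'') :
      Exec W (.loop b p) s (b.cost + t + t') s''

/-- The arrays `off`, `nbr` store the adjacency lists of the graph `G` on `{0, …, n - 1}`: the cells
`off v ≤ i < off (v + 1)` of `nbr` list the neighbours of `v`, without repetition and in any
order. All other cells are zero. (So `off n` is twice the number of edges.) -/
structure IsAdjacencyLists {n : ℕ} (G : SimpleGraph (Fin n)) (off nbr : ℕ → ℕ) : Prop where
  off_zero : off 0 = 0
  off_mono : ∀ v < n, off v ≤ off (v + 1)
  off_beyond : ∀ i, n < i → off i = 0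
  nbr_injOn : ∀ v < n, Set.InjOn nbr (Set.Ico (off v) (off (v + 1)))
  nbr_image : ∀ v : Fin n,
    nbr '' Set.Ico (off v) (off (v + 1)) = (fun w : Fin n => (w : ℕ)) '' G.neighborSet v
  nbr_beyond : ∀ i, off n ≤ i → nbr i = 0

/-- The initial memory: variable `0` holds `n`, arrays `0` and `1` hold the adjacency lists, and
everything else is zero. -/
def input (n : ℕ) (off nbr : ℕ → ℕ) : Mem where
  var := fun x => if x = 0 then n else 0
  arr := fun a => if a = 0 then off else if a = 1 then nbr else fun _ => 0

end RAM

/-! ### Distances and the Helly property -/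

namespace SimpleGraph

variable {V : Type*} {G : SimpleGraph V}

/-! Let `r` be half the diameter, rounded up. Applied to all balls of radius `r`, the Helly property
yields a vertex of eccentricity at most `r`, so `r` is the radius and the diameter is `2r` or `2r -
1`. It remains to reach a central vertex, to find a vertex of eccentricity at least `2r - 1`, and to
decide between the two values.

The Helly property and the absence of induced four-cycles make every slice of the geodesics between
two vertices a clique (`slice_clique`). Hence central vertices are at most three apart
(`dist_le_three_of_central`), and after two sweeps the middle of the geodesic found has eccentricity
at most `r + 2` (`ecc_middle_le`).

A descent step starts at `c` with a farthest vertex `w`; let `e` be the eccentricity of `c`. The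
neighbours of `c` at distance `e - 1` from `w` form a clique `S`. If some vertex is at distance at
least `e` from `S`, then `w` has eccentricity at least `2e - 1` (`far_of_le_lev`). Otherwise only
the vertices at distance `e - 1` from `S` matter. Each of them has a gate, a vertex whose neighbours
in `S` are exactly the members of `S` nearest to it (`adj_of_gate`). A common neighbour in `S` of
all gates has eccentricity below `e` (`ecc_lt_of_inMeet`). If there is none, a vertex whose gate
first empties the intersection has eccentricity at least `2e - 1` (`exists_far_of_meetFails`). As
`2e - 1` is at most `2r`, the second outcome means that `c` was central already. From `r + 2`, two
steps reach a central vertex and a third supplies a vertex of eccentricity at least `2r - 1`.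

For a central `c`, only vertices at distance `r` from `c` can be `2r` apart. To each such `x` is
assigned a neighbour of `c` closer to `x` with the most common neighbours with `c`. Two vertices are
`2r` apart if and only if their assigned neighbours are distinct and nonadjacent
(`dist_lt_iff_of_max`), so the question is whether the assigned vertices form a clique.

Gates and assigned neighbours are computed alike: count neighbours on one level of a breadth-first
search, then propagate the best vertex of level one upwards (`BfsOut.selSpec_of_pred`). All loops
run over the adjacency lists a bounded number of times. -/

theorem Connected.exists_dist_le_dist_le (hc : G.Connected) {u v : V} {a b : ℕ}
    (h : G.dist u v ≤ a + b) : ∃ z, G.dist u z ≤ a ∧ G.dist v z ≤ b := by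
  obtain ⟨p, hp⟩ := hc.exists_walk_length_eq_dist u v
  refine ⟨p.getVert a, (G.dist_le (p.take a)).trans ?_, ?_⟩
  · rw [Walk.take_length]; exact min_le_left _ _
  · rw [dist_comm]
    refine (G.dist_le (p.drop a)).trans ?_
    rw [Walk.drop_length]; omega

theorem Connected.dist_le_one_iff (hc : G.Connected) {u v : V} :
    G.dist u v ≤ 1 ↔ u = v ∨ G.Adj u v := by
  constructor
  · intro h
    by_cases h0 : G.dist u v = 0
    · exact .inl (hc.dist_eq_zero_iff.1 h0)
    · exact .inr (dist_eq_one_iff_adj.1 (by omega))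
  · rintro (rfl | h)
    · simp
    · exact (dist_eq_one_iff_adj.2 h).le

/-- Any two balls of the family (given by centres and radii) are near enough to intersect. -/
def PairwiseNear (G : SimpleGraph V) (F : Set (V × ℕ)) : Prop :=
  ∀ p ∈ F, ∀ q ∈ F, G.dist p.1 q.1 ≤ p.2 + q.2

theorem PairwiseNear.singleton (p : V × ℕ) : G.PairwiseNear {p} := by
  rintro _ rfl _ rfl; simp

theorem PairwiseNear.insert {F : Set (V × ℕ)} (hF : G.PairwiseNear F) {p : V × ℕ}
    (hp : ∀ q ∈ F, G.dist p.1 q.1 ≤ p.2 + q.2) : G.PairwiseNear (insert p F) := by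
  rintro a (rfl | ha) b (rfl | hb)
  · simp
  · exact hp b hb
  · rw [dist_comm, add_comm]; exact hp a ha
  · exact hF a ha b hb

theorem PairwiseNear.image_const {X : Set V} {d : ℕ}
    (h : ∀ x ∈ X, ∀ y ∈ X, G.dist x y ≤ d + d) :
    G.PairwiseNear ((fun x => (x, d)) '' X) := by
  rintro _ ⟨x, hx, rfl⟩ _ ⟨y, hy, rfl⟩; exact h x hx y hy

/-- In a connected graph two balls meet as soon as their radii add up to the distance of the
centres, by a point on a geodesic. The Helly property thus turns inequalities between distances into
a vertex. -/
theorem IsHelly.exists_dist_le (hH : G.IsHelly) (hc : G.Connected) {F : Set (V × ℕ)}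
    (hF : G.PairwiseNear F) : ∃ z, ∀ p ∈ F, G.dist p.1 z ≤ p.2 := by
  have key : ∀ (u v : V) (r : ℕ), v ∈ G.closedBall u r ↔ G.dist u v ≤ r := by
    intro u v r
    change G.edist u v ≤ (r : ℕ∞) ↔ _
    rw [← (hc.preconnected u v).coe_dist_eq_edist]
    exact Nat.cast_le
  obtain ⟨z, hz⟩ := hH F (by
    intro p hp q hq
    obtain ⟨z, h1, h2⟩ := hc.exists_dist_le_dist_le (hF p hp q hq)
    exact ⟨z, (key _ _ _).2 h1, (key _ _ _).2 h2⟩)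
  refine ⟨z, fun p hp => (key _ _ _).1 ?_⟩
  simp only [Set.mem_iInter] at hz
  exact hz p hp

theorem IsHelly.exists_dist_le₃ (hH : G.IsHelly) (hc : G.Connected) {u v w : V} {a b c : ℕ}
    (huv : G.dist u v ≤ a + b) (huw : G.dist u w ≤ a + c) (hvw : G.dist v w ≤ b + c) :
    ∃ z, G.dist u z ≤ a ∧ G.dist v z ≤ b ∧ G.dist w z ≤ c := by
  obtain ⟨z, hz⟩ := hH.exists_dist_le hc (F := {(u, a), (v, b), (w, c)})
    (((PairwiseNear.singleton (w, c)).insert (p := (v, b)) (by simpa using hvw)).insert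
      (p := (u, a)) (by simp [huv, huw]))
  exact ⟨z, by simpa using hz⟩

theorem IsHelly.exists_dist_le₄ (hH : G.IsHelly) (hc : G.Connected) {t u v w : V} {d a b c : ℕ}
    (htu : G.dist t u ≤ d + a) (htv : G.dist t v ≤ d + b) (htw : G.dist t w ≤ d + c)
    (huv : G.dist u v ≤ a + b) (huw : G.dist u w ≤ a + c) (hvw : G.dist v w ≤ b + c) :
    ∃ z, G.dist t z ≤ d ∧ G.dist u z ≤ a ∧ G.dist v z ≤ b ∧ G.dist w z ≤ c := by
  obtain ⟨z, hz⟩ := hH.exists_dist_le hc (F := {(t, d), (u, a), (v, b), (w, c)})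
    ((((PairwiseNear.singleton (w, c)).insert (p := (v, b)) (by simpa using hvw)).insert
      (p := (u, a)) (by simp [huv, huw])).insert (p := (t, d)) (by simp [htu, htv, htw]))
  exact ⟨z, by simpa using hz⟩

theorem IsC4Free.adj_of_square (h4 : G.IsC4Free) {a b c d : V} (hab : G.Adj a b) (hbc : G.Adj b c)
    (hcd : G.Adj c d) (hda : G.Adj d a) (hac : ¬ G.Adj a c) (hac' : a ≠ c) (hbd' : b ≠ d) :
    G.Adj b d := by
  by_contra hbd
  refine h4.false ⟨⟨![a, b, c, d], ?_⟩, ?_⟩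
  · intro i j hij
    have h1 := hab.ne
    have h2 := hbc.ne
    have h3 := hcd.ne
    have h4 := hda.ne
    fin_cases i <;> fin_cases j <;> simp_all
  · intro i j
    have hcyc : ∀ i j : Fin 4, (cycleGraph 4).Adj i j ↔ i = j + 1 ∨ j = i + 1 := by decide
    have hca : ¬ G.Adj c a := fun h => hac h.symm
    have hdb : ¬ G.Adj d b := fun h => hbd h.symm
    rw [hcyc]
    change G.Adj (![a, b, c, d] i) (![a, b, c, d] j) ↔ _
    fin_cases i <;> fin_cases j <;>
      simp [hab, hbc, hcd, hda, hac, hbd, hca, hdb, hab.symm, hbc.symm, hcd.symm, hda.symm]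

/-! ### Slices and almost central vertices -/

variable (hc : G.Connected) (hH : G.IsHelly) (h4 : G.IsC4Free)
include hc hH

include h4 in
/-- The vertices at given distances from the ends of a geodesic form a clique. -/
theorem slice_clique {x y z z' : V} {a b : ℕ} (hxy : G.dist x y = a + b)
    (hxz : G.dist x z ≤ a) (hzy : G.dist z y ≤ b) (hxz' : G.dist x z' ≤ a)
    (hzy' : G.dist z' y ≤ b) : G.dist z z' ≤ 1 := by
  by_contra hlt
  have tri : ∀ u v w, G.dist u w ≤ G.dist u v + G.dist v w := fun u v w => hc.dist_triangle
  have comm : ∀ u v, G.dist u v = G.dist v u := fun u v => dist_comm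
  -- If `z` and `z'` are at least two apart, there is a `t` in the same slice at distance exactly
  -- two from `z`: the last two radii add up to the distance of `z` and `z'`.
  obtain ⟨t, ht1, ht2, ht3, ht4⟩ := hH.exists_dist_le₄ hc (t := x) (u := y) (v := z) (w := z')
    (d := a) (a := b) (b := 2) (c := G.dist z z' - 2) hxy.le (by omega) (by omega)
    (by rw [comm]; omega) (by rw [comm]; omega) (by omega)
  have hzt : G.dist z t = 2 := by
    have := tri z t z'; rw [comm t z'] at this; omega
  have hxyz := tri x z y
  have hxyt := tri x t y
  have hyt := comm y t
  have ha : a ≠ 0 := by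
    rintro rfl
    have := tri z x t; rw [comm z x] at this; omega
  have hb : b ≠ 0 := by
    rintro rfl
    have := tri z y t; omega
  obtain ⟨p, hp1, hp2, hp3⟩ := hH.exists_dist_le₃ hc (u := x) (v := z) (w := t) (a := a - 1)
    (b := 1) (c := 1) (by omega) (by omega) (by omega)
  obtain ⟨q, hq1, hq2, hq3⟩ := hH.exists_dist_le₃ hc (u := y) (v := z) (w := t) (a := b - 1)
    (b := 1) (c := 1) (by rw [comm]; omega) (by omega) (by omega)
  -- The common neighbours `p` and `q` of `z` and `t` lie one step towards `x` and one step towards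
  -- `y`. They are thus two levels apart, and `z p t q` is an induced four-cycle.
  have hpq : 2 ≤ G.dist p q := by
    have h1 := tri x p y
    have h2 := tri p q y
    have := comm q y
    omega
  have hzp : G.Adj z p := ((hc.dist_le_one_iff).1 hp2).resolve_left (by rintro rfl; omega)
  have htp : G.Adj t p := ((hc.dist_le_one_iff).1 hp3).resolve_left (by rintro rfl; omega)
  have hzq : G.Adj z q := ((hc.dist_le_one_iff).1 hq2).resolve_left (by
    rintro rfl; have := comm y z; omega)
  have htq : G.Adj t q := ((hc.dist_le_one_iff).1 hq3).resolve_left (by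
    rintro rfl; have := comm y t; omega)
  have := h4.adj_of_square hzp htp.symm htq hzq.symm
    (fun h => by have := dist_eq_one_iff_adj.2 h; omega) (by rintro rfl; simp at hzt)
    (by rintro rfl; simp at hpq)
  have := dist_eq_one_iff_adj.2 this
  omega

include h4 in
/-- Points within the radius of both ends of a diametral pair are close to each other. -/
theorem dist_le_three_of_central {x y z z' : V} {r : ℕ} (hxy : 2 * r ≤ G.dist x y + 1)
    (hxy' : G.dist x y ≤ 2 * r)
    (hzx : G.dist z x ≤ r) (hzy : G.dist z y ≤ r) (hzx' : G.dist z' x ≤ r)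
    (hzy' : G.dist z' y ≤ r) : G.dist z z' ≤ 3 := by
  have tri : ∀ u v w, G.dist u w ≤ G.dist u v + G.dist v w := fun u v w => hc.dist_triangle
  have comm : ∀ u v, G.dist u v = G.dist v u := fun u v => dist_comm
  by_cases h : G.dist x y = r + r
  · have := slice_clique hc hH h4 h (by rw [comm]; exact hzx) hzy (by rw [comm]; exact hzx') hzy'
    omega
  -- Here `x` and `y` are `2r - 1` apart. Both `z` and `z'` move by at most one into the slice at `r
  -- - 1` from `x` and `r` from `y`, which is a clique; hence `1 + 1 + 1`.
  · obtain ⟨p, hp1, hp2, hp3⟩ := hH.exists_dist_le₃ hc (u := x) (v := y) (w := z) (a := r - 1)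
      (b := r) (c := 1) (by omega) (by rw [comm]; omega) (by rw [comm]; omega)
    obtain ⟨q, hq1, hq2, hq3⟩ := hH.exists_dist_le₃ hc (u := x) (v := y) (w := z') (a := r - 1)
      (b := r) (c := 1) (by omega) (by rw [comm]; omega) (by rw [comm]; omega)
    have h1 := slice_clique hc hH h4 (x := x) (y := y) (a := r - 1) (b := r)
      (z := p) (z' := q) (by omega) hp1
      (by rw [comm]; exact hp2) hq1 (by rw [comm]; exact hq2)
    have h2 := tri z p z'
    have h3 := tri p q z'
    have h5 := comm q z'
    omega

/-- A vertex `u` is at distance `k - r` from a vertex of eccentricity at most `r`. -/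
theorem exists_central_near {r k : ℕ} (hr : ∀ u v, G.dist u v ≤ 2 * r) (u : V)
    (hk : ∀ v, G.dist u v ≤ k) (hrk : r ≤ k) :
    ∃ z, G.dist u z ≤ k - r ∧ ∀ v, G.dist z v ≤ r := by
  obtain ⟨z, hz⟩ := hH.exists_dist_le hc
    ((PairwiseNear.image_const (X := Set.univ) (d := r)
      (fun x _ y _ => by have := hr x y; omega)).insert (p := (u, k - r)) (by
        rintro _ ⟨v, _, rfl⟩
        have := hk v
        dsimp
        omega))
  refine ⟨z, hz _ (Set.mem_insert _ _), fun v => ?_⟩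
  rw [dist_comm]
  exact hz (v, r) (Set.mem_insert_of_mem _ ⟨v, trivial, rfl⟩)

omit hH in
theorem radius_le_ecc {r : ℕ} {x y u : V} {k : ℕ} (hxy : 2 * r ≤ G.dist x y + 1)
    (hk : ∀ v, G.dist u v ≤ k) : r ≤ k := by
  have := hc.dist_triangle (u := x) (v := u) (w := y)
  have h1 := hk x
  rw [dist_comm] at h1
  have h2 := hk y
  omega

include h4 in
/-- The middle of the geodesic found by two sweeps is almost central. -/
theorem ecc_middle_le {r : ℕ} {x y : V} (hr : ∀ u v, G.dist u v ≤ 2 * r)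
    (hxy : 2 * r ≤ G.dist x y + 1) {u w v m : V} (hw : ∀ t, G.dist u t ≤ G.dist u w)
    (hv : ∀ t, G.dist w t ≤ G.dist w v) (hm : G.dist w m + G.dist m v = G.dist w v)
    (hm1 : 2 * G.dist w m ≤ G.dist w v) (hm2 : G.dist w v ≤ 2 * G.dist w m + 1) (t : V) :
    G.dist m t ≤ r + 2 := by
  have tri : ∀ u v w, G.dist u w ≤ G.dist u v + G.dist v w := fun u v w => hc.dist_triangle
  have comm : ∀ u v, G.dist u v = G.dist v u := fun u v => dist_comm
  have hrw := radius_le_ecc hc hxy hw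
  have hrv := radius_le_ecc hc hxy hv
  obtain ⟨c, hcu, hcr⟩ := exists_central_near hc hH hr u hw hrw
  obtain ⟨c', hcw', hcr'⟩ := exists_central_near hc hH hr w hv hrv
  have hcc := dist_le_three_of_central hc hH h4 hxy (hr x y) (hcr x) (hcr y) (hcr' x) (hcr' y)
  -- The central vertex `c` is so close to `u` that `w`, being farthest from `u`, is at distance `r`
  -- from it. So `w` is at least `r - 3` from `c'`, whereas `c'` is within the eccentricity of `w`
  -- minus `r`.
  have hlow : 2 * r ≤ G.dist w v + 3 := by
    have h1 := tri u c w
    have h2 := tri c c' w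
    have h3 := comm c' w
    omega
  have hup := hr w v
  -- The point `z` of the geodesic lies in the same slice between `w` and `v` as `c'`, so it is
  -- within one of a central vertex. By the lower bound just shown, `m` is within one of `z`.
  obtain ⟨z, hz1, hz2⟩ := hc.exists_dist_le_dist_le (u := w) (v := m) (a := G.dist w v - r)
    (b := G.dist w m - (G.dist w v - r)) (by omega)
  have hzc := slice_clique hc hH h4 (x := w) (y := v) (z := z) (z' := c') (a := G.dist w v - r)
    (b := r) (by omega) hz1 (by have := tri z m v; have := comm z m; omega) hcw' (hcr' v)
  have h1 := tri m z t
  have h2 := tri z c' t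
  have h3 := hcr' t
  omega

/-! ### Descending towards a farthest vertex -/

/-- Vertices that are near each other and near `w` have a common neighbour towards `w`, if `w`
is a vertex farthest from `c`. -/
theorem exists_common_descent {c w : V} (hk : ∀ x, G.dist c x ≤ G.dist c w)
    (hpos : 0 < G.dist c w) {X : Set V}
    (hX : ∀ x ∈ X, ∀ y ∈ X, G.dist x y + 2 ≤ 2 * G.dist c w)
    (hw : ∀ x ∈ X, G.dist w x + 2 ≤ 2 * G.dist c w) :
    ∃ u, G.Adj c u ∧ G.dist w u + 1 = G.dist c w ∧ ∀ x ∈ X, G.dist u x + 1 ≤ G.dist c w := by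
  obtain ⟨u, hu⟩ := hH.exists_dist_le hc
    (((PairwiseNear.image_const (X := X) (d := G.dist c w - 1) (fun x hx y hy => by
      have := hX x hx y hy; omega)).insert (p := (w, G.dist c w - 1)) (by
        rintro _ ⟨v, hv, rfl⟩
        have := hw v hv
        dsimp
        omega)).insert (p := (c, 1)) (by
          rintro _ (rfl | ⟨v, hv, rfl⟩)
          · dsimp; omega
          · have := hk v
            dsimp; omega))
  have h1 : G.dist c u ≤ 1 := hu _ (Set.mem_insert _ _)
  have h2 : G.dist w u ≤ G.dist c w - 1 := hu _ (Set.mem_insert_of_mem _ (Set.mem_insert _ _))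
  have h3 := hc.dist_triangle (u := c) (v := u) (w := w)
  rw [dist_comm (u := u)] at h3
  refine ⟨u, dist_eq_one_iff_adj.1 (by omega), by omega, fun x hx => ?_⟩
  have h4 : G.dist x u ≤ G.dist c w - 1 :=
    hu (x, G.dist c w - 1) (Set.mem_insert_of_mem _ (Set.mem_insert_of_mem _ ⟨x, hx, rfl⟩))
  rw [dist_comm]
  omega

include h4 in
theorem descent_clique {c w u v : V} (hu : G.Adj c u) (huw : G.dist w u + 1 = G.dist c w)
    (hv : G.Adj c v) (hvw : G.dist w v + 1 = G.dist c w) : G.dist u v ≤ 1 :=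
  slice_clique hc hH h4 (x := c) (y := w) (a := 1) (b := G.dist c w - 1) (by omega)
    (dist_eq_one_iff_adj.2 hu).le (by rw [dist_comm]; omega) (dist_eq_one_iff_adj.2 hv).le
    (by rw [dist_comm]; omega)

/-! ### Gates and maximal neighbours -/

/-- The unit balls around `S` meet pairwise, and each meets the ball of radius `d` around `x`. This
supplies the ideal candidate with which a vertex of largest degree into a set is compared. -/
theorem exists_dominating {S : Set V} (hS : ∀ u ∈ S, ∀ v ∈ S, G.dist u v ≤ 2) {x : V} {d : ℕ}
    (hx : ∀ u ∈ S, G.dist u x ≤ d + 1) :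
    ∃ g, G.dist g x ≤ d ∧ ∀ u ∈ S, G.dist g u ≤ 1 := by
  obtain ⟨g, hg⟩ := hH.exists_dist_le hc
    ((PairwiseNear.image_const (X := S) (d := 1) hS).insert (p := (x, d)) (by
        rintro _ ⟨v, hv, rfl⟩
        rw [dist_comm]
        exact hx v hv))
  refine ⟨g, ?_, fun u hu => ?_⟩
  · rw [dist_comm]; exact hg _ (Set.mem_insert _ _)
  · rw [dist_comm]; exact hg (u, 1) (Set.mem_insert_of_mem _ ⟨u, hu, rfl⟩)

/-- A gate of `x` in the clique `K`: among the vertices next to `K` and closest to `x`, one with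
the largest number of neighbours in `K` is adjacent to all vertices of `K` closest to `x`. -/
theorem adj_of_gate [Finite V] {K : Set V} (hK : ∀ u ∈ K, ∀ v ∈ K, G.dist u v ≤ 1) {x g : V}
    {d : ℕ} (hKx : ∀ u ∈ K, d + 1 ≤ G.dist u x) (hg : G.dist g x ≤ d)
    (hmax : ∀ g', (∃ u ∈ K, G.Adj g' u) → G.dist g' x ≤ d →
      {u | u ∈ K ∧ G.Adj g' u}.ncard ≤ {u | u ∈ K ∧ G.Adj g u}.ncard)
    {u : V} (hu : u ∈ K) : G.Adj g u ↔ G.dist u x = d + 1 := by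
  have tri : ∀ u v w, G.dist u w ≤ G.dist u v + G.dist v w := fun u v w => hc.dist_triangle
  have hfwd : ∀ u ∈ K, G.Adj g u → G.dist u x = d + 1 := by
    intro u hu ha
    have h1 := dist_eq_one_iff_adj.2 ha.symm
    have h2 := tri u g x
    have h3 := hKx u hu
    omega
  refine ⟨hfwd u hu, fun hux => ?_⟩
  obtain ⟨g', hg', hdom⟩ := exists_dominating hc hH (S := {v | v ∈ K ∧ G.dist v x = d + 1})
    (fun u hu v hv => (hK u hu.1 v hv.1).trans (by omega)) (x := x) (d := d) (fun u hu => hu.2.le)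
  have hadj : ∀ v ∈ K, G.dist v x = d + 1 → G.Adj g' v := fun v hv hvx =>
    (hc.dist_le_one_iff.1 (hdom v ⟨hv, hvx⟩)).resolve_left (by rintro rfl; omega)
  -- All neighbours of `g` in `K` are closest to `x`, hence also neighbours of the dominating `g'`.
  -- Maximality of `g` forces equality, so `g` misses no closest vertex.
  have hsub : {u | u ∈ K ∧ G.Adj g u} ⊆ {u | u ∈ K ∧ G.Adj g' u} := fun v hv =>
    ⟨hv.1, hadj v hv.1 (hfwd v hv.1 hv.2)⟩
  have heq := Set.eq_of_subset_of_ncard_le hsub (hmax g' ⟨u, hu, hadj u hu hux⟩ hg')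
    (Set.toFinite _)
  have : u ∈ {u | u ∈ K ∧ G.Adj g' u} := ⟨hu, hadj u hu hux⟩
  rw [← heq] at this
  exact this.2

/-- Among the neighbours of `c` towards `x`, one with the largest number of common neighbours with
`c` is adjacent or equal to every neighbour of `c` not farther from `x` than `c`. -/
theorem dist_le_one_of_max [Finite V] {c x b : V}
    (hb : G.Adj c b) (hbx : G.dist b x + 1 = G.dist c x)
    (hmax : ∀ b', G.Adj c b' → G.dist b' x + 1 = G.dist c x →
      {u | G.Adj c u ∧ G.Adj b' u}.ncard ≤ {u | G.Adj c u ∧ G.Adj b u}.ncard)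
    {u : V} (hu : G.Adj c u) (hux : G.dist u x ≤ G.dist c x) : G.dist b u ≤ 1 := by
  have tri : ∀ u v w, G.dist u w ≤ G.dist u v + G.dist v w := fun u v w => hc.dist_triangle
  have hdist : ∀ {u}, G.Adj c u → G.dist c u = 1 := fun h => dist_eq_one_iff_adj.2 h
  obtain ⟨g, hg, hdom⟩ := exists_dominating hc hH
    (S := insert c {v | G.Adj c v ∧ G.dist v x ≤ G.dist c x}) (x := x) (d := G.dist c x - 1) (by
      rintro u (rfl | hu) v (rfl | hv)
      · simp
      · rw [hdist hv.1]; omega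
      · rw [dist_comm, hdist hu.1]; omega
      · have := tri u c v
        rw [dist_comm (u := u) (v := c), hdist hu.1, hdist hv.1] at this
        exact this) (by
      rintro u (rfl | hu)
      · omega
      · have := hu.2
        omega)
  have hgc : G.Adj c g := by
    refine ((hc.dist_le_one_iff.1 (hdom c (Set.mem_insert _ _))).resolve_left ?_).symm
    rintro rfl
    omega
  have hgx : G.dist g x + 1 = G.dist c x := by
    have := tri c g x
    rw [hdist hgc] at this
    omega
  -- No closed neighbour of `b` is farther from `x` than `c`, so inside the neighbourhood of `c` the
  -- vertex `g` dominates whatever `b` dominates. The insertions pass to closed neighbourhoods,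
  -- adding one on either side.
  have hsub : insert b {u | G.Adj c u ∧ G.Adj b u} ⊆ insert g {u | G.Adj c u ∧ G.Adj g u} := by
    have aux : ∀ v, G.Adj c v → G.dist v x ≤ G.dist c x →
        v ∈ insert g {u | G.Adj c u ∧ G.Adj g u} := by
      intro v hv hvx
      rcases hc.dist_le_one_iff.1 (hdom v (Set.mem_insert_of_mem _ ⟨hv, hvx⟩)) with rfl | h
      · exact Set.mem_insert _ _
      · exact Set.mem_insert_of_mem _ ⟨hv, h⟩
    rintro v (rfl | hv)
    · exact aux v hb (by omega)
    · refine aux v hv.1 ?_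
      have := tri v b x
      rw [dist_eq_one_iff_adj.2 hv.2.symm] at this
      omega
  have heq := Set.eq_of_subset_of_ncard_le hsub (by
    rw [Set.ncard_insert_of_notMem (by simp), Set.ncard_insert_of_notMem (by simp)]
    exact Nat.succ_le_succ (hmax g hgc hgx)) (Set.toFinite _)
  have : u ∈ insert g {u | G.Adj c u ∧ G.Adj g u} := by
    rcases hc.dist_le_one_iff.1 (hdom u (Set.mem_insert_of_mem _ ⟨hu, hux⟩)) with rfl | h
    · exact Set.mem_insert _ _
    · exact Set.mem_insert_of_mem _ ⟨hu, h⟩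
  rw [← heq] at this
  rcases this with rfl | h
  · simp
  · exact (dist_eq_one_iff_adj.2 h.2).le

/-- Two vertices farthest from `c` are at distance less than twice the eccentricity if and only if
the corresponding maximal neighbours of `c` are adjacent or equal. -/
theorem dist_lt_iff_of_max [Finite V] {c x y b b' : V} (hxy : G.dist c x = G.dist c y)
    (hb : G.Adj c b) (hbx : G.dist b x + 1 = G.dist c x)
    (hmax : ∀ e, G.Adj c e → G.dist e x + 1 = G.dist c x →
      {u | G.Adj c u ∧ G.Adj e u}.ncard ≤ {u | G.Adj c u ∧ G.Adj b u}.ncard)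
    (hb' : G.Adj c b') (hby : G.dist b' y + 1 = G.dist c y)
    (hmax' : ∀ e, G.Adj c e → G.dist e y + 1 = G.dist c y →
      {u | G.Adj c u ∧ G.Adj e u}.ncard ≤ {u | G.Adj c u ∧ G.Adj b' u}.ncard) :
    G.dist x y + 1 ≤ 2 * G.dist c x ↔ G.dist b b' ≤ 1 := by
  have tri : ∀ u v w, G.dist u w ≤ G.dist u v + G.dist v w := fun u v w => hc.dist_triangle
  have comm : ∀ u v, G.dist u v = G.dist v u := fun u v => dist_comm
  constructor
  · intro h
    -- The neighbour `u` of `c` is closer to `x` than `c` and not farther from `y`. Maximality of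
    -- `b'` puts `b'` next to `u`, hence not farther from `x` than `c`; maximality of `b` then puts
    -- `b` next to `b'`.
    obtain ⟨u, hu1, hu2, hu3⟩ := hH.exists_dist_le₃ hc (u := x) (v := y) (w := c)
      (a := G.dist c x - 1) (b := G.dist c x) (c := 1) (by omega)
      (by rw [comm]; omega) (by rw [comm]; omega)
    have huc : G.Adj c u := by
      refine (hc.dist_le_one_iff.1 hu3).resolve_left ?_
      rintro rfl
      have := comm x c
      omega
    have h1 := dist_le_one_of_max hc hH hb' hby hmax' huc (by rw [comm]; omega)
    refine dist_le_one_of_max hc hH hb hbx hmax hb' ?_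
    have h2 := tri b' u x
    have h3 := comm u x
    omega
  · intro h
    have h1 := tri x b y
    have h2 := tri b b' y
    have h3 := comm x b
    omega

end SimpleGraph

namespace RAM

/-! ### Weakest preconditions and frames -/

/-- `Run W p s Q`: started in `s`, the program `p` halts, and `Q` holds of the time used and of the
final memory. -/
def Run (W : ℕ) (p : Prog) (s : Mem) (Q : ℕ → Mem → Prop) : Prop :=
  ∃ t s', Exec W p s t s' ∧ Q t s'

/-- The variables that a program may change. -/
def Prog.vars : Prog → List ℕ
  | .skip => []
  | .assign x _ => [x]
  | .write _ _ _ => []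
  | .seq p q => p.vars ++ q.vars
  | .ite _ p q => p.vars ++ q.vars
  | .loop _ p => p.vars

/-- The arrays that a program may change. -/
def Prog.arrs : Prog → List ℕ
  | .skip => []
  | .assign _ _ => []
  | .write a _ _ => [a]
  | .seq p q => p.arrs ++ q.arrs
  | .ite _ p q => p.arrs ++ q.arrs
  | .loop _ p => p.arrs

/-- The memories `s` and `s'` agree outside of the given variables and arrays. -/
structure Frame (vs as : List ℕ) (s s' : Mem) : Prop where
  var : ∀ x, x ∉ vs → s'.var x = s.var x
  arr : ∀ a, a ∉ as → s'.arr a = s.arr a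

theorem Frame.refl (vs as : List ℕ) (s : Mem) : Frame vs as s s := ⟨fun _ _ => rfl, fun _ _ => rfl⟩

theorem Frame.trans {vs as vs' as' : List ℕ} {s s' s'' : Mem} (h : Frame vs as s s')
    (h' : Frame vs' as' s' s'') (hv : vs' ⊆ vs) (ha : as' ⊆ as) : Frame vs as s s'' :=
  ⟨fun x hx => (h'.var x fun hh => hx (hv hh)).trans (h.var x hx),
    fun a hx => (h'.arr a fun hh => hx (ha hh)).trans (h.arr a hx)⟩

@[simp] theorem setVar_var (s : Mem) (x k y : ℕ) :
    (s.setVar x k).var y = if y = x then k else s.var y := by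
  simp [Mem.setVar, Function.update_apply]

@[simp] theorem setVar_arr (s : Mem) (x k : ℕ) : (s.setVar x k).arr = s.arr := rfl

@[simp] theorem setArr_var (s : Mem) (a i k : ℕ) : (s.setArr a i k).var = s.var := rfl

@[simp] theorem setArr_arr (s : Mem) (a i k b : ℕ) :
    (s.setArr a i k).arr b = if b = a then Function.update (s.arr a) i k else s.arr b := by
  by_cases h : b = a
  · subst h; simp [Mem.setArr]
  · simp [Mem.setArr, h]

theorem Exec.frame {W : ℕ} {p : Prog} {s s' : Mem} {t : ℕ} (h : Exec W p s t s') :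
    Frame p.vars p.arrs s s' := by
  induction h with
  | skip s => exact Frame.refl _ _ _
  | assign s x e he =>
    refine ⟨fun y hy => ?_, fun _ _ => rfl⟩
    rw [setVar_var, if_neg (by simpa [Prog.vars] using hy)]
  | write s a i e hi he =>
    refine ⟨fun _ _ => rfl, fun b hb => ?_⟩
    rw [setArr_arr, if_neg (by simpa [Prog.arrs] using hb)]
  | seq hp hq ihp ihq =>
    exact ⟨fun x hx => (ihq.var x fun h => hx (List.mem_append_right _ h)).trans
        (ihp.var x fun h => hx (List.mem_append_left _ h)),
      fun x hx => (ihq.arr x fun h => hx (List.mem_append_right _ h)).trans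
        (ihp.arr x fun h => hx (List.mem_append_left _ h))⟩
  | iteTrue hb hp ih =>
    exact ⟨fun x hx => ih.var x fun h => hx (List.mem_append_left _ h),
      fun x hx => ih.arr x fun h => hx (List.mem_append_left _ h)⟩
  | iteFalse hb hp ih =>
    exact ⟨fun x hx => ih.var x fun h => hx (List.mem_append_right _ h),
      fun x hx => ih.arr x fun h => hx (List.mem_append_right _ h)⟩
  | loopDone hb => exact Frame.refl _ _ _
  | loopStep hb hp hl ihp ihl =>
    exact ihp.trans ihl (List.Subset.refl _) (List.Subset.refl _)

/-- The frame is passed on along with the postcondition. Specifications therefore mention only what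
changes, and the survival of other variables and arrays reduces to a decidable non-membership. -/
theorem Run.mono {W : ℕ} {p : Prog} {s : Mem} {Q Q' : ℕ → Mem → Prop} (h : Run W p s Q)
    (hQ : ∀ t s', Frame p.vars p.arrs s s' → Q t s' → Q' t s') : Run W p s Q' := by
  obtain ⟨t, s', he, hq⟩ := h
  exact ⟨t, s', he, hQ t s' he.frame hq⟩

theorem run_skip {W : ℕ} {s : Mem} {Q : ℕ → Mem → Prop} (h : Q 1 s) : Run W .skip s Q :=
  ⟨_, _, .skip s, h⟩

theorem run_assign {W x : ℕ} {e : Expr} {s : Mem} {Q : ℕ → Mem → Prop} (he : e.eval s ≤ W)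
    (h : Q (e.cost + 1) (s.setVar x (e.eval s))) : Run W (.assign x e) s Q :=
  ⟨_, _, .assign s x e he, h⟩

theorem run_write {W a : ℕ} {i e : Expr} {s : Mem} {Q : ℕ → Mem → Prop} (hi : i.eval s ≤ W)
    (he : e.eval s ≤ W)
    (h : Q (i.cost + e.cost + 1) (s.setArr a (i.eval s) (e.eval s))) : Run W (.write a i e) s Q :=
  ⟨_, _, .write s a i e hi he, h⟩

theorem run_seq {W : ℕ} {p q : Prog} {s : Mem} {Q : ℕ → Mem → Prop}
    (h : Run W p s fun t s' => Run W q s' fun t' s'' => Q (t + t') s'') :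
    Run W (.seq p q) s Q := by
  obtain ⟨t, s', h1, t', s'', h2, h3⟩ := h
  exact ⟨_, _, .seq h1 h2, h3⟩

theorem run_ite {W : ℕ} {b : Test} {p q : Prog} {s : Mem} {Q : ℕ → Mem → Prop}
    (hp : b.holds s → Run W p s fun t s' => Q (b.cost + t) s')
    (hq : ¬ b.holds s → Run W q s fun t s' => Q (b.cost + t) s') : Run W (.ite b p q) s Q := by
  by_cases h : b.holds s
  · obtain ⟨t, s', h1, h2⟩ := hp h
    exact ⟨_, _, .iteTrue h h1, h2⟩
  · obtain ⟨t, s', h1, h2⟩ := hq h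
    exact ⟨_, _, .iteFalse h h1, h2⟩

/-! ### Counting loops -/

/-- The loop with counter `i` and upper limit `hi` (exclusive). -/
def forLoop (i hi : ℕ) (body : Prog) : Prog :=
  .loop (.lt (.var i) (.var hi)) (.seq body (.assign i (.add (.var i) (.const 1))))

/-- The invariant carries the elapsed time, with the pending test (three units) already paid. An
iteration adds `7`: four units for the increment and three for the next test. -/
theorem run_forLoop {W i hi N : ℕ} {body : Prog} {s₀ : Mem} (I : ℕ → ℕ → Mem → Prop)
    (hvi : i ∉ body.vars) (hvh : hi ∉ body.vars) (hne : i ≠ hi) (hN : s₀.var hi = N) (hNW : N ≤ W)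
    (hle : s₀.var i ≤ N) (h0 : I (s₀.var i) 3 s₀)
    (step : ∀ j τ s, s₀.var i ≤ j → j < N → s.var i = j → Frame (i :: body.vars) body.arrs s₀ s →
      I j τ s → Run W body s fun t s' => I (j + 1) (τ + t + 7) (s'.setVar i (j + 1))) :
    Run W (forLoop i hi body) s₀ fun t s' => I N t s' := by
  suffices H : ∀ d j τ s, j + d = N → s₀.var i ≤ j → s.var i = j →
      Frame (i :: body.vars) body.arrs s₀ s → I j (τ + 3) s →
      ∃ t s', Exec W (forLoop i hi body) s t s' ∧ I N (τ + t) s' by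
    obtain ⟨t, s', h1, h2⟩ := H (N - s₀.var i) (s₀.var i) 0 s₀ (by omega) le_rfl rfl
      (Frame.refl _ _ _) h0
    exact ⟨t, s', h1, by simpa using h2⟩
  intro d
  induction d with
  | zero =>
    intro j τ s hj _ hs hF hI
    have hh : s.var hi = N := (hF.var hi (by simp [hvh, hne.symm])).trans hN
    obtain rfl : j = N := by omega
    refine ⟨_, _, .loopDone ?_, hI⟩
    simp [Test.holds, Expr.eval, hh, hs]
  | succ d ih =>
    intro j τ s hj hj0 hs hF hI
    have hh : s.var hi = N := (hF.var hi (by simp [hvh, hne.symm])).trans hN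
    obtain ⟨t, s', he, hI'⟩ := step j (τ + 3) s hj0 (by omega) hs hF hI
    have hi' : s'.var i = j := (he.frame.var i hvi).trans hs
    have hF' : Frame (i :: body.vars) body.arrs s₀ (s'.setVar i (j + 1)) := by
      refine ⟨fun x hx => ?_, fun a ha => ?_⟩
      · simp only [List.mem_cons, not_or] at hx
        rw [setVar_var, if_neg hx.1, he.frame.var x hx.2, hF.var x (by simp [hx])]
      · rw [setVar_arr, he.frame.arr a ha, hF.arr a ha]
    obtain ⟨t', s'', he', hI''⟩ := ih (j + 1) (τ + t + 7) (s'.setVar i (j + 1)) (by omega)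
      (by omega) (by simp) hF' (by rwa [show τ + t + 7 + 3 = τ + 3 + t + 7 by omega])
    have hassign : Exec W (.assign i (.add (.var i) (.const 1))) s' 4 (s'.setVar i (j + 1)) := by
      have := Exec.assign (W := W) s' i (.add (.var i) (.const 1))
        (by simp only [Expr.eval, hi']; omega)
      simpa [Expr.eval, Expr.cost, hi'] using this
    refine ⟨_, _, .loopStep ?_ (.seq he hassign) he', ?_⟩
    · simp only [Test.holds, Expr.eval, hs, hh]; omega
    · simp only [Test.cost, Expr.cost]
      rwa [show τ + (1 + 1 + 1 + (t + 4) + t') = τ + t + 7 + t' by omega]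

/-! ### Adjacency lists -/

/-- Adjacency of natural numbers, understood as vertices. -/
def NAdj {n : ℕ} (G : SimpleGraph (Fin n)) (u v : ℕ) : Prop :=
  ∃ (hu : u < n) (hv : v < n), G.Adj ⟨u, hu⟩ ⟨v, hv⟩

theorem NAdj.symm {n : ℕ} {G : SimpleGraph (Fin n)} {u v : ℕ} (h : NAdj G u v) : NAdj G v u :=
  ⟨h.2.1, h.1, h.2.2.symm⟩

theorem NAdj.left_lt {n : ℕ} {G : SimpleGraph (Fin n)} {u v : ℕ} (h : NAdj G u v) : u < n := h.1

theorem NAdj.right_lt {n : ℕ} {G : SimpleGraph (Fin n)} {u v : ℕ} (h : NAdj G u v) : v < n := h.2.1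

@[simp] theorem nadj_coe {n : ℕ} {G : SimpleGraph (Fin n)} {u v : Fin n} :
    NAdj G u v ↔ G.Adj u v :=
  ⟨fun h => h.2.2, fun h => ⟨u.2, v.2, h⟩⟩

theorem IsAdjacencyLists.nbr_iff {n : ℕ} {G : SimpleGraph (Fin n)} {off nbr : ℕ → ℕ}
    (hA : IsAdjacencyLists G off nbr) {v : ℕ} (hv : v < n) (w : ℕ) :
    (∃ i, off v ≤ i ∧ i < off (v + 1) ∧ nbr i = w) ↔ NAdj G v w := by
  have h := hA.nbr_image ⟨v, hv⟩
  have h' : w ∈ nbr '' Set.Ico (off v) (off (v + 1)) ↔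
      w ∈ (fun w : Fin n => (w : ℕ)) '' G.neighborSet ⟨v, hv⟩ := by rw [h]
  simp only [Set.mem_image, Set.mem_Ico, SimpleGraph.mem_neighborSet] at h'
  constructor
  · rintro ⟨i, h1, h2, h3⟩
    obtain ⟨u, hu, rfl⟩ := h'.1 ⟨i, ⟨h1, h2⟩, h3⟩
    exact ⟨hv, u.2, hu⟩
  · rintro ⟨_, hw, h⟩
    obtain ⟨i, ⟨h1, h2⟩, h3⟩ := h'.2 ⟨⟨w, hw⟩, h, rfl⟩
    exact ⟨i, h1, h2, h3⟩

theorem IsAdjacencyLists.off_le {n : ℕ} {G : SimpleGraph (Fin n)} {off nbr : ℕ → ℕ}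
    (hA : IsAdjacencyLists G off nbr) {a b : ℕ} (hab : a ≤ b) (hb : b ≤ n) : off a ≤ off b := by
  induction b, hab using Nat.le_induction with
  | base => exact le_rfl
  | succ b hab ih => exact (ih (by omega)).trans (hA.off_mono b (by omega))

/-- The degree of a vertex, read off from the adjacency lists. -/
def deg (off : ℕ → ℕ) (v : ℕ) : ℕ := off (v + 1) - off v

theorem IsAdjacencyLists.sum_deg {n : ℕ} {G : SimpleGraph (Fin n)} {off nbr : ℕ → ℕ}
    (hA : IsAdjacencyLists G off nbr) : ∑ v ∈ Finset.range n, deg off v = off n := by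
  have : ∀ k ≤ n, ∑ v ∈ Finset.range k, deg off v = off k := by
    intro k
    induction k with
    | zero => simp [hA.off_zero]
    | succ k ih =>
      intro hk
      rw [Finset.sum_range_succ, ih (by omega)]
      have := hA.off_mono k (by omega)
      simp only [deg]; omega
  exact this n le_rfl

/-- The handshake lemma, by which bounds in `n + off n` become bounds in the numbers of vertices and
edges. -/
theorem IsAdjacencyLists.off_eq {n : ℕ} {G : SimpleGraph (Fin n)} {off nbr : ℕ → ℕ}
    (hA : IsAdjacencyLists G off nbr) : off n = 2 * G.edgeSet.ncard := by
  classical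
  rw [← hA.sum_deg, ← Fin.sum_univ_eq_sum_range, Set.ncard_eq_toFinset_card',
    ← SimpleGraph.edgeFinset, ← G.sum_degrees_eq_twice_card_edges]
  refine Finset.sum_congr rfl fun v _ => ?_
  have h1 : (nbr '' Set.Ico (off v) (off (v + 1))).ncard = deg off v := by
    rw [(hA.nbr_injOn v v.2).ncard_image, ← Finset.coe_Ico, Set.ncard_coe_finset,
      Nat.card_Ico, deg]
  rw [← h1, hA.nbr_image v, Set.ncard_image_of_injective _ Fin.val_injective,
    Set.ncard_eq_toFinset_card', ← SimpleGraph.card_neighborSet_eq_degree, Set.toFinset_card]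

/-- The graph is in memory, and words are large enough. -/
structure Loaded (n : ℕ) (off nbr : ℕ → ℕ) (s : Mem) : Prop where
  var : s.var 0 = n
  off : s.arr 0 = off
  nbr : s.arr 1 = nbr

theorem Loaded.frame {n : ℕ} {off nbr : ℕ → ℕ} {s s' : Mem} {vs as : List ℕ}
    (h : Loaded n off nbr s) (hF : Frame vs as s s') (hv : 0 ∉ vs) (h0 : 0 ∉ as) (h1 : 1 ∉ as) :
    Loaded n off nbr s' :=
  ⟨(hF.var 0 hv).trans h.var, (hF.arr 0 h0).trans h.off, (hF.arr 1 h1).trans h.nbr⟩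

/-! ### Loops over the vertices and over the neighbours of a vertex -/

/-- Run `body` with variable `3` taking the values `0, …, n - 1`. -/
def forV (body : Prog) : Prog :=
  .seq (.assign 3 (.const 0)) (forLoop 3 0 body)

/-- The time bound `T j` may depend on the vertex, so that a pass over its neighbours can be charged
to its degree. The `5` consists of the initial assignment and the first test. -/
theorem run_forV {W n : ℕ} {body : Prog} {s₀ : Mem} (I : ℕ → Mem → Prop) (T : ℕ → ℕ)
    (hn : s₀.var 0 = n) (hW : n ≤ W) (h3 : 3 ∉ body.vars) (hv0 : 0 ∉ body.vars)
    (hI : ∀ j s k, I j s → I j (s.setVar 3 k)) (h0 : I 0 s₀)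
    (step : ∀ j s, j < n → s.var 3 = j → Frame (3 :: body.vars) body.arrs s₀ s → I j s →
      Run W body s fun t s' => t ≤ T j ∧ I (j + 1) s') :
    Run W (forV body) s₀ fun t s' => t ≤ ∑ j ∈ Finset.range n, (T j + 7) + 5 ∧ I n s' := by
  refine run_seq (run_assign (by simp [Expr.eval]) ?_)
  simp only [Expr.eval, Expr.cost]
  refine (run_forLoop (N := n) (fun j τ s => τ ≤ ∑ j ∈ Finset.range j, (T j + 7) + 3 ∧ I j s)
    h3 hv0 (by decide) (by simpa using hn) hW (by simp) ?_ ?_).mono ?_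
  · simpa using hI _ _ 0 h0
  · intro j τ s _ hj hs hF hIj
    have hF' : Frame (3 :: body.vars) body.arrs s₀ s := by
      refine ⟨fun x hx => (hF.var x hx).trans ?_, fun a ha => hF.arr a ha⟩
      rw [setVar_var, if_neg]
      rintro rfl
      simp at hx
    refine (step j s hj hs hF' hIj.2).mono fun t s' _ ht => ⟨?_, hI _ _ _ ht.2⟩
    rw [Finset.sum_range_succ]
    have h1 := ht.1
    have h2 := hIj.1
    omega
  · intro t s' _ h
    exact ⟨by omega, h.2⟩

/-- The neighbours of `v` in the adjacency lists. -/
def nbrs (off nbr : ℕ → ℕ) (v : ℕ) : Finset ℕ := (Finset.Ico (off v) (off (v + 1))).image nbr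

theorem IsAdjacencyLists.mem_nbrs {n : ℕ} {G : SimpleGraph (Fin n)} {off nbr : ℕ → ℕ}
    (hA : IsAdjacencyLists G off nbr) {v : ℕ} (hv : v < n) {w : ℕ} :
    w ∈ nbrs off nbr v ↔ NAdj G v w := by
  rw [← hA.nbr_iff hv]
  simp [nbrs, and_assoc]

/-- Run `body` with variable `7` ranging over the neighbours of the vertex in variable `4`. -/
def forE (body : Prog) : Prog :=
  .seq (.assign 5 (.read 0 (.var 4))) (.seq (.assign 6 (.read 0 (.add (.var 4) (.const 1))))
    (forLoop 5 6 (.seq (.assign 7 (.read 1 (.var 5))) body)))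

/-- The invariant is indexed by the set of neighbours already visited, so the order of the adjacency
list plays no role. The absence of repetitions becomes `w ∉ D`, on which all counting relies. -/
theorem run_forE {W n : ℕ} {G : SimpleGraph (Fin n)} {off nbr : ℕ → ℕ}
    (hA : IsAdjacencyLists G off nbr) (hW : n + off n + 4 ≤ W) {body : Prog} {s₀ : Mem}
    (hs₀ : Loaded n off nbr s₀) {v : ℕ} (hv : v < n) (hv4 : s₀.var 4 = v)
    (I : Finset ℕ → Mem → Prop) (B : ℕ)
    (hvars : ∀ x ∈ [0, 4, 5, 6], x ∉ body.vars) (harrs : ∀ x ∈ [0, 1], x ∉ body.arrs)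
    (hI : ∀ D s x k, x = 5 ∨ x = 6 ∨ x = 7 → I D s → I D (s.setVar x k)) (h0 : I ∅ s₀)
    (step : ∀ D s w, D ⊆ nbrs off nbr v → w ∉ D → NAdj G v w → s.var 7 = w →
      Frame (5 :: 6 :: 7 :: body.vars) body.arrs s₀ s → I D s →
      Run W body s fun t s' => t ≤ B ∧ I (insert w D) s') :
    Run W (forE body) s₀ fun t s' => t ≤ (B + 10) * deg off v + 12 ∧ I (nbrs off nbr v) s' := by
  have hv1 : off (v + 1) ≤ off n := hA.off_le (by omega) le_rfl
  have hv2 : off v ≤ off (v + 1) := hA.off_mono v hv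
  simp only [List.mem_cons, List.not_mem_nil, or_false, forall_eq_or_imp, forall_eq] at hvars harrs
  refine run_seq (run_assign (by simp [Expr.eval, hs₀.off, hv4]; omega) ?_)
  refine run_seq (run_assign (by simp [Expr.eval, hs₀.off, hv4]; omega) ?_)
  simp only [Expr.eval, Expr.cost, setVar_arr, setVar_var, hs₀.off, hv4]
  set s₁ := (s₀.setVar 5 (off v)).setVar 6 (off (v + 1)) with hs₁
  have hF₁ : Frame (5 :: 6 :: 7 :: body.vars) body.arrs s₀ s₁ := by
    refine ⟨fun x hx => ?_, fun a ha => rfl⟩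
    simp only [List.mem_cons, not_or] at hx
    simp [hs₁, hx]
  have hb7 : (Prog.seq (.assign 7 (.read 1 (.var 5))) body).vars = 7 :: body.vars := rfl
  have hb7' : (Prog.seq (.assign 7 (.read 1 (.var 5))) body).arrs = body.arrs := rfl
  refine (run_forLoop (N := off (v + 1))
    (fun j τ s => τ ≤ (B + 10) * (j - off v) + 3 ∧
      I ((Finset.Ico (off v) j).image nbr) s) ?_ ?_ (by decide) (by simp) (by omega)
      (by simpa [hs₁] using hv2) ?_ ?_).mono ?_
  · rw [hb7]; simp [hvars]
  · rw [hb7]; simp [hvars]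
  · simpa [hs₁] using hI _ _ _ _ (.inr (.inl rfl)) (hI _ _ _ _ (.inl rfl) h0)
  · intro j τ s hj hj' hs hF hIj
    rw [hb7, hb7'] at hF
    have hj0 : off v ≤ j := by simpa [hs₁] using hj
    have hF' : Frame (5 :: 6 :: 7 :: body.vars) body.arrs s₀ s :=
      hF₁.trans hF (by intro x; simp; tauto) (List.Subset.refl _)
    have hnbr : s.arr 1 = nbr := (hF'.arr 1 harrs.2).trans hs₀.nbr
    have hadj : NAdj G v (nbr j) := (hA.nbr_iff hv _).1 ⟨j, hj0, hj', rfl⟩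
    have hlt := hadj.right_lt
    refine run_seq (run_assign (by simp [Expr.eval, hnbr, hs]; omega) ?_)
    simp only [Expr.eval, Expr.cost, hnbr, hs]
    have hnot : nbr j ∉ (Finset.Ico (off v) j).image nbr := by
      simp only [Finset.mem_image, Finset.mem_Ico, not_exists, not_and]
      intro i hi hij
      have := hA.nbr_injOn v hv (show i ∈ Set.Ico _ _ from ⟨hi.1, by omega⟩)
        (show j ∈ Set.Ico _ _ from ⟨hj0, hj'⟩) hij
      omega
    have hins : insert (nbr j) ((Finset.Ico (off v) j).image nbr) =
        (Finset.Ico (off v) (j + 1)).image nbr := by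
      rw [← Finset.image_insert, Finset.insert_Ico_right_eq_Ico_add_one hj0]
    refine (step _ (s.setVar 7 (nbr j)) (nbr j) ?_ hnot hadj (by simp) ?_
      (hI _ _ _ _ (.inr (.inr rfl)) hIj.2)).mono fun t s' _ ht => ⟨?_, ?_⟩
    · exact Finset.image_subset_image (Finset.Ico_subset_Ico_right hj'.le)
    · refine ⟨fun x hx => ?_, fun a ha => hF'.arr a ha⟩
      rw [setVar_var, if_neg, hF'.var x hx]
      rintro rfl
      simp at hx
    · have h1 := hIj.1
      have h2 := ht.1
      rw [show j + 1 - off v = (j - off v) + 1 by omega, Nat.mul_add]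
      omega
    · rw [← hins]
      exact hI _ _ _ _ (.inl rfl) ht.2
  · intro t s' _ h
    refine ⟨?_, h.2⟩
    have := h.1
    simp only [deg]
    omega

/-- A cost per vertex that is affine in the degree gives a linear total; `1 ≤ n` absorbs the
constant. Here `W` is a mere factor, unrelated to word size. -/
theorem sum_time {W A B n E : ℕ} {f : ℕ → ℕ} (h : ∑ j ∈ Finset.range n, f j = E) (hn : 1 ≤ n)
    (hW : A + B + 12 ≤ W) :
    ∑ j ∈ Finset.range n, (A * f j + B + 7) + 5 ≤ W * (n + E) := by
  simp only [Finset.sum_add_distrib, ← Finset.mul_sum, h, Finset.sum_const, Finset.card_range,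
    smul_eq_mul]
  calc A * E + n * B + n * 7 + 5 ≤ (A + B + 12) * (n + E) := by nlinarith [Nat.zero_le (B * E)]
    _ ≤ W * (n + E) := Nat.mul_le_mul_right _ hW

/-! ### Breadth-first search -/

/-- The result of a breadth-first search from the set `S`: `lev` holds the levels, and `Q` lists
the vertices in the order of their levels. -/
structure BfsOut {n : ℕ} (G : SimpleGraph (Fin n)) (S : Set ℕ) (lev Q : ℕ → ℕ) : Prop where
  Q_lt : ∀ i < n, Q i < n
  inj : ∀ i < n, ∀ j < n, Q i = Q j → i = j
  surj : ∀ v < n, ∃ i < n, Q i = v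
  lev_lt : ∀ v < n, lev v < n
  zero : ∀ v < n, lev v = 0 ↔ v ∈ S
  mono : ∀ i j, i ≤ j → j < n → lev (Q i) ≤ lev (Q j)
  step : ∀ u v, NAdj G u v → lev v ≤ lev u + 1
  pred : ∀ v < n, lev v ≠ 0 → ∃ u, NAdj G u v ∧ lev u + 1 = lev v

/-- The invariant of breadth-first search: `tail` vertices have been found, and the first `h` of
them have been processed. -/
structure BfsInv {n : ℕ} (G : SimpleGraph (Fin n)) (S : Set ℕ) (lev Q : ℕ → ℕ) (h tail : ℕ) :
    Prop where
  Q_lt : ∀ i < tail, Q i < n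
  inj : ∀ i < tail, ∀ j < tail, Q i = Q j → i = j
  lev_le : ∀ i < tail, lev (Q i) ≤ i
  unseen : ∀ v < n, (∀ i < tail, Q i ≠ v) → lev v = n
  zero : ∀ v < n, lev v = 0 ↔ v ∈ S
  mono : ∀ i j, i ≤ j → j < tail → lev (Q i) ≤ lev (Q j)
  near : h < tail → ∀ j < tail, lev (Q j) ≤ lev (Q h) + 1
  done : ∀ i < h, ∀ w, NAdj G (Q i) w → lev w ≤ lev (Q i) + 1 ∧ ∃ j < tail, Q j = w
  pred : ∀ i < tail, lev (Q i) ≠ 0 → ∃ u, NAdj G u (Q i) ∧ lev u + 1 = lev (Q i)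
  h_le : h ≤ tail
  pos : 0 < tail

theorem le_of_injOn_lt {n k : ℕ} {Q : ℕ → ℕ} (hlt : ∀ i < k, Q i < n)
    (hinj : ∀ i < k, ∀ j < k, Q i = Q j → i = j) : k ≤ n := by
  simpa using Finset.card_le_card_of_injOn (s := Finset.range k) (t := Finset.range n) Q
    (by simpa [Set.MapsTo] using hlt)
    (by intro i hi j hj h; simp at hi hj; exact hinj i hi j hj h)

theorem surj_of_injOn_lt {n : ℕ} {Q : ℕ → ℕ} (hlt : ∀ i < n, Q i < n)
    (hinj : ∀ i < n, ∀ j < n, Q i = Q j → i = j) : ∀ v < n, ∃ i < n, Q i = v := by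
  intro v hv
  have := Finset.surjOn_of_injOn_of_card_le (s := Finset.range n) (t := Finset.range n) Q
    (by simpa [Set.MapsTo] using hlt)
    (by intro i hi j hj h; simp at hi hj; exact hinj i hi j hj h) le_rfl
  obtain ⟨i, hi, rfl⟩ := this (show v ∈ (↑(Finset.range n) : Set ℕ) by simpa using hv)
  exact ⟨i, by simpa using hi, rfl⟩

theorem sum_comp_of_injOn {n : ℕ} {Q f : ℕ → ℕ} (hlt : ∀ i < n, Q i < n)
    (hinj : ∀ i < n, ∀ j < n, Q i = Q j → i = j) :
    ∑ i ∈ Finset.range n, f (Q i) = ∑ v ∈ Finset.range n, f v := by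
  refine Finset.sum_bij (fun i _ => Q i) (by simpa using hlt) ?_ ?_ (fun _ _ => rfl)
  · intro i hi j hj h; simp at hi hj; exact hinj i hi j hj h
  · intro v hv
    obtain ⟨i, hi, h⟩ := surj_of_injOn_lt hlt hinj v (by simpa using hv)
    exact ⟨i, by simpa using hi, h⟩

theorem forall_of_nadj {n : ℕ} {G : SimpleGraph (Fin n)} (hc : G.Connected) {P : ℕ → Prop}
    {u : ℕ} (hu : u < n) (hPu : P u) (hP : ∀ u v, NAdj G u v → P u → P v) {v : ℕ} (hv : v < n) :
    P v := by
  obtain ⟨p⟩ := hc.preconnected ⟨u, hu⟩ ⟨v, hv⟩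
  have : ∀ {a b : Fin n}, G.Walk a b → P a → P b := by
    intro a b p
    induction p with
    | nil => exact id
    | cons h _ ih => exact fun ha => ih (hP _ _ (nadj_coe.2 h) ha)
  exact this p hPu

section

variable {n : ℕ} {G : SimpleGraph (Fin n)} {S : Set ℕ} {lev Q : ℕ → ℕ} {h tail : ℕ}

theorem BfsInv.tail_le (H : BfsInv G S lev Q h tail) : tail ≤ n := le_of_injOn_lt H.Q_lt H.inj

/-- If the queue ran empty early, the vertices found would be closed under adjacency, hence all
vertices by connectedness. The search may therefore be a counting loop up to `n`. -/
theorem BfsInv.lt_tail (H : BfsInv G S lev Q h tail) (hc : G.Connected) (hn : h < n) :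
    h < tail := by
  by_contra hlt
  obtain rfl : h = tail := le_antisymm H.h_le (not_lt.1 hlt)
  have hall : ∀ v < n, ∃ i < h, Q i = v := fun v hv =>
    forall_of_nadj hc (P := fun v => ∃ i < h, Q i = v) (H.Q_lt 0 H.pos) ⟨0, H.pos, rfl⟩ (by
      rintro _ v huv ⟨i, hi, rfl⟩
      exact (H.done i hi v huv).2) hv
  have : n ≤ h := by
    choose! f hf using hall
    refine le_of_injOn_lt (Q := f) (fun v hv => (hf v hv).1) fun u hu v hv huv => ?_
    rw [← (hf u hu).2, ← (hf v hv).2, huv]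
  omega

/-- A vertex found as number `i` has level at most `i`, which is less than `n`; so the value `n`
safely marks the vertices not yet found. -/
theorem BfsInv.ne_of_lev (H : BfsInv G S lev Q h tail) {w : ℕ} (hw : lev w = n) :
    ∀ i < tail, Q i ≠ w := by
  rintro i hi rfl
  have := H.lev_le i hi
  have := H.tail_le
  omega

/-- The queue stays sorted because all levels in it are at most one above that of the head, which is
the level the new vertex gets. -/
theorem BfsInv.push (H : BfsInv G S lev Q h tail) (hh : h < tail) {w : ℕ} (hw : lev w = n)
    (hadj : NAdj G (Q h) w) :
    BfsInv G S (Function.update lev w (lev (Q h) + 1)) (Function.update Q tail w) h (tail + 1) := by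
  have hne := H.ne_of_lev hw
  have hn : 0 < n := lt_of_le_of_lt (Nat.zero_le _) hadj.left_lt
  have hQ : ∀ i < tail, Function.update Q tail w i = Q i := fun i hi =>
    Function.update_of_ne hi.ne _ _
  have hQt : Function.update Q tail w tail = w := Function.update_self _ _ _
  have hl : ∀ i < tail, Function.update lev w (lev (Q h) + 1) (Q i) = lev (Q i) := fun i hi =>
    Function.update_of_ne (hne i hi) _ _
  have hlw : Function.update lev w (lev (Q h) + 1) w = lev (Q h) + 1 := Function.update_self _ _ _
  have hcases : ∀ i, i < tail + 1 → i < tail ∨ i = tail := fun i hi => by omega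
  refine ⟨?_, ?_, ?_, ?_, ?_, ?_, ?_, ?_, ?_, by have := H.h_le; omega, by omega⟩
  · intro i hi
    rcases hcases i hi with hi | rfl
    · rw [hQ i hi]; exact H.Q_lt i hi
    · rw [hQt]; exact hadj.right_lt
  · intro i hi j hj hij
    rcases hcases i hi with hi | rfl <;> rcases hcases j hj with hj | rfl
    · rw [hQ i hi, hQ j hj] at hij; exact H.inj i hi j hj hij
    · rw [hQ i hi, hQt] at hij; exact absurd hij (hne i hi)
    · rw [hQ j hj, hQt] at hij; exact absurd hij.symm (hne j hj)
    · rfl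
  · intro i hi
    rcases hcases i hi with hi | rfl
    · rw [hQ i hi, hl i hi]; exact H.lev_le i hi
    · rw [hQt, hlw]; have := H.lev_le h hh; omega
  · intro v hv hvn
    have hvw : v ≠ w := fun e => hvn tail (by omega) (hQt.trans e.symm)
    rw [Function.update_of_ne hvw]
    exact H.unseen v hv fun i hi => by rw [← hQ i hi]; exact hvn i (by omega)
  · intro v hv
    rw [← H.zero v hv]
    by_cases hvw : v = w
    · subst hvw; rw [hlw]; omega
    · rw [Function.update_of_ne hvw]
  · intro i j hij hj
    rcases hcases j hj with hj | rfl
    · rw [hQ i (by omega), hQ j hj, hl i (by omega), hl j hj]; exact H.mono i j hij hj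
    · rcases hcases i (by omega) with hi | rfl
      · rw [hQ i hi, hQt, hl i hi, hlw]; exact H.near hh i hi
      · exact le_rfl
  · intro _ j hj
    rw [hQ h hh, hl h hh]
    rcases hcases j hj with hj | rfl
    · rw [hQ j hj, hl j hj]; exact H.near hh j hj
    · rw [hQt, hlw]
  · intro i hi u hu
    rw [hQ i (by omega)] at hu ⊢
    rw [hl i (by omega)]
    obtain ⟨h1, j, hj, rfl⟩ := H.done i hi u hu
    rw [hl j hj]
    exact ⟨h1, j, by omega, hQ j hj⟩
  · intro i hi h0
    rcases hcases i hi with hi | rfl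
    · rw [hQ i hi, hl i hi] at h0 ⊢
      obtain ⟨u, hu, hlu⟩ := H.pred i hi h0
      refine ⟨u, hu, ?_⟩
      rw [Function.update_of_ne ?_]
      · exact hlu
      · rintro rfl
        have := H.lev_le i hi
        have := H.tail_le
        omega
    · rw [hQt, hlw]
      exact ⟨Q h, hadj, by rw [hl h hh]⟩

theorem BfsInv.advance (H : BfsInv G S lev Q h tail) (hh : h < tail)
    (hdone : ∀ w, NAdj G (Q h) w → lev w ≤ lev (Q h) + 1 ∧ ∃ j < tail, Q j = w) :
    BfsInv G S lev Q (h + 1) tail where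
  Q_lt := H.Q_lt
  inj := H.inj
  lev_le := H.lev_le
  unseen := H.unseen
  zero := H.zero
  mono := H.mono
  near h1 j hj := (H.near hh j hj).trans (Nat.succ_le_succ (H.mono h (h + 1) (by omega) h1))
  done i hi w hw := by
    rcases Nat.lt_succ_iff_lt_or_eq.1 hi with hi | rfl
    · exact H.done i hi w hw
    · exact hdone w hw
  pred := H.pred
  h_le := hh
  pos := H.pos

theorem BfsInv.out (H : BfsInv G S lev Q n tail) : BfsOut G S lev Q := by
  obtain rfl : tail = n := le_antisymm H.tail_le H.h_le
  have hs := surj_of_injOn_lt H.Q_lt H.inj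
  refine ⟨H.Q_lt, H.inj, hs, ?_, H.zero, H.mono, ?_, ?_⟩
  · intro v hv
    obtain ⟨i, hi, rfl⟩ := hs v hv
    exact (H.lev_le i hi).trans_lt hi
  · intro u v huv
    obtain ⟨i, hi, rfl⟩ := hs u huv.left_lt
    exact (H.done i hi v huv).1
  · intro v hv
    obtain ⟨i, hi, rfl⟩ := hs v hv
    exact H.pred i hi

end

/-- Mark the vertex in variable `7` if it has not been found yet. -/
def bfsVisit : Prog :=
  .ite (.eq (.read 2 (.var 7)) (.var 0))
    (.seq (.write 2 (.var 7) (.add (.read 2 (.var 4)) (.const 1)))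
      (.seq (.write 3 (.var 8) (.var 7)) (.assign 8 (.add (.var 8) (.const 1))))) .skip

/-- Breadth-first search from the vertices in the first `var 8` cells of array `3`. -/
def bfs : Prog :=
  .seq (forV (.write 2 (.var 3) (.var 0)))
    (.seq (.seq (.assign 5 (.const 0)) (forLoop 5 8 (.write 2 (.read 3 (.var 5)) (.const 0))))
      (.seq (.assign 3 (.const 0))
        (forLoop 3 0 (.seq (.assign 4 (.read 3 (.var 3))) (forE bfsVisit)))))

variable {W n : ℕ} {G : SimpleGraph (Fin n)} {off nbr : ℕ → ℕ}

theorem run_fill {s : Mem} (hs : Loaded n off nbr s) (hW : n + off n + 4 ≤ W) {a : ℕ}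
    {e : Expr} {k : ℕ} (he : ∀ s', Frame [3] [a] s s' → e.eval s' = k)
    (hk : k ≤ W) :
    Run W (forV (.write a (.var 3) e)) s fun t s' =>
      t ≤ (e.cost + 9) * n + 5 ∧ ∀ v < n, s'.arr a v = k := by
  refine (run_forV (fun j s' => ∀ v < j, s'.arr a v = k) (fun _ => e.cost + 2) hs.var (by omega)
    (by simp [Prog.vars]) (by simp [Prog.vars]) (by simp) (by simp) ?_).mono ?_
  · intro j s' hj hs' hF hI
    have hek := he s' ⟨fun x hx => hF.var x hx, fun x hx => hF.arr x hx⟩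
    refine run_write (by simp [Expr.eval, hs']; omega) (by rw [hek]; exact hk) ?_
    refine ⟨by simp [Expr.cost]; omega, ?_⟩
    intro v hv
    simp only [Expr.eval, hs', hek, setArr_arr, if_true, Function.update_apply]
    split_ifs with h
    · rfl
    · exact hI v (by omega)
  · intro t s' _ h
    refine ⟨h.1.trans ?_, h.2⟩
    simp
    rw [Nat.mul_comm]

theorem run_bfs (hA : IsAdjacencyLists G off nbr) (hc : G.Connected) (hW : n + off n + 4 ≤ W)
    {s : Mem} (hs : Loaded n off nbr s) (htail : 0 < s.var 8) (hlt : ∀ i < s.var 8, s.arr 3 i < n)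
    (hinj : ∀ i < s.var 8, ∀ j < s.var 8, s.arr 3 i = s.arr 3 j → i = j) :
    Run W bfs s fun t s' => t ≤ 100 * (n + off n) ∧
      BfsOut G {v | ∃ i < s.var 8, s.arr 3 i = v} (s'.arr 2) (s'.arr 3) := by
  have hn : 0 < n := lt_of_le_of_lt (Nat.zero_le _) (hlt 0 htail)
  have htn := le_of_injOn_lt hlt hinj
  refine run_seq ((run_fill hs hW (a := 2) (k := n)
    (fun s' hF => by simp [Expr.eval, hF.var 0 (by decide), hs.var]) (by omega)).mono ?_)
  rintro t₁ s₁ hF₁ ⟨ht₁, hI₁⟩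
  have hs₁ := hs.frame hF₁ (by decide) (by decide) (by decide)
  have hv8 : s₁.var 8 = s.var 8 := hF₁.var 8 (by decide)
  have ha3 : s₁.arr 3 = s.arr 3 := hF₁.arr 3 (by decide)
  refine run_seq (run_seq (run_assign (by simp [Expr.eval]) ?_))
  simp only [Expr.eval, Expr.cost]
  refine (run_forLoop (N := s.var 8) (fun j τ s' => τ ≤ 11 * j + 3 ∧
    ∀ v < n, s'.arr 2 v = if ∃ i < j, s.arr 3 i = v then 0 else n) (by decide) (by decide)
    (by decide) (by simp [hv8]) (by omega) (by simp) ?_ ?_).mono ?_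
  · simpa using hI₁
  · intro j τ s' _ hj hj' hF hI
    have hv := hlt j hj
    have h3 : s'.arr 3 = s.arr 3 := (hF.arr 3 (by decide)).trans ha3
    refine run_write (by simp [Expr.eval, h3, hj']; omega) (by simp [Expr.eval]) ⟨?_, ?_⟩
    · simp only [Expr.cost]; omega
    · intro v hv
      simp only [Expr.eval, h3, hj', setVar_arr, setArr_arr, if_true, Function.update_apply]
      by_cases hvj : v = s.arr 3 j
      · rw [if_pos hvj, if_pos ⟨j, by omega, hvj.symm⟩]
      · rw [if_neg hvj, hI.2 v hv]
        congr 1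
        simp only [eq_iff_iff]
        constructor
        · rintro ⟨i, hi, h⟩; exact ⟨i, by omega, h⟩
        · rintro ⟨i, hi, h⟩
          rcases Nat.lt_succ_iff_lt_or_eq.1 hi with hi | rfl
          · exact ⟨i, hi, h⟩
          · exact absurd h.symm hvj
  rintro t₂ s₂ hF₂ ⟨ht₂, hI₂⟩
  have hs₂ : Loaded n off nbr s₂ :=
    (Loaded.mk (by simpa using hs₁.var) hs₁.off hs₁.nbr : Loaded n off nbr (s₁.setVar 5 0)).frame
      hF₂ (by decide) (by decide) (by decide)
  have hv8₂ : s₂.var 8 = s.var 8 := by rw [hF₂.var 8 (by decide)]; simp [hv8]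
  have ha3₂ : s₂.arr 3 = s.arr 3 := by rw [hF₂.arr 3 (by decide)]; simp [ha3]
  refine run_seq (run_assign (by simp [Expr.eval]) ?_)
  simp only [Expr.eval, Expr.cost]
  set S : Set ℕ := {v | ∃ i < s.var 8, s.arr 3 i = v} with hS
  have hinit : BfsInv G S (s₂.arr 2) (s₂.arr 3) 0 (s₂.var 8) := by
    have hz : ∀ i < s.var 8, s₂.arr 2 (s.arr 3 i) = 0 := fun i hi => by
      rw [hI₂ _ (hlt i hi), if_pos ⟨i, hi, rfl⟩]
    rw [hv8₂, ha3₂]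
    refine ⟨hlt, hinj, fun i hi => by simp [hz i hi], ?_, ?_, ?_, ?_, by simp, ?_, by omega, htail⟩
    · intro v hv hi
      rw [hI₂ v hv, if_neg (by simpa using hi)]
    · intro v hv
      rw [hI₂ v hv, hS]
      simp only [Set.mem_ofPred_eq]
      split_ifs with h
      · simp [h]
      · simp only [h, iff_false]; omega
    · intro i j hij hj
      rw [hz i (by omega)]; exact Nat.zero_le _
    · intro _ j hj
      rw [hz j hj]; exact Nat.zero_le _
    · intro i hi h
      exact absurd (hz i hi) h
  -- The time is charged to the degrees of the processed part of the queue; the inner loop leaves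
  -- that part unchanged. In the end the queue is a permutation of the vertices, and the degrees add
  -- up to `off n`.
  refine (run_forLoop (N := n) (fun h τ s' =>
    τ ≤ 40 * ∑ i ∈ Finset.range h, deg off (s'.arr 3 i) + 30 * h + 3 ∧
    BfsInv G S (s'.arr 2) (s'.arr 3) h (s'.var 8)) (by decide) (by decide)
    (by decide) (by simpa using hs₂.var) (by omega) (by simp) ?_ ?_).mono ?_
  · simpa using hinit
  · intro h τ s' _ hh hh' hF ⟨hτ, hinv⟩
    have hs' : Loaded n off nbr s' :=
      (Loaded.mk (by simpa using hs₂.var) hs₂.off hs₂.nbr : Loaded n off nbr (s₂.setVar 3 0)).frame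
        hF (by decide) (by decide) (by decide)
    have hht := hinv.lt_tail hc hh
    set v := s'.arr 3 h with hv
    have hvn : v < n := hinv.Q_lt h hht
    refine run_seq (run_assign (by simp only [Expr.eval, hh']; omega) ?_)
    simp only [Expr.eval, Expr.cost, hh', ← hv]
    refine (run_forE (body := bfsVisit) (s₀ := s'.setVar 4 v) hA hW
      (Loaded.mk (by simpa using hs'.var) hs'.off hs'.nbr) hvn (by simp)
      (fun D s'' => BfsInv G S (s''.arr 2) (s''.arr 3) h (s''.var 8) ∧ h < s''.var 8 ∧
        s''.arr 3 h = v ∧ (∀ i ≤ h, s''.arr 3 i = s'.arr 3 i) ∧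
        ∀ w ∈ D, s''.arr 2 w ≤ s''.arr 2 v + 1 ∧ ∃ j < s''.var 8, s''.arr 3 j = w) 24
      (by decide) (by decide) ?_ ?_ ?_).mono ?_
    · rintro D s'' x k (rfl | rfl | rfl) h <;> simpa using h
    · simpa using ⟨hinv, hht, hv.symm⟩
    · rintro D s'' w _ _ hvw hw hF'' ⟨hi, hht'', hQh, hQ, hD⟩
      have hn'' : s''.var 0 = n := by rw [hF''.var 0 (by decide)]; simpa using hs'.var
      have h4'' : s''.var 4 = v := by rw [hF''.var 4 (by decide)]; simp
      have hwn := hvw.right_lt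
      have htl := hi.tail_le
      refine run_ite (fun hb => ?_) (fun hb => ?_)
      · simp only [Test.holds, Expr.eval, hw, hn''] at hb
        have hpush := hi.push hht'' hb (by rw [hQh]; exact hvw)
        rw [hQh] at hpush
        have hlv := hi.lev_le h hht''
        rw [hQh] at hlv
        have hvw' : v ≠ w := by rintro rfl; omega
        have htl' := hpush.tail_le
        refine run_seq (run_write (by simp [Expr.eval, hw]; omega)
          (by simp [Expr.eval, h4'']; omega) ?_)
        refine run_seq (run_write (by simp [Expr.eval]; omega) (by simp [Expr.eval, hw]; omega) ?_)
        refine run_assign (by simp [Expr.eval]; omega) ?_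
        simp only [Expr.eval, Expr.cost, Test.cost, hw, h4'', setArr_var, setVar_var, setVar_arr,
          setArr_arr, if_true, if_false, Nat.reduceEqDiff]
        refine ⟨by omega, hpush, by omega, ?_, ?_, ?_⟩
        · rw [Function.update_of_ne (by omega)]; exact hQh
        · intro i hih
          rw [Function.update_of_ne (by omega)]; exact hQ i hih
        · intro u hu
          rw [Function.update_of_ne hvw']
          rcases Finset.mem_insert.1 hu with rfl | hu
          · exact ⟨by simp, s''.var 8, by omega, by simp⟩
          · obtain ⟨h1, j, hj, rfl⟩ := hD u hu
            refine ⟨?_, j, by omega, ?_⟩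
            · rw [Function.update_of_ne (hi.ne_of_lev hb j hj)]; exact h1
            · rw [Function.update_of_ne (by omega)]
      · simp only [Test.holds, Expr.eval, hw, hn''] at hb
        refine run_skip ⟨by simp [Test.cost, Expr.cost], hi, hht'', hQh, hQ, ?_⟩
        intro u hu
        rcases Finset.mem_insert.1 hu with rfl | hu
        · have : ∃ j < s''.var 8, s''.arr 3 j = u := by
            by_contra hne
            push Not at hne
            exact hb (hi.unseen u hwn hne)
          obtain ⟨j, hj, hju⟩ := this
          refine ⟨?_, j, hj, hju⟩
          have := hi.near hht'' j hj
          rwa [hju, hQh] at this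
        · exact hD u hu
    · rintro t s'' _ ⟨ht, hi, hht'', hQh, hQ, hD⟩
      refine ⟨?_, ?_⟩
      · simp only [setVar_arr]
        have hsum : ∑ i ∈ Finset.range (h + 1), deg off (s''.arr 3 i) =
            ∑ i ∈ Finset.range h, deg off (s'.arr 3 i) + deg off v := by
          rw [Finset.sum_range_succ, hQh]
          congr 1
          refine Finset.sum_congr rfl fun i hi => ?_
          rw [hQ i (by have := Finset.mem_range.1 hi; omega)]
        rw [hsum, Nat.mul_add]
        omega
      · simp only [setVar_arr, setVar_var, Nat.reduceEqDiff, if_false]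
        refine hi.advance hht'' fun w hw => ?_
        rw [hQh] at hw ⊢
        exact hD w ((hA.mem_nbrs hvn).2 hw)
  · rintro t₃ s₃ _ ⟨ht₃, hinv⟩
    have hout := hinv.out
    refine ⟨?_, hout⟩
    simp only [Expr.cost] at ht₁
    rw [sum_comp_of_injOn hout.Q_lt hout.inj (f := deg off), hA.sum_deg] at ht₃
    omega

section Levels

variable {S : Set ℕ} {lev Q : ℕ → ℕ}

theorem BfsOut.lev_le_add (H : BfsOut G S lev Q) (hc : G.Connected) (u v : Fin n) :
    lev v ≤ lev u + G.dist u v := by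
  obtain ⟨p, hp⟩ := hc.exists_walk_length_eq_dist u v
  rw [← hp]
  clear hp
  induction p with
  | nil => simp
  | cons h p ih =>
    have := H.step _ _ (nadj_coe.2 h)
    rw [SimpleGraph.Walk.length_cons]
    omega

/-- Following predecessors down to level zero gives the upper bound; levels change by at most one
along an edge, which gives the lower bound. -/
theorem BfsOut.exists_dist_eq (H : BfsOut G S lev Q) (hc : G.Connected) (v : Fin n) :
    ∃ s : Fin n, (s : ℕ) ∈ S ∧ G.dist s v = lev v := by
  suffices h : ∀ k, ∀ v : Fin n, lev v = k → ∃ s : Fin n, (s : ℕ) ∈ S ∧ G.dist s v ≤ lev v by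
    obtain ⟨s, hs, hd⟩ := h _ v rfl
    have := H.lev_le_add hc s v
    have := (H.zero s s.2).2 hs
    exact ⟨s, hs, by omega⟩
  intro k
  induction k with
  | zero => exact fun v hv => ⟨v, (H.zero v v.2).1 hv, by simp⟩
  | succ k ih =>
    intro v hv
    obtain ⟨u, hu, hl⟩ := H.pred v v.2 (by omega)
    obtain ⟨s, hs, hd⟩ := ih ⟨u, hu.left_lt⟩ (by dsimp; omega)
    refine ⟨s, hs, ?_⟩
    have h1 := hc.dist_triangle (u := s) (v := ⟨u, hu.left_lt⟩) (w := v)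
    have h2 := SimpleGraph.dist_eq_one_iff_adj.2 hu.2.2
    simp only [Fin.eta] at h2
    dsimp at hd
    omega

theorem BfsOut.lev_le_dist (H : BfsOut G S lev Q) (hc : G.Connected) {s v : Fin n}
    (hs : (s : ℕ) ∈ S) : lev v ≤ G.dist s v := by
  have h1 := H.lev_le_add hc s v
  have h2 := (H.zero s s.2).2 hs
  omega

theorem BfsOut.lev_eq_dist {c : Fin n} (H : BfsOut G {(c : ℕ)} lev Q) (hc : G.Connected)
    (v : Fin n) : lev v = G.dist c v := by
  obtain ⟨s, hs, hd⟩ := H.exists_dist_eq hc v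
  obtain rfl : s = c := Fin.ext hs
  exact hd.symm

/-- This is how a farthest vertex, and with it an eccentricity, is read off from the last cell of
the queue. -/
theorem BfsOut.lev_le_last (H : BfsOut G S lev Q) {v : ℕ} (hv : v < n) :
    lev v ≤ lev (Q (n - 1)) := by
  obtain ⟨i, hi, rfl⟩ := H.surj v hv
  exact H.mono i (n - 1) (by omega) (by omega)

end Levels

theorem Loaded.setVar {s : Mem} (h : Loaded n off nbr s) {x k : ℕ} (hx : x ≠ 0) :
    Loaded n off nbr (s.setVar x k) :=
  ⟨by simp [hx.symm, h.var], h.off, h.nbr⟩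

theorem Loaded.setArr {s : Mem} (h : Loaded n off nbr s) {a i k : ℕ} (h0 : a ≠ 0) (h1 : a ≠ 1) :
    Loaded n off nbr (s.setArr a i k) :=
  ⟨h.var, by simp [h0.symm, h.off], by simp [h1.symm, h.nbr]⟩

/-- Breadth-first search from the vertex in variable `x`. -/
def bfsFrom (x : ℕ) : Prog :=
  .seq (.write 3 (.const 0) (.var x)) (.seq (.assign 8 (.const 1)) bfs)

theorem run_bfsFrom (hA : IsAdjacencyLists G off nbr) (hc : G.Connected) (hW : n + off n + 4 ≤ W)
    {s : Mem} (hs : Loaded n off nbr s) {x c : ℕ} (hx : s.var x = c) (hcn : c < n) :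
    Run W (bfsFrom x) s fun t s' => t ≤ 106 * (n + off n) ∧
      BfsOut G {c} (s'.arr 2) (s'.arr 3) := by
  refine run_seq (run_write (by simp [Expr.eval]) (by simp [Expr.eval]; omega) ?_)
  refine run_seq (run_assign (by simp [Expr.eval]; omega) ?_)
  simp only [Expr.eval, Expr.cost, hx]
  refine (run_bfs hA hc hW (s := ((s.setArr 3 0 c).setVar 8 1)) ((hs.setArr (by decide)
    (by decide)).setVar (by decide)) (by simp) (by simpa using hcn) (by simp)).mono ?_
  rintro t s' _ ⟨ht, h⟩
  refine ⟨by omega, ?_⟩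
  convert h using 1
  ext v
  simp [eq_comm]

/-! ### Counting neighbours on a level -/

/-- Count the vertex in variable `7` if it lies on the level in variable `12`. -/
def keyVisit : Prog :=
  .ite (.eq (.read 2 (.var 7)) (.var 12))
    (.write 5 (.var 4) (.add (.read 5 (.var 4)) (.const 1))) .skip

/-- For each vertex, count the neighbours on the level in variable `12`. -/
def keys : Prog :=
  forV (.seq (.assign 4 (.var 3)) (.seq (.write 5 (.var 4) (.const 0)) (forE keyVisit)))

theorem IsAdjacencyLists.card_nbrs_le (hA : IsAdjacencyLists G off nbr) {v : ℕ} (hv : v < n) :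
    (nbrs off nbr v).card ≤ off n := by
  have h1 := hA.off_le (a := v + 1) (b := n) hv le_rfl
  have h2 : (nbrs off nbr v).card ≤ _ := Finset.card_image_le
  rw [Nat.card_Ico] at h2
  omega

theorem run_keys (hA : IsAdjacencyLists G off nbr) (hW : n + off n + 4 ≤ W) (hn : 0 < n)
    {s : Mem} (hs : Loaded n off nbr s) :
    Run W keys s fun t s' => t ≤ 100 * (n + off n) ∧
      ∀ v < n, s'.arr 5 v = ((nbrs off nbr v).filter (s.arr 2 · = s.var 12)).card := by
  refine (run_forV (fun j s' => ∀ v < j, s'.arr 5 v =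
    ((nbrs off nbr v).filter (s.arr 2 · = s.var 12)).card) (fun j => 22 * deg off j + 20) hs.var
    (by omega) (by decide) (by decide) (by simp) (by simp) ?_).mono ?_
  · intro j s₁ hj h3 hF hI
    have hs₁ := hs.frame hF (by decide) (by decide) (by decide)
    refine run_seq (run_assign (by simp [Expr.eval]; omega) ?_)
    refine run_seq (run_write (by simp [Expr.eval]; omega) (by simp [Expr.eval]) ?_)
    simp only [Expr.eval, Expr.cost, h3, setVar_var, if_true]
    refine (run_forE (body := keyVisit) (s₀ := (s₁.setVar 4 j).setArr 5 j 0) hA hW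
      ((hs₁.setVar (by decide)).setArr (by decide) (by decide)) hj (by simp)
      (fun D s' => (∀ v < j, s'.arr 5 v =
        ((nbrs off nbr v).filter (s.arr 2 · = s.var 12)).card) ∧
        s'.arr 5 j = (D.filter (s.arr 2 · = s.var 12)).card) 12 (by decide) (by decide)
      ?_ ?_ ?_).mono ?_
    · rintro D s' x k (rfl | rfl | rfl) h <;> simpa using h
    · refine ⟨fun v hv => ?_, by simp⟩
      simp only [setArr_arr, if_true, setVar_arr]
      rw [Function.update_of_ne (by omega)]; exact hI v hv
    · rintro D s' w hD hwD hjw h7 hF' ⟨hI', hD'⟩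
      have h4 : s'.var 4 = j := by rw [hF'.var 4 (by decide)]; simp
      have h12 : s'.var 12 = s.var 12 := by
        rw [hF'.var 12 (by decide)]; simpa using hF.var 12 (by decide)
      have h2 : s'.arr 2 = s.arr 2 := by
        rw [hF'.arr 2 (by decide)]; simpa using hF.arr 2 (by decide)
      refine run_ite (fun hb => ?_) (fun hb => ?_)
      · simp only [Test.holds, Expr.eval, h7, h2, h12] at hb
        have hc1 := hA.card_nbrs_le hj
        have hc2 := Finset.card_le_card hD
        have hc3 := Finset.card_filter_le D (s.arr 2 · = s.var 12)
        refine run_write (by simp [Expr.eval, h4]; omega) (by simp [Expr.eval, h4, hD']; omega) ?_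
        simp only [Expr.eval, Expr.cost, Test.cost, h4, setArr_arr, if_true]
        refine ⟨by omega, fun v hv => ?_, ?_⟩
        · rw [Function.update_of_ne (by omega)]; exact hI' v hv
        · rw [Function.update_self, Finset.filter_insert, if_pos hb,
            Finset.card_insert_of_notMem (by simp [hwD]), hD']
      · simp only [Test.holds, Expr.eval, h7, h2, h12] at hb
        refine run_skip ⟨by simp [Expr.cost, Test.cost], hI', ?_⟩
        rw [Finset.filter_insert, if_neg hb, hD']
    · rintro t s' _ ⟨ht, h1, h2⟩
      refine ⟨by omega, fun v hv => ?_⟩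
      rcases Nat.lt_succ_iff_lt_or_eq.1 hv with hv | rfl
      · exact h1 v hv
      · exact h2
  · rintro t s' _ ⟨ht, h⟩
    exact ⟨ht.trans (sum_time hA.sum_deg hn (by norm_num)), h⟩

theorem IsAdjacencyLists.card_filter_nbrs (hA : IsAdjacencyLists G off nbr) (p : ℕ → Prop)
    [DecidablePred p] (v : Fin n) :
    ((nbrs off nbr v).filter p).card = {u : Fin n | p u ∧ G.Adj v u}.ncard := by
  rw [← Set.ncard_image_of_injective _ Fin.val_injective, ← Set.ncard_coe_finset]
  congr 1
  ext w
  simp only [Finset.coe_filter, hA.mem_nbrs v.2, Set.mem_ofPred_eq, Set.mem_image]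
  constructor
  · rintro ⟨h, hw⟩
    exact ⟨⟨w, h.right_lt⟩, ⟨hw, h.2.2⟩, rfl⟩
  · rintro ⟨u, ⟨hu, h⟩, rfl⟩
    exact ⟨nadj_coe.2 h, hu⟩

/-! ### Selecting the best vertex of the first level -/

/-- The vertex `sel x` of level one is below `x`, and its key is largest under this condition. -/
def SelSpec (G : SimpleGraph (Fin n)) (lev key sel : ℕ → ℕ) (x : Fin n) : Prop :=
  ∃ b : Fin n, sel x = b ∧ (lev x ≠ 0 → lev b = 1 ∧ G.dist b x + 1 = lev x ∧
    ∀ u : Fin n, lev u = 1 → G.dist u x + 1 ≤ lev x → key u ≤ key b)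

/-- Take the selection of the vertex in variable `7`, if it precedes the vertex in variable `4`
and is better than the best one so far. -/
def selVisit : Prog :=
  .ite (.and (.eq (.add (.read 2 (.var 7)) (.const 1)) (.read 2 (.var 4)))
      (.not (.lt (.read 5 (.read 6 (.var 7))) (.var 14))))
    (.seq (.assign 13 (.read 6 (.var 7)))
      (.assign 14 (.add (.read 5 (.read 6 (.var 7))) (.const 1)))) .skip

/-- Propagate the vertices with the largest keys from the first level upwards. -/
def select : Prog :=
  forV (.seq (.assign 4 (.read 3 (.var 3))) (.seq (.assign 13 (.const 0)) (.seq
    (.assign 14 (.const 0)) (.seq (forE selVisit) (.ite (.lt (.read 2 (.var 4)) (.const 2))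
      (.write 6 (.var 4) (.var 4)) (.write 6 (.var 4) (.var 13)))))))

/-- On level one the only competitor is at distance zero, that is, the vertex itself; on level zero
nothing is required. -/
theorem selSpec_of_lt_two {lev key sel : ℕ → ℕ}
    (hc : G.Connected) {v : Fin n} (hv : lev v < 2) (hsel : sel v = v) :
    SelSpec G lev key sel v := by
  refine ⟨v, hsel, fun h0 => ⟨by omega, by simp; omega, fun u hu huv => ?_⟩⟩
  have h : G.dist u v = 0 := by omega
  rw [hc.dist_eq_zero_iff.1 h]

/-- A vertex of level one below `v` reaches `v` by a geodesic whose last but one vertex is a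
neighbour of `v` on the previous level. The candidates for `v` are thus those of its predecessors
together, and the best of their selections is best for `v`. -/
theorem BfsOut.selSpec_of_pred {S : Set ℕ} {lev Q key sel : ℕ → ℕ} (H : BfsOut G S lev Q)
    (hc : G.Connected) {v w : Fin n} (hv : 2 ≤ lev v) (hvw : G.Adj v w) (hw : lev w + 1 = lev v)
    (hsel : sel v = sel w) (hspec : ∀ p, G.Adj v p → lev p + 1 = lev v → SelSpec G lev key sel p)
    (hmax : ∀ p : Fin n, G.Adj v p → lev p + 1 = lev v → key (sel p) ≤ key (sel w)) :
    SelSpec G lev key sel v := by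
  obtain ⟨b, hb, hb'⟩ := hspec w hvw hw
  obtain ⟨hb1, hb2, -⟩ := hb' (by omega)
  refine ⟨b, hsel.trans hb, fun _ => ⟨hb1, ?_, fun u hu huv => ?_⟩⟩
  · have h1 := H.lev_le_add hc b v
    have h2 := hc.dist_triangle (u := b) (v := w) (w := v)
    rw [SimpleGraph.dist_eq_one_iff_adj.2 hvw.symm] at h2
    omega
  · have h1 := H.lev_le_add hc u v
    obtain ⟨p, hp1, hp2⟩ := hc.exists_dist_le_dist_le (u := u) (v := v) (a := G.dist u v - 1)
      (b := 1) (by omega)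
    have h2 := H.lev_le_add hc u p
    have h3 := H.lev_le_add hc p v
    rw [SimpleGraph.dist_comm] at h3
    have hvp : G.Adj v p := (hc.dist_le_one_iff.1 hp2).resolve_left (by rintro rfl; omega)
    have hp : lev p + 1 = lev v := by omega
    obtain ⟨b', hb', hb''⟩ := hspec p hvp hp
    have h4 := (hb'' (by omega)).2.2 u hu (by omega)
    have h5 := hmax p hvp hp
    rw [hb, hb'] at h5
    omega

theorem run_select (hA : IsAdjacencyLists G off nbr) (hc : G.Connected) (hW : n + off n + 4 ≤ W)
    (hn : 0 < n) {s : Mem} (hs : Loaded n off nbr s) {S : Set ℕ}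
    (H : BfsOut G S (s.arr 2) (s.arr 3)) (hkey : ∀ v < n, s.arr 5 v ≤ off n) :
    Run W select s fun t s' => t ≤ 100 * (n + off n) ∧
      ∀ x : Fin n, SelSpec G (s.arr 2) (s.arr 5) (s'.arr 6) x := by
  refine (run_forV (fun j s' => ∀ v : Fin n, (∃ i < j, s.arr 3 i = v) →
    SelSpec G (s.arr 2) (s.arr 5) (s'.arr 6) v) (fun j => 35 * deg off (s.arr 3 j) + 40) hs.var
    (by omega) (by decide) (by decide) (by simp) (by simp) ?_).mono ?_
  · intro j s₁ hj h3 hF hI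
    have hs₁ := hs.frame hF (by decide) (by decide) (by decide)
    have a2 : s₁.arr 2 = s.arr 2 := hF.arr 2 (by decide)
    have a3 : s₁.arr 3 = s.arr 3 := hF.arr 3 (by decide)
    have a5 : s₁.arr 5 = s.arr 5 := hF.arr 5 (by decide)
    have hvn := H.Q_lt j hj
    obtain ⟨v, hv⟩ : ∃ v : Fin n, s.arr 3 j = v := ⟨⟨_, hvn⟩, rfl⟩
    -- The queue is sorted by level, so the predecessors of `v` have been treated before `v`.
    have hlow : ∀ p : Fin n, s.arr 2 p + 1 = s.arr 2 v →
        SelSpec G (s.arr 2) (s.arr 5) (s₁.arr 6) p := by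
      intro p hp
      obtain ⟨i, hi, hip⟩ := H.surj p p.2
      refine hI p ⟨i, ?_, hip⟩
      by_contra hij
      have := H.mono j i (by omega) hi
      rw [hip, hv] at this
      omega
    refine run_seq (run_assign (by simp [Expr.eval, h3, a3]; omega) ?_)
    refine run_seq (run_assign (by simp [Expr.eval]) ?_)
    refine run_seq (run_assign (by simp [Expr.eval]) ?_)
    simp only [Expr.eval, Expr.cost, h3, a3, hv]
    -- Variable `14` holds one plus the best key so far, so zero means that no predecessor has been
    -- seen, and a predecessor with key zero is still accepted.
    refine run_seq ((run_forE (body := selVisit)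
      (s₀ := ((s₁.setVar 4 v).setVar 13 0).setVar 14 0) hA hW
      (((hs₁.setVar (by decide)).setVar (by decide)).setVar (by decide)) v.2 (by simp)
      (fun D s' => (s'.var 14 = 0 ∧ ∀ w ∈ D, s.arr 2 w + 1 ≠ s.arr 2 v) ∨
        ∃ w ∈ D, s.arr 2 w + 1 = s.arr 2 v ∧ s'.var 13 = s₁.arr 6 w ∧
          s'.var 14 = s.arr 5 (s₁.arr 6 w) + 1 ∧ ∀ p ∈ D, s.arr 2 p + 1 = s.arr 2 v →
            s.arr 5 (s₁.arr 6 p) ≤ s.arr 5 (s₁.arr 6 w)) 25 (by decide) (by decide)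
      ?_ ?_ ?_).mono ?_)
    · rintro D s' x k (rfl | rfl | rfl) h <;> simpa using h
    · simp
    · rintro D s' w hD hwD hvw h7 hF' hI'
      have h4 : s'.var 4 = v := by rw [hF'.var 4 (by decide)]; simp
      have b2 : s'.arr 2 = s.arr 2 := (hF'.arr 2 (by decide)).trans a2
      have b5 : s'.arr 5 = s.arr 5 := (hF'.arr 5 (by decide)).trans a5
      have b6 : s'.arr 6 = s₁.arr 6 := hF'.arr 6 (by decide)
      refine run_ite (fun hb => ?_) (fun hb => ?_)
      · simp only [Test.holds, Expr.eval, h7, h4, b2, b5, b6] at hb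
        obtain ⟨b, hbw, -⟩ := hlow ⟨w, hvw.right_lt⟩ hb.1
        dsimp at hbw
        have hkb := hkey b b.2
        refine run_seq (run_assign (by simp [Expr.eval, h7, b6, hbw]; omega) ?_)
        refine run_assign (by simp [Expr.eval, h7, b5, b6, hbw]; omega) ?_
        simp only [Expr.eval, Expr.cost, Test.cost, h7, b5, b6, setVar_arr, setVar_var,
          Nat.reduceEqDiff, if_true, if_false]
        refine ⟨by omega, .inr ⟨w, by simp, hb.1, rfl, rfl, fun p hp hp' => ?_⟩⟩
        rcases Finset.mem_insert.1 hp with rfl | hp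
        · exact le_rfl
        · rcases hI' with h | ⟨w', hw', h1, h2, h3, h4⟩
          · exact absurd hp' (h.2 p hp)
          · have := h4 p hp hp'
            omega
      · simp only [Test.holds, Expr.eval, h7, h4, b2, b5, b6] at hb
        refine run_skip ⟨by simp [Expr.cost, Test.cost], ?_⟩
        rcases hI' with h | ⟨w', hw', h1, h2, h3, h4⟩
        · refine .inl ⟨h.1, fun p hp hp' => ?_⟩
          rcases Finset.mem_insert.1 hp with rfl | hp
          · exact hb ⟨hp', by omega⟩
          · exact h.2 p hp hp'
        · refine .inr ⟨w', by simp [hw'], h1, h2, h3, fun p hp hp' => ?_⟩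
          rcases Finset.mem_insert.1 hp with rfl | hp
          · by_contra hlt
            exact hb ⟨hp', by omega⟩
          · exact h4 p hp hp'
    · rintro t s₂ hF₂ ⟨ht, hI₂⟩
      have h4 : s₂.var 4 = v := by rw [hF₂.var 4 (by decide)]; simp
      have b2 : s₂.arr 2 = s.arr 2 := (hF₂.arr 2 (by decide)).trans a2
      have b6 : s₂.arr 6 = s₁.arr 6 := hF₂.arr 6 (by decide)
      have hpres : ∀ b : ℕ, SelSpec G (s.arr 2) (s.arr 5) (Function.update (s₁.arr 6) v b) v →
          ∀ u : Fin n, (∃ i < j + 1, s.arr 3 i = u) →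
          SelSpec G (s.arr 2) (s.arr 5) (Function.update (s₁.arr 6) v b) u := by
        rintro b hvb u ⟨i, hi, hiu⟩
        by_cases huv : u = v
        · rw [huv]; exact hvb
        · have hij : i < j := by
            refine lt_of_le_of_ne (by omega) ?_
            rintro rfl
            exact huv (Fin.ext (hiu.symm.trans hv))
          obtain ⟨b', hb', h⟩ := hI u ⟨i, hij, hiu⟩
          exact ⟨b', by rw [Function.update_of_ne (fun e => huv (Fin.ext e))]; exact hb', h⟩
      refine run_ite (fun hb => ?_) (fun hb => ?_)
      · simp only [Test.holds, Expr.eval, h4, b2] at hb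
        refine run_write (by simp [Expr.eval, h4]; omega) (by simp [Expr.eval, h4]; omega) ?_
        simp only [Expr.eval, Expr.cost, Test.cost, h4, setArr_arr, if_true, b6]
        exact ⟨by omega, hpres v (selSpec_of_lt_two hc hb (by simp))⟩
      · simp only [Test.holds, Expr.eval, h4, b2] at hb
        have hv2 : 2 ≤ s.arr 2 v := by omega
        have hmem : ∀ p : Fin n, p.1 ∈ nbrs off nbr v ↔ G.Adj v p := fun p => by
          rw [hA.mem_nbrs v.2, nadj_coe]
        rcases hI₂ with h | ⟨w, hw, h1, h2, h3, hmax⟩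
        · exfalso
          obtain ⟨u, hu, hlu⟩ := H.pred v v.2 (by omega)
          exact h.2 u ((hA.mem_nbrs v.2).2 hu.symm) hlu
        · have hwn := ((hA.mem_nbrs v.2).1 hw).right_lt
          lift w to Fin n using hwn
          obtain ⟨b, hb', -⟩ := hlow w h1
          refine run_write (by simp [Expr.eval, h4]; omega) (by simp [Expr.eval, h2, hb']; omega) ?_
          simp only [Expr.eval, Expr.cost, Test.cost, h4, setArr_arr, if_true, b6, h2]
          refine ⟨by omega, hpres _ ?_⟩
          have hne : ∀ p : Fin n, G.Adj v p →
              Function.update (s₁.arr 6) v (s₁.arr 6 w) p = s₁.arr 6 p := fun p hp =>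
            Function.update_of_ne (fun e => hp.ne (Fin.ext e.symm)) _ _
          have hvw := (hmem w).1 hw
          refine H.selSpec_of_pred hc hv2 hvw h1 (by rw [hne w hvw]; simp) ?_ ?_
          · intro p hp hp'
            obtain ⟨b', hb', h⟩ := hlow p hp'
            exact ⟨b', (hne p hp).trans hb', h⟩
          · intro p hp hp'
            rw [hne p hp, hne w hvw]
            exact hmax p ((hmem p).2 hp) hp'
  · rintro t s' _ ⟨ht, h⟩
    refine ⟨ht.trans (sum_time ?_ hn (by norm_num)), fun x => h x (H.surj x x.2)⟩
    rw [sum_comp_of_injOn H.Q_lt H.inj (f := deg off), hA.sum_deg]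

/-! ### Marking selected vertices -/

/-- Mark the selections of the vertices whose level plus one is in variable `15`; the mark of a
vertex is one plus a vertex that selects it. -/
def mark : Prog :=
  .seq (forV (.write 8 (.var 3) (.const 0)))
    (forV (.ite (.eq (.add (.read 2 (.var 3)) (.const 1)) (.var 15))
      (.write 8 (.read 6 (.var 3)) (.add (.var 3) (.const 1))) .skip))

/-- The marks show which vertices `g` are `sel v` for some `v` with `lev v + 1 = k`. -/
structure MarkSpec (n : ℕ) (lev sel mk : ℕ → ℕ) (k : ℕ) : Prop where
  of_pos : ∀ g < n, 0 < mk g → ∃ v < n, lev v + 1 = k ∧ sel v = g ∧ mk g = v + 1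
  pos : ∀ v < n, lev v + 1 = k → 0 < mk (sel v)

theorem run_mark (hW : n + off n + 4 ≤ W) {s : Mem} (hs : Loaded n off nbr s)
    (hsel : ∀ v < n, s.arr 6 v < n) :
    Run W mark s fun t s' => t ≤ 100 * n + 10 ∧
      MarkSpec n (s.arr 2) (s.arr 6) (s'.arr 8) (s.var 15) := by
  refine run_seq ((run_fill hs hW (a := 8) (k := 0) (fun s' hF => by simp [Expr.eval])
    (by omega)).mono ?_)
  rintro t₁ s₁ hF₁ ⟨ht₁, hI₁⟩
  simp only [Expr.cost] at ht₁
  have a2 : s₁.arr 2 = s.arr 2 := hF₁.arr 2 (by decide)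
  have a6 : s₁.arr 6 = s.arr 6 := hF₁.arr 6 (by decide)
  have v15 : s₁.var 15 = s.var 15 := hF₁.var 15 (by decide)
  have hs₁ := hs.frame hF₁ (by decide) (by decide) (by decide)
  refine (run_forV (fun j s' => (∀ g < n, 0 < s'.arr 8 g → ∃ v < j, s.arr 2 v + 1 = s.var 15 ∧
      s.arr 6 v = g ∧ s'.arr 8 g = v + 1) ∧
      ∀ v < j, s.arr 2 v + 1 = s.var 15 → 0 < s'.arr 8 (s.arr 6 v)) (fun _ => 20) hs₁.var
      (by omega) (by decide) (by decide) (by simp) ?_ ?_).mono ?_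
  · refine ⟨fun g hg h => ?_, by simp⟩
    rw [hI₁ g hg] at h
    omega
  · intro j s₂ hj h3 hF hI
    have b2 : s₂.arr 2 = s.arr 2 := (hF.arr 2 (by decide)).trans a2
    have b6 : s₂.arr 6 = s.arr 6 := (hF.arr 6 (by decide)).trans a6
    have w15 : s₂.var 15 = s.var 15 := (hF.var 15 (by decide)).trans v15
    have hsj := hsel j hj
    refine run_ite (fun hb => ?_) (fun hb => ?_)
    · simp only [Test.holds, Expr.eval, h3, b2, w15] at hb
      refine run_write (by simp [Expr.eval, h3, b6]; omega) (by simp [Expr.eval, h3]; omega) ?_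
      simp only [Expr.eval, Expr.cost, Test.cost, h3, b6, setArr_arr, if_true,
        Function.update_apply]
      refine ⟨by omega, fun g hg hpos => ?_, fun v hv hv' => ?_⟩
      · split_ifs at hpos ⊢ with hgj
        · exact ⟨j, by omega, hb, hgj.symm, rfl⟩
        · obtain ⟨v, hv, h⟩ := hI.1 g hg hpos
          exact ⟨v, by omega, h⟩
      · split_ifs with hgj
        · omega
        · refine hI.2 v ?_ hv'
          rcases Nat.lt_succ_iff_lt_or_eq.1 hv with hv | rfl
          · exact hv
          · exact absurd rfl hgj
    · simp only [Test.holds, Expr.eval, h3, b2, w15] at hb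
      refine run_skip ⟨by simp [Expr.cost, Test.cost], fun g hg hpos => ?_, fun v hv hv' => ?_⟩
      · obtain ⟨v, hv, h⟩ := hI.1 g hg hpos
        exact ⟨v, by omega, h⟩
      · refine hI.2 v ?_ hv'
        rcases Nat.lt_succ_iff_lt_or_eq.1 hv with hv | rfl
        · exact hv
        · exact absurd hv' hb
  · rintro t s' _ ⟨ht, h⟩
    simp only [Finset.sum_const, Finset.card_range, smul_eq_mul] at ht
    exact ⟨by omega, h.1, h.2⟩

/-! ### Intersecting neighbourhoods -/

/-- Count the vertex in variable `7` if it is on level zero and in the intersection so far. -/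
def meetVisit : Prog :=
  .ite (.and (.eq (.read 2 (.var 7)) (.const 0)) (.eq (.read 7 (.var 7)) (.var 16)))
    (.seq (.write 7 (.var 7) (.add (.var 16) (.const 1)))
      (.seq (.assign 18 (.var 7)) (.assign 19 (.const 1)))) .skip

/-- Intersect with the neighbourhood of the vertex in variable `3`, if it is marked. -/
def meetStep : Prog :=
  .ite (.and (.lt (.const 0) (.read 8 (.var 3))) (.eq (.var 17) (.const 0)))
    (.seq (.assign 4 (.var 3)) (.seq (.assign 19 (.const 0)) (.seq (forE meetVisit)
      (.ite (.eq (.var 19) (.const 0))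
        (.seq (.assign 17 (.const 1)) (.assign 10 (.sub (.read 8 (.var 4)) (.const 1))))
        (.assign 16 (.add (.var 16) (.const 1))))))) .skip

/-- Intersect the neighbourhoods of the marked vertices in level zero, up to the first marked vertex
that makes the intersection empty. -/
def meet : Prog :=
  .seq (forV (.write 7 (.var 3) (.const 0))) (.seq (.assign 16 (.const 0))
    (.seq (.assign 17 (.const 0)) (forV meetStep)))

/-- The vertex `u` of level zero is adjacent to all marked vertices less than `h`. -/
def InMeet (G : SimpleGraph (Fin n)) (lev mk : ℕ → ℕ) (h u : ℕ) : Prop :=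
  u < n ∧ lev u = 0 ∧ ∀ g < h, 0 < mk g → NAdj G g u

/-- The marked vertex `g` is the first one that makes the intersection empty. -/
def MeetFails (G : SimpleGraph (Fin n)) (lev mk : ℕ → ℕ) (z : ℕ) : Prop :=
  ∃ g < n, 0 < mk g ∧ z = mk g - 1 ∧ (∃ u, InMeet G lev mk g u) ∧ ¬ ∃ u, InMeet G lev mk (g + 1) u

/-- The invariant of `meet` as long as the intersection is nonempty. -/
structure MeetInv (G : SimpleGraph (Fin n)) (lev mk cnt : ℕ → ℕ) (h j last : ℕ) : Prop where
  le : j ≤ h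
  cnt_le : ∀ u < n, lev u = 0 → cnt u ≤ j
  cnt_iff : ∀ u < n, lev u = 0 → (cnt u = j ↔ InMeet G lev mk h u)
  nonempty : ∃ u, InMeet G lev mk h u
  last : (∃ g < h, 0 < mk g) → InMeet G lev mk h last

theorem inMeet_succ {lev mk : ℕ → ℕ} {h u : ℕ} (hh : 0 < mk h) :
    InMeet G lev mk (h + 1) u ↔ InMeet G lev mk h u ∧ NAdj G h u := by
  constructor
  · rintro ⟨h1, h2, h3⟩
    exact ⟨⟨h1, h2, fun g hg => h3 g (by omega)⟩, h3 h (by omega) hh⟩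
  · rintro ⟨⟨h1, h2, h3⟩, h4⟩
    refine ⟨h1, h2, fun g hg hg' => ?_⟩
    rcases Nat.lt_succ_iff_lt_or_eq.1 hg with hg | rfl
    · exact h3 g hg hg'
    · exact h4

theorem inMeet_succ_of_not {lev mk : ℕ → ℕ} {h u : ℕ} (hh : ¬ 0 < mk h) :
    InMeet G lev mk (h + 1) u ↔ InMeet G lev mk h u := by
  constructor
  · rintro ⟨h1, h2, h3⟩
    exact ⟨h1, h2, fun g hg => h3 g (by omega)⟩
  · rintro ⟨h1, h2, h3⟩
    refine ⟨h1, h2, fun g hg hg' => ?_⟩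
    rcases Nat.lt_succ_iff_lt_or_eq.1 hg with hg | rfl
    · exact h3 g hg hg'
    · exact absurd hg' hh

theorem MeetInv.skip {lev mk cnt : ℕ → ℕ} {h j last : ℕ} (H : MeetInv G lev mk cnt h j last)
    (hh : ¬ 0 < mk h) : MeetInv G lev mk cnt (h + 1) j last := by
  have e : ∀ u, InMeet G lev mk (h + 1) u ↔ InMeet G lev mk h u := fun u => inMeet_succ_of_not hh
  refine ⟨H.le.trans (by omega), H.cnt_le, fun u hu hu' => (H.cnt_iff u hu hu').trans (e u).symm,
    ?_, ?_⟩
  · obtain ⟨u, hu⟩ := H.nonempty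
    exact ⟨u, (e u).2 hu⟩
  · rintro ⟨g, hg, hg'⟩
    rcases Nat.lt_succ_iff_lt_or_eq.1 hg with hg | rfl
    · exact (e _).2 (H.last ⟨g, hg, hg'⟩)
    · exact absurd hg' hh

/-- A counter for each vertex avoids clearing marks between rounds: a vertex of level zero is in the
current intersection precisely when its counter equals the number of rounds. One that has dropped
out stays behind for good. Each marked vertex costs its degree once, however many vertices select
it. -/
theorem run_meet (hA : IsAdjacencyLists G off nbr) (hW : n + off n + 4 ≤ W) {s : Mem}
    (hs : Loaded n off nbr s) (hne : ∃ u < n, s.arr 2 u = 0) (hmk : ∀ g < n, s.arr 8 g ≤ n) :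
    Run W meet s fun t s' => t ≤ 110 * (n + off n) ∧
      (s'.var 17 = 0 ∧ ((∃ g < n, 0 < s.arr 8 g) → InMeet G (s.arr 2) (s.arr 8) n (s'.var 18)) ∨
        s'.var 17 = 1 ∧ MeetFails G (s.arr 2) (s.arr 8) (s'.var 10)) := by
  have hn : 0 < n := by obtain ⟨u, hu, -⟩ := hne; omega
  set lev := s.arr 2 with hlev
  set mk := s.arr 8 with hmk'
  refine run_seq ((run_fill hs hW (a := 7) (k := 0) (fun s' hF => by simp [Expr.eval])
    (by omega)).mono ?_)
  rintro t₁ s₁ hF₁ ⟨ht₁, hI₁⟩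
  simp only [Expr.cost] at ht₁
  have hs₁ := hs.frame hF₁ (by decide) (by decide) (by decide)
  refine run_seq (run_assign (by simp [Expr.eval]) ?_)
  refine run_seq (run_assign (by simp [Expr.eval]) ?_)
  simp only [Expr.eval, Expr.cost]
  refine (run_forV (s₀ := (s₁.setVar 16 0).setVar 17 0) (body := meetStep)
    (fun h s' => s'.var 17 = 0 ∧ MeetInv G lev mk (s'.arr 7) h (s'.var 16) (s'.var 18) ∨
      s'.var 17 = 1 ∧ MeetFails G lev mk (s'.var 10)) (fun j => 29 * deg off j + 50)
    (by simpa using hs₁.var) (by omega) (by decide) (by decide) (by simp) ?_ ?_).mono ?_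
  · refine .inl ⟨by simp, ?_⟩
    simp only [setVar_arr, setVar_var, Nat.reduceEqDiff, if_true, if_false]
    refine ⟨le_rfl, fun u hu _ => (hI₁ u hu).le, fun u hu hu' => ?_, ?_, by simp⟩
    · simp [hI₁ u hu, InMeet, hu, hu']
    · obtain ⟨u, hu, hu'⟩ := hne
      exact ⟨u, hu, hu', by simp⟩
  · intro h s₂ hh h3 hF hI
    have hs₂ := ((hs₁.setVar (x := 16) (k := 0) (by decide)).setVar (x := 17) (k := 0)
      (by decide)).frame hF (by decide) (by decide) (by decide)
    have a2 : s₂.arr 2 = lev := by rw [hF.arr 2 (by decide)]; exact hF₁.arr 2 (by decide)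
    have a8 : s₂.arr 8 = mk := by rw [hF.arr 8 (by decide)]; exact hF₁.arr 8 (by decide)
    refine run_ite (fun hb => ?_) (fun hb => ?_)
    · simp only [Test.holds, Expr.eval, h3, a8] at hb
      obtain ⟨hpos, h17⟩ := hb
      have hinv : MeetInv G lev mk (s₂.arr 7) h (s₂.var 16) (s₂.var 18) := by
        rcases hI with hI | hI
        · exact hI.2
        · omega
      have hj := hinv.le
      refine run_seq (run_assign (by simp [Expr.eval]; omega) ?_)
      refine run_seq (run_assign (by simp [Expr.eval]) ?_)
      simp only [Expr.eval, Expr.cost, h3]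
      refine run_seq ((run_forE (body := meetVisit) (s₀ := (s₂.setVar 4 h).setVar 19 0) hA hW
        ((hs₂.setVar (by decide)).setVar (by decide)) hh (by simp)
        (fun D s' => (∀ u, s'.arr 7 u =
            if u ∈ D ∧ lev u = 0 ∧ s₂.arr 7 u = s₂.var 16 then s₂.var 16 + 1 else s₂.arr 7 u) ∧
          (s'.var 19 = 0 ∧ (∀ u ∈ D, lev u = 0 → s₂.arr 7 u ≠ s₂.var 16) ∨
            s'.var 19 = 1 ∧ s'.var 18 ∈ D ∧ lev (s'.var 18) = 0 ∧
              s₂.arr 7 (s'.var 18) = s₂.var 16)) 19 (by decide) (by decide) ?_ ?_ ?_).mono ?_)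
      · rintro D s' x k (rfl | rfl | rfl) h <;> simpa using h
      · simp
      · rintro D s' w hD hwD hvw h7 hF' ⟨hcnt, hfound⟩
        have b2 : s'.arr 2 = lev := (hF'.arr 2 (by decide)).trans a2
        have h16 : s'.var 16 = s₂.var 16 := by rw [hF'.var 16 (by decide)]; simp
        have hwn := hvw.right_lt
        -- A neighbour is met only once in a round, so its counter still has the value from before
        -- the round.
        have hcw : s'.arr 7 w = s₂.arr 7 w := by rw [hcnt w, if_neg (by simp [hwD])]
        refine run_ite (fun hb => ?_) (fun hb => ?_)
        · simp only [Test.holds, Expr.eval, h7, b2, h16, hcw] at hb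
          refine run_seq (run_write (by simp [Expr.eval, h7]; omega)
            (by simp [Expr.eval, h16]; omega) ?_)
          refine run_seq (run_assign (by simp [Expr.eval, h7]; omega) ?_)
          refine run_assign (by simp [Expr.eval]; omega) ?_
          simp only [Expr.eval, Expr.cost, Test.cost, h7, h16, setArr_arr, setArr_var, setVar_arr,
            setVar_var, Nat.reduceEqDiff, if_true, if_false, Function.update_apply]
          refine ⟨by omega, fun u => ?_, .inr ⟨trivial, by simp, hb.1, hb.2⟩⟩
          by_cases huw : u = w
          · rw [if_pos huw, if_pos ⟨by simp [huw], huw ▸ hb.1, huw ▸ hb.2⟩]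
          · rw [if_neg huw, hcnt u]
            simp [huw]
        · simp only [Test.holds, Expr.eval, h7, b2, h16, hcw] at hb
          refine run_skip ⟨by simp [Expr.cost, Test.cost], fun u => ?_, ?_⟩
          · rw [hcnt u]
            by_cases huw : u = w
            · subst huw
              rw [if_neg (by simp [hwD]), if_neg (by rintro ⟨_, h⟩; exact hb h)]
            · simp [huw]
          · rcases hfound with h | h
            · refine .inl ⟨h.1, fun u hu hu' => ?_⟩
              rcases Finset.mem_insert.1 hu with rfl | hu
              · exact fun h => hb ⟨hu', h⟩
              · exact h.2 u hu hu'
            · exact .inr ⟨h.1, by simp [h.2.1], h.2.2⟩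
      · rintro t s₃ hF₃ ⟨ht, hcnt, hfound⟩
        have b8 : s₃.arr 8 = mk := (hF₃.arr 8 (by decide)).trans a8
        have h4 : s₃.var 4 = h := by rw [hF₃.var 4 (by decide)]; simp
        have h16 : s₃.var 16 = s₂.var 16 := by rw [hF₃.var 16 (by decide)]; simp
        have h17' : s₃.var 17 = 0 := by rw [hF₃.var 17 (by decide)]; simpa using h17
        have hmem : ∀ {u}, InMeet G lev mk (h + 1) u ↔
            u ∈ nbrs off nbr h ∧ lev u = 0 ∧ s₂.arr 7 u = s₂.var 16 := by
          intro u
          rw [inMeet_succ hpos, hA.mem_nbrs hh]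
          constructor
          · rintro ⟨h1, h2⟩
            exact ⟨h2, h1.2.1, (hinv.cnt_iff u h1.1 h1.2.1).2 h1⟩
          · rintro ⟨h1, h2, h3⟩
            exact ⟨(hinv.cnt_iff u h1.right_lt h2).1 h3, h1⟩
        have hmkh := hmk h hh
        refine run_ite (fun hb => ?_) (fun hb => ?_)
        · simp only [Test.holds, Expr.eval] at hb
          refine run_seq (run_assign (by simp [Expr.eval]; omega) ?_)
          refine run_assign (by simp [Expr.eval, h4, b8]; omega) ?_
          simp only [Expr.eval, Expr.cost, Test.cost, h4, b8, setVar_arr,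
            setVar_var, Nat.reduceEqDiff, if_true, if_false]
          refine ⟨by omega, .inr ⟨trivial, h, hh, hpos, rfl, hinv.nonempty, ?_⟩⟩
          rintro ⟨u, hu⟩
          have hu' := hmem.1 hu
          rcases hfound with h | h
          · exact h.2 u hu'.1 hu'.2.1 hu'.2.2
          · omega
        · simp only [Test.holds, Expr.eval] at hb
          refine run_assign (by simp [Expr.eval, h16]; omega) ?_
          simp only [Expr.eval, Expr.cost, Test.cost, h16, setVar_arr,
            setVar_var, Nat.reduceEqDiff, if_true, if_false]
          have hlast : InMeet G lev mk (h + 1) (s₃.var 18) := by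
            rcases hfound with h | h
            · exact absurd h.1 hb
            · exact hmem.2 h.2
          refine ⟨by omega, .inl ⟨h17', by omega, fun u hu hu' => ?_, fun u hu hu' => ?_,
            ⟨_, hlast⟩, fun _ => hlast⟩⟩
          · have := hinv.cnt_le u hu hu'
            rw [hcnt u]
            split_ifs <;> omega
          · rw [hmem, hcnt u]
            have := hinv.cnt_le u hu hu'
            split_ifs with hif
            · exact ⟨fun _ => hif, fun _ => rfl⟩
            · exact ⟨fun h => by omega, fun h => absurd h hif⟩
    · simp only [Test.holds, Expr.eval, h3, a8] at hb
      refine run_skip ⟨by simp [Expr.cost, Test.cost], ?_⟩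
      rcases hI with hI | hI
      · exact .inl ⟨hI.1, hI.2.skip fun hp => hb ⟨hp, hI.1⟩⟩
      · exact .inr hI
  · rintro t s' _ ⟨ht, h⟩
    have ht' := ht.trans (sum_time (W := 91) hA.sum_deg hn (by norm_num))
    refine ⟨by omega, ?_⟩
    rcases h with h | h
    · exact .inl ⟨h.1, h.2.last⟩
    · exact .inr h

/-! ### Testing whether the marked vertices form a clique -/

/-- Count the marked neighbours of the vertex in variable `3`; if some other marked vertex is not
among them, store a vertex that selects it in variable `10`. -/
def cliqueStep : Prog :=
  .seq (.assign 4 (.var 3)) (.seq (.assign 19 (.const 0)) (.seq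
    (forE (.ite (.lt (.const 0) (.read 8 (.var 7))) (.assign 19 (.add (.var 19) (.const 1))) .skip))
    (.ite (.and (.lt (.const 0) (.read 8 (.var 4)))
        (.lt (.add (.var 19) (.const 1)) (.var 16)))
      (.assign 10 (.sub (.read 8 (.var 4)) (.const 1))) .skip)))

/-- Look for a marked vertex that is not adjacent to all other marked vertices. -/
def cliqueTest : Prog :=
  .seq (.assign 16 (.const 0)) (.seq
    (forV (.ite (.lt (.const 0) (.read 8 (.var 3)))
      (.assign 16 (.add (.var 16) (.const 1))) .skip))
    (forV cliqueStep))

/-- A marked vertex together with its marked neighbours is a subset of all marked vertices, and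
comparing the sizes decides equality. No pair is examined: on failure the nonadjacent partner exists
by counting and need not be computed. -/
theorem run_cliqueTest (hA : IsAdjacencyLists G off nbr) (hW : n + off n + 4 ≤ W) (hn : 0 < n)
    {s : Mem} (hs : Loaded n off nbr s) (hmk : ∀ g < n, s.arr 8 g ≤ n) :
    Run W cliqueTest s fun t s' => t ≤ 100 * (n + off n) ∧
      (s'.var 10 = s.var 10 ∧ (∀ g < n, ∀ g' < n, 0 < s.arr 8 g → 0 < s.arr 8 g' →
          g = g' ∨ NAdj G g g') ∨
        ∃ g < n, ∃ g' < n, 0 < s.arr 8 g ∧ 0 < s.arr 8 g' ∧ g ≠ g' ∧ ¬ NAdj G g g' ∧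
          s'.var 10 = s.arr 8 g - 1) := by
  set mk := s.arr 8 with hmk'
  refine run_seq (run_assign (by simp [Expr.eval]) ?_)
  simp only [Expr.eval, Expr.cost]
  have hs₀ : Loaded n off nbr (s.setVar 16 0) := hs.setVar (by decide)
  refine run_seq ((run_forV (fun h s' => s'.var 16 = ((Finset.range h).filter (0 < mk ·)).card)
    (fun _ => 10) hs₀.var (by omega) (by decide) (by decide) (by simp) (by simp) ?_).mono ?_)
  · intro h s' hh h3 hF hI
    have a8 : s'.arr 8 = mk := hF.arr 8 (by decide)
    have hle : ((Finset.range h).filter (0 < mk ·)).card ≤ h :=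
      (Finset.card_filter_le _ _).trans (by simp)
    refine run_ite (fun hb => ?_) (fun hb => ?_)
    · simp only [Test.holds, Expr.eval, h3, a8] at hb
      refine run_assign (by simp only [Expr.eval, hI]; omega) ?_
      refine ⟨by simp [Expr.cost, Test.cost], ?_⟩
      simp only [Expr.eval, setVar_var, if_true]
      rw [Finset.range_add_one, Finset.filter_insert, if_pos hb,
        Finset.card_insert_of_notMem (by simp), hI]
    · simp only [Test.holds, Expr.eval, h3, a8] at hb
      refine run_skip ⟨by simp [Expr.cost, Test.cost], ?_⟩
      rw [Finset.range_add_one, Finset.filter_insert, if_neg hb, hI]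
  rintro t₁ s₁ hF₁ ⟨ht₁, h16⟩
  set M := (Finset.range n).filter (0 < mk ·) with hM
  have hmemM : ∀ g, g ∈ M ↔ g < n ∧ 0 < mk g := fun g => by simp [hM]
  have hs₁ := hs₀.frame hF₁ (by decide) (by decide) (by decide)
  have a8 : s₁.arr 8 = mk := hF₁.arr 8 (by decide)
  have v10 : s₁.var 10 = s.var 10 := by rw [hF₁.var 10 (by decide)]; simp
  refine (run_forV (body := cliqueStep) (fun h s' => (s'.var 10 = s.var 10 ∧
      (∀ g < h, ∀ g' < n, 0 < mk g → 0 < mk g' → g = g' ∨ NAdj G g g')) ∨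
        ∃ g < n, ∃ g' < n, 0 < mk g ∧ 0 < mk g' ∧ g ≠ g' ∧ ¬ NAdj G g g' ∧
          s'.var 10 = mk g - 1) (fun j => 20 * deg off j + 37) hs₁.var (by omega) (by decide)
      (by decide) (by simp) (.inl ⟨v10, by simp⟩) ?_).mono ?_
  · intro h s₂ hh h3 hF hI
    have hs₂ := hs₁.frame hF (by decide) (by decide) (by decide)
    have a8' : s₂.arr 8 = mk := (hF.arr 8 (by decide)).trans a8
    have v16 : s₂.var 16 = M.card := (hF.var 16 (by decide)).trans h16
    refine run_seq (run_assign (by simp [Expr.eval]; omega) ?_)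
    refine run_seq (run_assign (by simp [Expr.eval]) ?_)
    simp only [Expr.eval, Expr.cost, h3]
    refine run_seq ((run_forE (s₀ := (s₂.setVar 4 h).setVar 19 0) hA hW
      ((hs₂.setVar (by decide)).setVar (by decide)) hh (by simp)
      (fun D s' => s'.var 19 = (D.filter (0 < mk ·)).card ∧ s'.var 10 = s₂.var 10) 10 (by decide)
      (by decide) ?_ ?_ ?_).mono ?_)
    · rintro D s' x k (rfl | rfl | rfl) h <;> simpa using h
    · simp
    · rintro D s' w hD hwD hvw h7 hF' ⟨h19, h10⟩
      have b8 : s'.arr 8 = mk := (hF'.arr 8 (by decide)).trans a8'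
      have hc1 := hA.card_nbrs_le hh
      have hc2 := Finset.card_le_card hD
      have hc3 := Finset.card_filter_le D (0 < mk ·)
      refine run_ite (fun hb => ?_) (fun hb => ?_)
      · simp only [Test.holds, Expr.eval, h7, b8] at hb
        refine run_assign (by simp only [Expr.eval, h19]; omega) ?_
        refine ⟨by simp [Expr.cost, Test.cost], ?_, by simpa using h10⟩
        simp only [Expr.eval, setVar_var, if_true]
        rw [Finset.filter_insert, if_pos hb, Finset.card_insert_of_notMem (by simp [hwD]), h19]
      · simp only [Test.holds, Expr.eval, h7, b8] at hb
        refine run_skip ⟨by simp [Expr.cost, Test.cost], ?_, h10⟩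
        rw [Finset.filter_insert, if_neg hb, h19]
    · rintro t s₃ hF₃ ⟨ht, h19, h10⟩
      have b8 : s₃.arr 8 = mk := (hF₃.arr 8 (by decide)).trans a8'
      have h4 : s₃.var 4 = h := by rw [hF₃.var 4 (by decide)]; simp
      have w16 : s₃.var 16 = M.card := by rw [hF₃.var 16 (by decide)]; simpa using v16
      set N := (nbrs off nbr h).filter (0 < mk ·) with hN
      have hmemN : ∀ g, g ∈ N ↔ NAdj G h g ∧ 0 < mk g := fun g => by
        simp [hN, hA.mem_nbrs hh]
      have hhN : h ∉ N := fun hmem => ((hmemN h).1 hmem).1.2.2.ne rfl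
      have hcard := Finset.card_insert_of_notMem hhN
      have hmkh := hmk h hh
      refine run_ite (fun hb => ?_) (fun hb => ?_)
      · simp only [Test.holds, Expr.eval, h4, b8, h19, w16] at hb
        refine run_assign (by simp only [Expr.eval, h4, b8]; omega) ?_
        refine ⟨by simp [Expr.cost, Test.cost]; omega, .inr ?_⟩
        obtain ⟨g', hg', hg''⟩ := Finset.exists_mem_notMem_of_card_lt_card
          (s := insert h N) (t := M) (by omega)
        rw [hmemM] at hg'
        simp only [Finset.mem_insert, not_or, hmemN] at hg''
        refine ⟨h, hh, g', hg'.1, hb.1, hg'.2, fun e => hg''.1 e.symm,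
          fun hadj => hg''.2 ⟨hadj, hg'.2⟩, by simp [Expr.eval, h4, b8]⟩
      · simp only [Test.holds, Expr.eval, h4, b8, h19, w16] at hb
        refine run_skip ⟨by simp [Expr.cost, Test.cost]; omega, ?_⟩
        rw [h10]
        rcases hI with hI | hI
        · refine .inl ⟨hI.1, fun g hg g' hg' hp hp' => ?_⟩
          rcases Nat.lt_succ_iff_lt_or_eq.1 hg with hg | rfl
          · exact hI.2 g hg g' hg' hp hp'
          · have hsub : insert g N ⊆ M := by
              intro x hx
              rw [hmemM]
              rcases Finset.mem_insert.1 hx with rfl | hx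
              · exact ⟨hh, hp⟩
              · have := (hmemN x).1 hx
                exact ⟨this.1.right_lt, this.2⟩
            have heq := Finset.eq_of_subset_of_card_le hsub (by
              rw [hcard]
              by_contra hlt
              exact hb ⟨hp, by omega⟩)
            have : g' ∈ insert g N := by rw [heq, hmemM]; exact ⟨hg', hp'⟩
            rcases Finset.mem_insert.1 this with rfl | h
            · exact .inl rfl
            · exact .inr ((hmemN g').1 h).1
        · exact .inr hI
  · rintro t s' _ ⟨ht, h⟩
    have ht' := ht.trans (sum_time (W := 69) hA.sum_deg hn (by norm_num))
    simp only [Finset.sum_const, Finset.card_range, smul_eq_mul] at ht₁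
    exact ⟨by omega, h⟩

/-! ### The descent step -/

/-- The eccentricity of a vertex. -/
noncomputable def ecc (G : SimpleGraph (Fin n)) (c : Fin n) : ℕ := Finset.univ.sup fun x => G.dist c x

theorem dist_le_ecc (c x : Fin n) : G.dist c x ≤ ecc G c :=
  Finset.le_sup (f := fun x => G.dist c x) (Finset.mem_univ x)

theorem ecc_le {c : Fin n} {k : ℕ} (h : ∀ x, G.dist c x ≤ k) : ecc G c ≤ k :=
  Finset.sup_le fun x _ => h x

theorem BfsOut.last_eq_ecc {c : Fin n} {lev Q : ℕ → ℕ} (H : BfsOut G {(c : ℕ)} lev Q)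
    (hc : G.Connected) : ∃ w : Fin n, Q (n - 1) = w ∧ lev w = ecc G c ∧ G.dist c w = ecc G c := by
  have hn := c.2
  refine ⟨⟨Q (n - 1), H.Q_lt _ (by omega)⟩, rfl, ?_⟩
  have h1 := H.lev_eq_dist hc ⟨Q (n - 1), H.Q_lt _ (by omega)⟩
  have h2 := dist_le_ecc (G := G) c ⟨Q (n - 1), H.Q_lt _ (by omega)⟩
  have h3 : ecc G c ≤ lev (Q (n - 1)) := ecc_le fun x => by
    rw [← H.lev_eq_dist hc x]; exact H.lev_le_last x.2
  dsimp at h1 ⊢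
  omega

theorem ecc_pos (hc : G.Connected) (hn : 1 < n) (c : Fin n) : 0 < ecc G c := by
  have : Nontrivial (Fin n) := Fin.nontrivial_iff_two_le.2 hn
  obtain ⟨x, hx⟩ := exists_ne c
  exact (hc.pos_dist_of_ne hx.symm).trans_le (dist_le_ecc c x)

section Descent

variable (hc : G.Connected) (hH : G.IsHelly) (h4 : G.IsC4Free) {c w : Fin n}
  (hw : ∀ x, G.dist c x ≤ G.dist c w) (hpos : 0 < G.dist c w) {S : Set ℕ} {lev Q key sel mk : ℕ → ℕ}
  (H : BfsOut G S lev Q)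
  (hS : ∀ u : Fin n, (u : ℕ) ∈ S ↔ G.Adj c u ∧ G.dist w u + 1 = G.dist c w)

include hc hH hw hpos H hS

/-- Were `x` within `2e - 2` of `w`, where `e` is the distance of `c` and `w`, the Helly property
would give a neighbour of `c` at distance `e - 1` from `w` and at most `e - 1` from `x`. That vertex
is in `S`, so the level of `x` would be below `e`. -/
theorem far_of_le_lev {x : Fin n} (hx : G.dist c w ≤ lev x) :
    2 * G.dist c w ≤ G.dist w x + 1 := by
  by_contra hlt
  obtain ⟨u, hu1, hu2, hu3⟩ := SimpleGraph.exists_common_descent hc hH hw hpos (X := {x})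
    (by rintro _ rfl _ rfl; simp; omega) (by rintro _ rfl; omega)
  have h1 := hu3 x rfl
  have h2 := H.lev_le_dist hc (v := x) ((hS u).2 ⟨hu1, hu2⟩)
  omega

variable (hlev : ∀ x : Fin n, lev x < G.dist c w)
  (hkey : ∀ v : Fin n, key v = {u : Fin n | lev u = 0 ∧ G.Adj v u}.ncard)
  (hsel : ∀ x, SelSpec G lev key sel x)

include h4 hlev hkey hsel

omit hw hpos in
-- Level zero is a clique by `descent_clique`, and the key counts neighbours in it, so the selection
-- is a gate in the sense of `adj_of_gate`.
theorem sel_adj_iff {x : Fin n} (hx : lev x + 1 = G.dist c w) {u : Fin n} (hu : lev u = 0) :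
    NAdj G (sel x) u ↔ G.dist u x + 1 = G.dist c w := by
  -- As `c` is not in `S` but has level less than its distance from `w`, that distance is at least
  -- two. So `x` is not on level zero and its selection is meaningful.
  have hlc : lev c ≠ 0 := by
    rw [Ne, H.zero c c.2, hS]
    exact fun h => h.1.ne rfl
  have hlc' := hlev c
  obtain ⟨b, hb, hb'⟩ := hsel x
  obtain ⟨hb1, hb2, hb3⟩ := hb' (by omega)
  have hadj : ∀ u v : Fin n, lev u = 0 → G.Adj v u → lev v ≤ 1 := fun u v hu huv => by
    have := H.step u v (nadj_coe.2 huv.symm); omega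
  have := SimpleGraph.adj_of_gate hc hH (K := {u : Fin n | lev u = 0}) (x := x) (g := b)
    (d := lev x - 1) (u := u) (by
      intro u hu v hv
      have hu' := (hS u).1 ((H.zero u u.2).1 hu)
      have hv' := (hS v).1 ((H.zero v v.2).1 hv)
      exact SimpleGraph.descent_clique hc hH h4 hu'.1 hu'.2 hv'.1 hv'.2) (by
      intro u hu
      have h1 := H.lev_le_add hc u x
      have h2 : lev u = 0 := hu
      omega) (by omega) (by
      rintro g' ⟨v, hv, hgv⟩ hg'
      have h1 := hadj v g' hv hgv
      have h2 := H.lev_le_add hc g' x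
      have h3 := hb3 g' (by omega) (by omega)
      rw [hkey, hkey] at h3
      exact h3) hu
  rw [hb, nadj_coe, this]
  omega

variable (hmk : MarkSpec n lev sel mk (G.dist c w))

include hmk

/-- On the top level the gates guarantee the distance. A vertex on a lower level has a nearest
member of `S` one step closer than needed, and `u` is at most one away from it because `S` is a
clique. -/
theorem ecc_lt_of_inMeet {u : Fin n} (hu : InMeet G lev mk n u) : ecc G u + 1 ≤ ecc G c := by
  have hcw : ecc G c = G.dist c w := le_antisymm (ecc_le hw) (dist_le_ecc c w)
  suffices h : ecc G u ≤ G.dist c w - 1 by omega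
  refine ecc_le fun x => ?_
  have h1 := hlev x
  by_cases hx : lev x + 1 = G.dist c w
  · obtain ⟨b, hb, -⟩ := hsel x
    have h2 := hu.2.2 (sel x) (by rw [hb]; exact b.2) (hmk.pos x x.2 hx)
    have h3 := (sel_adj_iff hc hH h4 H hS hlev hkey hsel hx hu.2.1).1 h2
    omega
  · obtain ⟨s, hs, hsx⟩ := H.exists_dist_eq hc x
    have hu' := (hS u).1 ((H.zero u u.2).1 hu.2.1)
    have hs' := (hS s).1 hs
    have h2 := SimpleGraph.descent_clique hc hH h4 hu'.1 hu'.2 hs'.1 hs'.2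
    have h3 := hc.dist_triangle (u := u) (v := s) (w := x)
    omega

/-- Suppose that the vertex `z` selecting the failing gate `g` is within `2e - 2` of every vertex.
The top-level vertices with earlier gates are all `e - 1` from a vertex `u₀` of the last nonempty
intersection, as is `w`, so their pairwise distances are at most `2e - 2` too. The Helly property
then gives a member of `S` adjacent to `g` and to all earlier gates, a contradiction. -/
theorem exists_far_of_meetFails {z : ℕ} (hz : MeetFails G lev mk z) :
    ∃ z' y : Fin n, z = z' ∧ 2 * ecc G c ≤ G.dist z' y + 1 := by
  have hcw : ecc G c = G.dist c w := le_antisymm (ecc_le hw) (dist_le_ecc c w)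
  rw [hcw]
  obtain ⟨g, hg, hgpos, hzg, ⟨u₀, hu₀⟩, hno⟩ := hz
  obtain ⟨v, hv, hlv, hsv, hmv⟩ := hmk.of_pos g hg hgpos
  obtain rfl : z = v := by omega
  refine ⟨⟨z, hv⟩, ?_⟩
  by_contra hcon
  push Not at hcon
  have hfar : ∀ y, G.dist ⟨z, hv⟩ y + 2 ≤ 2 * G.dist c w := fun y => by
    have := hcon y rfl; omega
  have hadj := fun {x : Fin n} (hx : lev x + 1 = G.dist c w) {u : Fin n} =>
    sel_adj_iff hc hH h4 H hS hlev hkey hsel hx (u := u)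
  have hu₀n := hu₀.1
  lift u₀ to Fin n using hu₀n
  have hclose : ∀ x : Fin n, lev x + 1 = G.dist c w → sel x < g →
      G.dist u₀ x + 1 = G.dist c w := fun x hx hxg =>
    (hadj hx hu₀.2.1).1 (hu₀.2.2 _ hxg (hmk.pos x x.2 hx))
  have hwu₀ := ((hS u₀).1 ((H.zero u₀ u₀.2).1 hu₀.2.1)).2
  obtain ⟨u, hu1, hu2, hu3⟩ := SimpleGraph.exists_common_descent hc hH hw hpos
    (X := {x : Fin n | lev x + 1 = G.dist c w ∧ (sel x < g ∨ x = ⟨z, hv⟩)}) (by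
      rintro x ⟨hx, hx' | rfl⟩ y ⟨hy, hy' | rfl⟩
      · have h1 := hclose x hx hx'
        have h2 := hclose y hy hy'
        have h3 := hc.dist_triangle (u := x) (v := u₀) (w := y)
        rw [SimpleGraph.dist_comm (u := x) (v := u₀)] at h3
        omega
      · rw [SimpleGraph.dist_comm]; exact hfar x
      · exact hfar y
      · exact hfar _) (by
      rintro x ⟨hx, hx' | rfl⟩
      · have h1 := hclose x hx hx'
        have h3 := hc.dist_triangle (u := w) (v := u₀) (w := x)
        omega
      · rw [SimpleGraph.dist_comm]; exact hfar w)
  have hu0 : lev u = 0 := (H.zero u u.2).2 ((hS u).2 ⟨hu1, hu2⟩)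
  have hux : ∀ x : Fin n, lev x + 1 = G.dist c w → (sel x < g ∨ x = ⟨z, hv⟩) →
      NAdj G (sel x) u := fun x hx hx' => by
    refine (hadj hx hu0).2 ?_
    have h1 := hu3 x ⟨hx, hx'⟩
    have h2 := H.lev_le_add hc u x
    omega
  refine hno ⟨u, u.2, hu0, fun g' hg' hpos' => ?_⟩
  rcases Nat.lt_succ_iff_lt_or_eq.1 hg' with hlt | rfl
  · obtain ⟨v, hv', hlv', hsv', -⟩ := hmk.of_pos g' (by omega) hpos'
    have := hux ⟨v, hv'⟩ hlv' (.inl (by rw [hsv']; exact hlt))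
    rwa [hsv'] at this
  · have := hux ⟨z, hv⟩ hlv (.inr rfl)
    rwa [hsv] at this

end Descent

/-- Append the vertex in variable `7` to array `3`, if its level plus one is in variable `21`. -/
def seedVisit : Prog :=
  .ite (.eq (.add (.read 2 (.var 7)) (.const 1)) (.var 21))
    (.seq (.write 3 (.var 8) (.var 7)) (.assign 8 (.add (.var 8) (.const 1)))) .skip

/-- List the neighbours of the vertex in variable `9` whose level plus one is in variable `21`. -/
def seeds : Prog :=
  .seq (.assign 8 (.const 0)) (.seq (.assign 4 (.var 9)) (forE seedVisit))

theorem run_seeds (hA : IsAdjacencyLists G off nbr) (hW : n + off n + 4 ≤ W) {s : Mem}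
    (hs : Loaded n off nbr s) {c : ℕ} (hcn : c < n) (h9 : s.var 9 = c) :
    Run W seeds s fun t s' => t ≤ 40 * (n + off n) ∧ (∀ i < s'.var 8, s'.arr 3 i < n) ∧
      (∀ i < s'.var 8, ∀ j < s'.var 8, s'.arr 3 i = s'.arr 3 j → i = j) ∧
      ∀ v, (∃ i < s'.var 8, s'.arr 3 i = v) ↔ NAdj G c v ∧ s.arr 2 v + 1 = s.var 21 := by
  refine run_seq (run_assign (by simp [Expr.eval]) ?_)
  refine run_seq (run_assign (by simp [Expr.eval, h9]; omega) ?_)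
  simp only [Expr.eval, Expr.cost, setVar_var, Nat.reduceEqDiff, if_false, h9]
  refine (run_forE (body := seedVisit) (s₀ := (s.setVar 8 0).setVar 4 c) hA hW
    ((hs.setVar (by decide)).setVar (by decide)) hcn (by simp)
    (fun D s' => (∀ i < s'.var 8, s'.arr 3 i < n) ∧
      (∀ i < s'.var 8, ∀ j < s'.var 8, s'.arr 3 i = s'.arr 3 j → i = j) ∧
      ∀ v, (∃ i < s'.var 8, s'.arr 3 i = v) ↔ v ∈ D ∧ s.arr 2 v + 1 = s.var 21) 15 (by decide)
      (by decide) ?_ ?_ ?_).mono ?_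
  · rintro D s' x k (rfl | rfl | rfl) h <;> simpa using h
  · simp
  · rintro D s' w hD hwD hcw h7 hF ⟨hlt, hinj, hiff⟩
    have b2 : s'.arr 2 = s.arr 2 := hF.arr 2 (by decide)
    have h21 : s'.var 21 = s.var 21 := by rw [hF.var 21 (by decide)]; simp
    have hle := le_of_injOn_lt hlt hinj
    have hwn := hcw.right_lt
    refine run_ite (fun hb => ?_) (fun hb => ?_)
    · simp only [Test.holds, Expr.eval, h7, b2, h21] at hb
      refine run_seq (run_write (by simp [Expr.eval]; omega) (by simp [Expr.eval, h7]; omega) ?_)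
      refine run_assign (by simp [Expr.eval]; omega) ?_
      simp only [Expr.eval, Expr.cost, Test.cost, h7, setArr_arr, setArr_var, setVar_arr,
        setVar_var, if_true]
      set T := s'.var 8
      have hne : ∀ i < T, s'.arr 3 i ≠ w := fun i hi h => hwD ((hiff w).1 ⟨i, hi, h⟩).1
      have hQ : ∀ i < T, Function.update (s'.arr 3) T w i = s'.arr 3 i := fun i hi =>
        Function.update_of_ne hi.ne _ _
      have hQT : Function.update (s'.arr 3) T w T = w := Function.update_self _ _ _
      refine ⟨by omega, fun i hi => ?_, fun i hi j hj hij => ?_, fun v => ?_⟩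
      · rcases Nat.lt_succ_iff_lt_or_eq.1 hi with hi | rfl
        · rw [hQ i hi]; exact hlt i hi
        · rw [hQT]; exact hwn
      · rcases Nat.lt_succ_iff_lt_or_eq.1 hi with hi | rfl <;>
          rcases Nat.lt_succ_iff_lt_or_eq.1 hj with hj | rfl
        · rw [hQ i hi, hQ j hj] at hij; exact hinj i hi j hj hij
        · rw [hQ i hi, hQT] at hij; exact absurd hij (hne i hi)
        · rw [hQ j hj, hQT] at hij; exact absurd hij.symm (hne j hj)
        · rfl
      · constructor
        · rintro ⟨i, hi, rfl⟩
          rcases Nat.lt_succ_iff_lt_or_eq.1 hi with hi | rfl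
          · rw [hQ i hi]
            have := (hiff _).1 ⟨i, hi, rfl⟩
            exact ⟨by simp [this.1], this.2⟩
          · rw [hQT]; exact ⟨by simp, hb⟩
        · rintro ⟨hv, hv'⟩
          rcases Finset.mem_insert.1 hv with rfl | hv
          · exact ⟨T, by omega, hQT⟩
          · obtain ⟨i, hi, hiv⟩ := (hiff v).2 ⟨hv, hv'⟩
            exact ⟨i, by omega, by rw [hQ i hi]; exact hiv⟩
    · simp only [Test.holds, Expr.eval, h7, b2, h21] at hb
      refine run_skip ⟨by simp [Expr.cost, Test.cost], hlt, hinj, fun v => ?_⟩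
      rw [hiff v]
      constructor
      · rintro ⟨h1, h2⟩; exact ⟨by simp [h1], h2⟩
      · rintro ⟨h1, h2⟩
        rcases Finset.mem_insert.1 h1 with rfl | h1
        · exact absurd h2 hb
        · exact ⟨h1, h2⟩
  · rintro t s' _ ⟨ht, h1, h2, h3⟩
    refine ⟨?_, h1, h2, fun v => by rw [h3 v, hA.mem_nbrs hcn]⟩
    have h5 := hA.off_le (a := c + 1) (b := n) hcn le_rfl
    simp only [deg] at ht
    omega

/-- Store the last vertex of array `3` in variable `x`. -/
def lastVertex (x : ℕ) : Prog := .assign x (.read 3 (.sub (.var 0) (.const 1)))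

/-- Look for a common neighbour of all sets of vertices of the clique on level zero that are closest
to the vertices whose level plus one is in variable `21`. -/
def descentSearch : Prog :=
  .seq (.assign 12 (.const 0)) (.seq keys (.seq select (.seq (.assign 15 (.var 21)) (.seq mark
    (.seq meet (.ite (.eq (.var 17) (.const 0)) (.assign 9 (.var 18)) .skip))))))

/-- Replace the vertex in variable `9` by one of smaller eccentricity, or store a vertex of large
eccentricity in variable `10`. -/
def descent : Prog :=
  .seq (bfsFrom 9) (.seq (lastVertex 20) (.seq (.assign 21 (.read 2 (.var 20)))
    (.seq (bfsFrom 20) (.seq seeds (.seq bfs (.seq (lastVertex 22)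
      (.ite (.lt (.read 2 (.var 22)) (.var 21)) descentSearch (.assign 10 (.var 20)))))))))

/-- The result of a descent step. -/
def DescentSpec (G : SimpleGraph (Fin n)) (c : Fin n) (s : Mem) : Prop :=
  ∃ c' : Fin n, s.var 9 = c' ∧ (ecc G c' + 1 ≤ ecc G c ∨
    c' = c ∧ ∃ z y : Fin n, s.var 10 = z ∧ 2 * ecc G c ≤ G.dist z y + 1)

theorem run_descentSearch (hA : IsAdjacencyLists G off nbr) (hc : G.Connected) (hH : G.IsHelly)
    (h4 : G.IsC4Free) (hW : n + off n + 4 ≤ W) {s : Mem} (hs : Loaded n off nbr s) {c w : Fin n}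
    (hw : ∀ x, G.dist c x ≤ G.dist c w) (hpos : 0 < G.dist c w) {S : Set ℕ}
    (H : BfsOut G S (s.arr 2) (s.arr 3))
    (hS : ∀ u : Fin n, (u : ℕ) ∈ S ↔ G.Adj c u ∧ G.dist w u + 1 = G.dist c w)
    (hlev : ∀ x : Fin n, s.arr 2 x < G.dist c w) (h9 : s.var 9 = c)
    (h21 : s.var 21 = G.dist c w) :
    Run W descentSearch s fun t s' => t ≤ 500 * (n + off n) ∧ DescentSpec G c s' := by
  have hn : 0 < n := lt_of_le_of_lt (Nat.zero_le _) c.2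
  refine run_seq (run_assign (by simp [Expr.eval]) ?_)
  simp only [Expr.eval, Expr.cost]
  have hs₀ : Loaded n off nbr (s.setVar 12 0) := hs.setVar (by decide)
  refine run_seq ((run_keys hA hW hn hs₀).mono ?_)
  rintro t₁ s₁ hF₁ ⟨ht₁, hkey⟩
  have hs₁ := hs₀.frame hF₁ (by decide) (by decide) (by decide)
  have a2₁ : s₁.arr 2 = s.arr 2 := hF₁.arr 2 (by decide)
  have a3₁ : s₁.arr 3 = s.arr 3 := hF₁.arr 3 (by decide)
  simp only [setVar_arr, setVar_var, if_true] at hkey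
  refine run_seq ((run_select hA hc hW hn hs₁ (S := S) (by rw [a2₁, a3₁]; exact H)
    (fun v hv => by
      rw [hkey v hv]
      exact (Finset.card_filter_le _ _).trans (hA.card_nbrs_le hv))).mono ?_)
  rintro t₂ s₂ hF₂ ⟨ht₂, hsel⟩
  have hs₂ := hs₁.frame hF₂ (by decide) (by decide) (by decide)
  have a2₂ : s₂.arr 2 = s.arr 2 := (hF₂.arr 2 (by decide)).trans a2₁
  rw [a2₁] at hsel
  have v21₂ : s₂.var 21 = G.dist c w := by
    rw [hF₂.var 21 (by decide), hF₁.var 21 (by decide)]; simpa using h21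
  have hdn : G.dist c w < n := by
    obtain ⟨p, hp, hlen⟩ := hc.exists_path_of_dist c w
    have := hp.length_lt
    simp at this
    omega
  refine run_seq (run_assign (by simp [Expr.eval, v21₂]; omega) ?_)
  simp only [Expr.eval, Expr.cost, v21₂]
  have hs₂' : Loaded n off nbr (s₂.setVar 15 (G.dist c w)) := hs₂.setVar (by decide)
  refine run_seq ((run_mark hW hs₂' (fun v hv => by
    obtain ⟨b, hb, -⟩ := hsel ⟨v, hv⟩
    simp only [setVar_arr]
    rw [hb]; exact b.2)).mono ?_)
  rintro t₃ s₃ hF₃ ⟨ht₃, hmk⟩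
  simp only [setVar_arr, setVar_var, if_true, a2₂] at hmk
  have hs₃ := hs₂'.frame hF₃ (by decide) (by decide) (by decide)
  have a2₃ : s₃.arr 2 = s.arr 2 := (hF₃.arr 2 (by decide)).trans a2₂
  have h9₃ : s₃.var 9 = c := by
    rw [hF₃.var 9 (by decide)]
    simp only [setVar_var, Nat.reduceEqDiff, if_false]
    rw [hF₂.var 9 (by decide), hF₁.var 9 (by decide)]
    simpa using h9
  -- With an empty family this only says that level zero is nonempty, as `meet` requires.
  obtain ⟨u₀, hu1, hu2, -⟩ := SimpleGraph.exists_common_descent hc hH hw hpos (X := ∅) (by simp)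
    (by simp)
  refine run_seq ((run_meet hA hW hs₃ ⟨u₀, u₀.2, by
      rw [a2₃]; exact (H.zero u₀ u₀.2).2 ((hS u₀).2 ⟨hu1, hu2⟩)⟩ (fun g hg => by
    by_cases h : 0 < s₃.arr 8 g
    · obtain ⟨v, hv, -, -, h⟩ := hmk.of_pos g hg h
      omega
    · omega)).mono ?_)
  rintro t₄ s₄ hF₄ ⟨ht₄, hmeet⟩
  rw [a2₃] at hmeet
  have h9₄ : s₄.var 9 = c := (hF₄.var 9 (by decide)).trans h9₃
  have hkey' : ∀ v : Fin n, s₁.arr 5 v = {u : Fin n | s.arr 2 u = 0 ∧ G.Adj v u}.ncard := by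
    intro v
    rw [hkey v v.2]
    exact hA.card_filter_nbrs (fun u => s.arr 2 u = 0) v
  -- The vertex `w` is on the top level, since every member of `S` is at the same distance from it.
  -- So there is at least one gate, and variable `18` has been set.
  have hmarked : ∃ g < n, 0 < s₃.arr 8 g := by
    obtain ⟨s', hs', hsw⟩ := H.exists_dist_eq hc w
    have h1 := ((hS s').1 hs').2
    rw [SimpleGraph.dist_comm] at h1
    obtain ⟨b, hb, -⟩ := hsel w
    exact ⟨_, by rw [hb]; exact b.2, hmk.pos w w.2 (by omega)⟩
  refine run_ite (fun hb => ?_) (fun hb => ?_)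
  · simp only [Test.holds, Expr.eval] at hb
    have hin : InMeet G (s.arr 2) (s₃.arr 8) n (s₄.var 18) := by
      rcases hmeet with h | h
      · exact h.2 hmarked
      · omega
    obtain ⟨u, hu⟩ : ∃ u : Fin n, s₄.var 18 = u := ⟨⟨_, hin.1⟩, rfl⟩
    rw [hu] at hin
    refine run_assign (by simp [Expr.eval, hu]; omega) ?_
    simp only [Expr.eval, Expr.cost, Test.cost, hu]
    refine ⟨by omega, u, by simp, .inl ?_⟩
    exact ecc_lt_of_inMeet hc hH h4 hw hpos H hS hlev hkey' hsel hmk hin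
  · simp only [Test.holds, Expr.eval] at hb
    refine run_skip ?_
    simp only [Expr.cost, Test.cost]
    have hfail : MeetFails G (s.arr 2) (s₃.arr 8) (s₄.var 10) := by
      rcases hmeet with h | h
      · exact absurd h.1 hb
      · exact h.2
    obtain ⟨z, y, hz⟩ := exists_far_of_meetFails hc hH h4 hw hpos H hS hlev hkey' hsel hmk hfail
    exact ⟨by omega, c, h9₄, .inr ⟨rfl, z, y, hz⟩⟩

theorem run_lastVertex {s : Mem} (hs : Loaded n off nbr s) {x v : ℕ}
    (hv : s.arr 3 (n - 1) = v) (hW : v ≤ W) {Q : ℕ → Mem → Prop} (h : Q 5 (s.setVar x v)) :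
    Run W (lastVertex x) s Q :=
  run_assign (by simpa [Expr.eval, hs.var, hv] using hW)
    (by simpa [Expr.eval, Expr.cost, hs.var, hv] using h)

theorem run_descent (hA : IsAdjacencyLists G off nbr) (hc : G.Connected) (hH : G.IsHelly)
    (h4 : G.IsC4Free) (hW : n + off n + 4 ≤ W) (hn : 1 < n) {s : Mem} (hs : Loaded n off nbr s)
    {c : Fin n} (h9 : s.var 9 = c) :
    Run W descent s fun t s' => t ≤ 1000 * (n + off n) ∧ DescentSpec G c s' := by
  refine run_seq ((run_bfsFrom hA hc hW hs h9 c.2).mono ?_)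
  rintro t₁ s₁ hF₁ ⟨ht₁, H₁⟩
  have hs₁ := hs.frame hF₁ (by decide) (by decide) (by decide)
  have h9₁ : s₁.var 9 = c := (hF₁.var 9 (by decide)).trans h9
  obtain ⟨w, hwQ, hlw, hdw⟩ := H₁.last_eq_ecc hc
  have hpos := ecc_pos hc hn c
  have hlwn := H₁.lev_lt w w.2
  refine run_seq (run_lastVertex hs₁ hwQ (by omega) ?_)
  refine run_seq (run_assign (by simp [Expr.eval]; omega) ?_)
  simp only [Expr.eval, Expr.cost, setVar_var, setVar_arr, if_true, hlw]
  have hs₁' : Loaded n off nbr ((s₁.setVar 20 w).setVar 21 (ecc G c)) :=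
    (hs₁.setVar (by decide)).setVar (by decide)
  refine run_seq ((run_bfsFrom hA hc hW hs₁' (x := 20) (c := w) (by simp) w.2).mono ?_)
  rintro t₂ s₂ hF₂ ⟨ht₂, H₂⟩
  have hs₂ := hs₁'.frame hF₂ (by decide) (by decide) (by decide)
  have h9₂ : s₂.var 9 = c := by rw [hF₂.var 9 (by decide)]; simpa using h9₁
  have h20₂ : s₂.var 20 = w := by rw [hF₂.var 20 (by decide)]; simp
  have h21₂ : s₂.var 21 = ecc G c := by rw [hF₂.var 21 (by decide)]; simp
  refine run_seq ((run_seeds hA hW hs₂ c.2 h9₂).mono ?_)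
  rintro t₃ s₃ hF₃ ⟨ht₃, hlt, hinj, hiff⟩
  have hs₃ := hs₂.frame hF₃ (by decide) (by decide) (by decide)
  have h9₃ : s₃.var 9 = c := (hF₃.var 9 (by decide)).trans h9₂
  have h20₃ : s₃.var 20 = w := (hF₃.var 20 (by decide)).trans h20₂
  have h21₃ : s₃.var 21 = ecc G c := (hF₃.var 21 (by decide)).trans h21₂
  rw [h21₂] at hiff
  have hw : ∀ x, G.dist c x ≤ G.dist c w := fun x => by rw [hdw]; exact dist_le_ecc c x
  have hpos' : 0 < G.dist c w := by omega
  have hS : ∀ u : Fin n, (u : ℕ) ∈ {v | ∃ i < s₃.var 8, s₃.arr 3 i = v} ↔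
      G.Adj c u ∧ G.dist w u + 1 = G.dist c w := by
    intro u
    rw [hdw, ← H₂.lev_eq_dist hc u, ← nadj_coe]
    exact hiff u
  have htail : 0 < s₃.var 8 := by
    obtain ⟨u, hu1, hu2, -⟩ := SimpleGraph.exists_common_descent hc hH hw hpos' (X := ∅) (by simp)
      (by simp)
    obtain ⟨i, hi, -⟩ := (hS u).2 ⟨hu1, hu2⟩
    omega
  refine run_seq ((run_bfs hA hc hW hs₃ htail hlt hinj).mono ?_)
  rintro t₄ s₄ hF₄ ⟨ht₄, H₄⟩
  have hs₄ := hs₃.frame hF₄ (by decide) (by decide) (by decide)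
  have h9₄ : s₄.var 9 = c := (hF₄.var 9 (by decide)).trans h9₃
  have h20₄ : s₄.var 20 = w := (hF₄.var 20 (by decide)).trans h20₃
  have h21₄ : s₄.var 21 = ecc G c := (hF₄.var 21 (by decide)).trans h21₃
  have hxn := H₄.Q_lt (n - 1) (by omega)
  obtain ⟨x, hx⟩ : ∃ x : Fin n, s₄.arr 3 (n - 1) = x := ⟨⟨_, hxn⟩, rfl⟩
  refine run_seq (run_lastVertex hs₄ hx (by omega) ?_)
  have hs₄' : Loaded n off nbr (s₄.setVar 22 x) := hs₄.setVar (by decide)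
  refine run_ite (fun hb => ?_) (fun hb => ?_)
  · simp only [Test.holds, Expr.eval, setVar_var, setVar_arr, Nat.reduceEqDiff, if_true, if_false,
      h21₄] at hb
    refine (run_descentSearch hA hc hH h4 hW hs₄' (c := c) hw hpos' H₄ hS (fun y => ?_)
      (by simpa using h9₄) (by rw [hdw]; simpa using h21₄)).mono ?_
    · have := H₄.lev_le_last y.2
      rw [hx] at this
      simp only [setVar_arr]
      omega
    · rintro t s' _ ⟨ht, h⟩
      simp only [Test.cost, Expr.cost]
      exact ⟨by omega, h⟩
  -- The farthest vertex from `S` is too far away, so `w` itself has large eccentricity; the partner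
  -- `x` is not stored.
  · simp only [Test.holds, Expr.eval, setVar_var, setVar_arr, Nat.reduceEqDiff, if_true, if_false,
      h21₄] at hb
    refine run_assign (by simp [Expr.eval, h20₄]; omega) ?_
    simp only [Expr.eval, Expr.cost, Test.cost, setVar_var, Nat.reduceEqDiff, if_false, h20₄]
    refine ⟨by omega, c, by simpa using h9₄, .inr ⟨rfl, w, x, by simp, ?_⟩⟩
    rw [← hdw]
    exact far_of_le_lev hc hH hw hpos' H₄ hS (by omega)

/-! ### The initial sweeps -/

/-- Store the vertex in variable `3` in variable `9`, if it is in the middle of a geodesic between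
the vertices whose distances are in the arrays `2` and `4`; variable `21` is the length. -/
def middleStep : Prog :=
  .ite (.and (.eq (.add (.read 4 (.var 3)) (.read 2 (.var 3))) (.var 21))
      (.and (.not (.lt (.var 21) (.add (.read 4 (.var 3)) (.read 4 (.var 3)))))
        (.not (.lt (.add (.add (.read 4 (.var 3)) (.read 4 (.var 3))) (.const 1)) (.var 21)))))
    (.assign 9 (.var 3)) .skip

/-- Store an almost central vertex in variable `9`. -/
def sweeps : Prog :=
  .seq (.assign 9 (.const 0)) (.seq (bfsFrom 9) (.seq (lastVertex 20) (.seq (bfsFrom 20)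
    (.seq (lastVertex 22) (.seq (.assign 21 (.read 2 (.var 22)))
      (.seq (forV (.write 4 (.var 3) (.read 2 (.var 3)))) (.seq (bfsFrom 22)
        (forV middleStep))))))))

theorem run_sweeps (hA : IsAdjacencyLists G off nbr) (hc : G.Connected) (hH : G.IsHelly)
    (h4 : G.IsC4Free) (hW : n + off n + 4 ≤ W) (hn : 0 < n) {s : Mem} (hs : Loaded n off nbr s)
    {r : ℕ} {x y : Fin n} (hr : ∀ u v, G.dist u v ≤ 2 * r) (hxy : 2 * r ≤ G.dist x y + 1) :
    Run W sweeps s fun t s' => t ≤ 500 * (n + off n) ∧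
      ∃ m : Fin n, s'.var 9 = m ∧ ecc G m ≤ r + 2 := by
  refine run_seq (run_assign (by simp [Expr.eval]) ?_)
  simp only [Expr.eval, Expr.cost]
  have hs₀ : Loaded n off nbr (s.setVar 9 0) := hs.setVar (by decide)
  refine run_seq ((run_bfsFrom hA hc hW hs₀ (x := 9) (c := 0) (by simp) hn).mono ?_)
  rintro t₁ s₁ hF₁ ⟨ht₁, H₁⟩
  have hs₁ := hs₀.frame hF₁ (by decide) (by decide) (by decide)
  obtain ⟨w, hwQ, -, hdw⟩ := (show BfsOut G {((⟨0, hn⟩ : Fin n) : ℕ)} _ _ from H₁).last_eq_ecc hc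
  refine run_seq (run_lastVertex hs₁ hwQ (by omega) ?_)
  have hs₁' : Loaded n off nbr (s₁.setVar 20 w) := hs₁.setVar (by decide)
  refine run_seq ((run_bfsFrom hA hc hW hs₁' (x := 20) (c := w) (by simp) w.2).mono ?_)
  rintro t₂ s₂ hF₂ ⟨ht₂, H₂⟩
  have hs₂ := hs₁'.frame hF₂ (by decide) (by decide) (by decide)
  obtain ⟨v, hvQ, hlv, hdv⟩ := H₂.last_eq_ecc hc
  have hlvn := H₂.lev_lt v v.2
  refine run_seq (run_lastVertex hs₂ hvQ (by omega) ?_)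
  refine run_seq (run_assign (by simp [Expr.eval]; omega) ?_)
  simp only [Expr.eval, Expr.cost, setVar_var, setVar_arr, if_true, hlv]
  set s₂' := (s₂.setVar 22 v).setVar 21 (ecc G w) with hs₂def
  have hs₂' : Loaded n off nbr s₂' := (hs₂.setVar (by decide)).setVar (by decide)
  refine run_seq ((run_forV (body := .write 4 (.var 3) (.read 2 (.var 3)))
    (fun h s' => ∀ u < h, s'.arr 4 u = s₂.arr 2 u) (fun _ => 4) hs₂'.var
    (by omega) (by decide) (by decide) (by simp) (by simp) ?_).mono ?_)
  · intro h s' hh h3 hF hI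
    have b2 : s'.arr 2 = s₂.arr 2 := hF.arr 2 (by decide)
    have := H₂.lev_lt h hh
    refine run_write (by simp [Expr.eval, h3]; omega) (by simp [Expr.eval, h3, b2]; omega) ?_
    simp only [Expr.eval, Expr.cost, h3, b2, setArr_arr, if_true]
    refine ⟨by omega, fun u hu => ?_⟩
    rw [Function.update_apply]
    split_ifs with huh
    · rw [huh]
    · exact hI u (by omega)
  rintro t₃ s₃ hF₃ ⟨ht₃, ha4⟩
  have hs₃ := hs₂'.frame hF₃ (by decide) (by decide) (by decide)
  have h22₃ : s₃.var 22 = v := by rw [hF₃.var 22 (by decide), hs₂def]; simp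
  have h21₃ : s₃.var 21 = ecc G w := by rw [hF₃.var 21 (by decide), hs₂def]; simp
  refine run_seq ((run_bfsFrom hA hc hW hs₃ h22₃ v.2).mono ?_)
  rintro t₄ s₄ hF₄ ⟨ht₄, H₄⟩
  have hs₄ := hs₃.frame hF₄ (by decide) (by decide) (by decide)
  have h21₄ : s₄.var 21 = ecc G w := (hF₄.var 21 (by decide)).trans h21₃
  have ha4₄ : s₄.arr 4 = s₃.arr 4 := hF₄.arr 4 (by decide)
  set P : Fin n → Prop := fun m => G.dist w m + G.dist m v = G.dist w v ∧
    2 * G.dist w m ≤ G.dist w v ∧ G.dist w v ≤ 2 * G.dist w m + 1 with hP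
  -- The stored vertex may be overwritten by later ones; any vertex satisfying `P` serves.
  refine (run_forV (body := middleStep) (fun h s' => (∃ m : Fin n, m.1 < h ∧ P m) →
    ∃ m : Fin n, s'.var 9 = m ∧ P m) (fun _ => 40) hs₄.var
    (by omega) (by decide) (by decide) (by simp) (by simp) ?_).mono ?_
  · intro h s' hh h3 hF hI
    have b2 : s'.arr 2 = s₄.arr 2 := hF.arr 2 (by decide)
    have b4 : s'.arr 4 = s₃.arr 4 := (hF.arr 4 (by decide)).trans ha4₄
    have b21 : s'.var 21 = ecc G w := (hF.var 21 (by decide)).trans h21₄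
    have e4 : s₃.arr 4 h = G.dist w ⟨h, hh⟩ := by
      rw [ha4 h hh]; exact H₂.lev_eq_dist hc ⟨h, hh⟩
    have e2 : s₄.arr 2 h = G.dist ⟨h, hh⟩ v := by
      rw [SimpleGraph.dist_comm]; exact H₄.lev_eq_dist hc ⟨h, hh⟩
    refine run_ite (fun hb => ?_) (fun hb => ?_)
    · simp only [Test.holds, Expr.eval, h3, b2, b4, b21, e4, e2] at hb
      refine run_assign (by simp [Expr.eval, h3]; omega) ?_
      refine ⟨by simp [Expr.cost, Test.cost], fun _ => ⟨⟨h, hh⟩, by simp [Expr.eval, h3], ?_⟩⟩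
      rw [hP]
      dsimp only
      omega
    · simp only [Test.holds, Expr.eval, h3, b2, b4, b21, e4, e2] at hb
      refine run_skip ⟨by simp [Expr.cost, Test.cost], ?_⟩
      rintro ⟨m, hm, hPm⟩
      rcases Nat.lt_succ_iff_lt_or_eq.1 hm with hm | rfl
      · exact hI ⟨m, hm, hPm⟩
      · rw [hP] at hPm
        exfalso
        apply hb
        rw [Fin.eta, ← hdv]
        omega
  · rintro t s' _ ⟨ht, h⟩
    simp only [Finset.sum_const, Finset.card_range, smul_eq_mul] at ht ht₃
    refine ⟨by omega, ?_⟩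
    have hex : ∃ m, P m := by
      obtain ⟨m, hm1, hm2⟩ := hc.exists_dist_le_dist_le (u := w) (v := v) (a := G.dist w v / 2)
        (b := G.dist w v - G.dist w v / 2) (by omega)
      have := hc.dist_triangle (u := w) (v := m) (w := v)
      rw [SimpleGraph.dist_comm (u := v) (v := m)] at hm2
      refine ⟨m, ?_, ?_, ?_⟩ <;> omega
    obtain ⟨m, hm⟩ := hex
    obtain ⟨m, h9, hm1, hm2, hm3⟩ := h ⟨m, m.2, hm⟩
    refine ⟨m, h9, ecc_le fun t => ?_⟩
    exact SimpleGraph.ecc_middle_le hc hH h4 hr hxy (u := ⟨0, hn⟩)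
      (fun t => by rw [hdw]; exact dist_le_ecc _ t) (fun t => by rw [hdv]; exact dist_le_ecc _ t)
      hm1 hm2 hm3 t

/-! ### The final step -/

/-- Improve the vertex in variable `10` to the end of a diametral pair, by means of the central
vertex in variable `9`. -/
def improve : Prog :=
  .seq (bfsFrom 9) (.seq (lastVertex 20) (.seq (.assign 15 (.add (.read 2 (.var 20)) (.const 1)))
    (.seq (.assign 12 (.const 1)) (.seq keys (.seq select (.seq mark cliqueTest))))))

/-- Output the vertex in variable `10`, a vertex farthest from it, and their distance. -/
def output : Prog :=
  .seq (bfsFrom 10) (.seq (lastVertex 1) (.seq (.assign 2 (.read 2 (.var 1)))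
    (.assign 0 (.var 10))))

theorem dist_le_two_mul_ecc (hc : G.Connected) (c u v : Fin n) : G.dist u v ≤ 2 * ecc G c := by
  have h1 := hc.dist_triangle (u := u) (v := c) (w := v)
  rw [SimpleGraph.dist_comm (u := u) (v := c)] at h1
  have h2 := dist_le_ecc (G := G) c u
  have h3 := dist_le_ecc (G := G) c v
  omega

/-- By the hypothesis on `z` and `y` the diameter is `2e` or `2e - 1`, where `e` is the eccentricity
of `c`. A pair at distance `2e` has both ends at distance `e` from `c`. If the selections of these
vertices form a clique, no such pair exists and `z` is kept; otherwise a vertex selecting a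
nonadjacent one replaces it. -/
theorem run_improve (hA : IsAdjacencyLists G off nbr) (hc : G.Connected) (hH : G.IsHelly)
    (hW : n + off n + 4 ≤ W) (hn : 1 < n) {s : Mem} (hs : Loaded n off nbr s)
    {c z y : Fin n} (h9 : s.var 9 = c) (h10 : s.var 10 = z)
    (hzy : 2 * ecc G c ≤ G.dist z y + 1) :
    Run W improve s fun t s' => t ≤ 600 * (n + off n) ∧
      ∃ z' : Fin n, s'.var 10 = z' ∧ ∀ u v, G.dist u v ≤ ecc G z' := by
  refine run_seq ((run_bfsFrom hA hc hW hs h9 c.2).mono ?_)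
  rintro t₁ s₁ hF₁ ⟨ht₁, H⟩
  have hs₁ := hs.frame hF₁ (by decide) (by decide) (by decide)
  have h10₁ : s₁.var 10 = z := (hF₁.var 10 (by decide)).trans h10
  obtain ⟨w, hwQ, hlw, -⟩ := H.last_eq_ecc hc
  have hpos := ecc_pos hc hn c
  have hlwn := H.lev_lt w w.2
  refine run_seq (run_lastVertex hs₁ hwQ (by omega) ?_)
  refine run_seq (run_assign (by simp [Expr.eval]; omega) ?_)
  refine run_seq (run_assign (by simp [Expr.eval]; omega) ?_)
  simp only [Expr.eval, Expr.cost, setVar_var, setVar_arr, if_true, hlw]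
  -- Marking compares level plus one with variable `15`, so this value picks the vertices farthest
  -- from `c`. The `1` in variable `12` makes the keys count common neighbours with `c`.
  set s₂ := ((s₁.setVar 20 w).setVar 15 (ecc G c + 1)).setVar 12 1 with hs₂def
  have hs₂ : Loaded n off nbr s₂ :=
    ((hs₁.setVar (by decide)).setVar (by decide)).setVar (by decide)
  have h10₂ : s₂.var 10 = z := by simpa [hs₂def] using h10₁
  have h15₂ : s₂.var 15 = ecc G c + 1 := by simp [hs₂def]
  refine run_seq ((run_keys hA hW (by omega) hs₂).mono ?_)
  rintro t₃ s₃ hF₃ ⟨ht₃, hkey⟩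
  have hs₃ := hs₂.frame hF₃ (by decide) (by decide) (by decide)
  have a2₃ : s₃.arr 2 = s₁.arr 2 := hF₃.arr 2 (by decide)
  have a3₃ : s₃.arr 3 = s₁.arr 3 := hF₃.arr 3 (by decide)
  have hkey' : ∀ v : Fin n, s₃.arr 5 v = {u : Fin n | G.Adj c u ∧ G.Adj v u}.ncard := by
    intro v
    rw [hkey v v.2]
    refine (hA.card_filter_nbrs (fun u => s₁.arr 2 u = 1) v).trans ?_
    congr 1
    ext u
    simp only [Set.mem_ofPred_eq]
    rw [H.lev_eq_dist hc u, SimpleGraph.dist_eq_one_iff_adj]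
  refine run_seq ((run_select hA hc hW (by omega) hs₃ (S := {(c : ℕ)})
    (by rw [a2₃, a3₃]; exact H) (fun v hv => by
      rw [hkey v hv]
      exact (Finset.card_filter_le _ _).trans (hA.card_nbrs_le hv))).mono ?_)
  rintro t₄ s₄ hF₄ ⟨ht₄, hsel⟩
  have hs₄ := hs₃.frame hF₄ (by decide) (by decide) (by decide)
  rw [a2₃] at hsel
  have a2₄ : s₄.arr 2 = s₁.arr 2 := (hF₄.arr 2 (by decide)).trans a2₃
  have h15₄ : s₄.var 15 = ecc G c + 1 := by
    rw [hF₄.var 15 (by decide), hF₃.var 15 (by decide), h15₂]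
  have h10₄ : s₄.var 10 = z := by rw [hF₄.var 10 (by decide), hF₃.var 10 (by decide), h10₂]
  refine run_seq ((run_mark hW hs₄ (fun v hv => by
    obtain ⟨b, hb, -⟩ := hsel ⟨v, hv⟩
    rw [hb]; exact b.2)).mono ?_)
  rintro t₅ s₅ hF₅ ⟨ht₅, hmk⟩
  rw [a2₄, h15₄] at hmk
  have hs₅ := hs₄.frame hF₅ (by decide) (by decide) (by decide)
  have h10₅ : s₅.var 10 = z := (hF₅.var 10 (by decide)).trans h10₄
  have hiff : ∀ x y b b' : Fin n, G.dist c x = ecc G c → G.dist c y = ecc G c →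
      s₄.arr 6 x = b → s₄.arr 6 y = b' →
      (G.dist x y + 1 ≤ 2 * ecc G c ↔ b.1 = b'.1 ∨ NAdj G b b') := by
    intro x y b b' hx hy hb hb'
    have hprop : ∀ x b : Fin n, G.dist c x = ecc G c → s₄.arr 6 x = b → G.Adj c b ∧
        G.dist b x + 1 = G.dist c x ∧ ∀ e, G.Adj c e → G.dist e x + 1 = G.dist c x →
        {u | G.Adj c u ∧ G.Adj e u}.ncard ≤ {u | G.Adj c u ∧ G.Adj b u}.ncard := by
      intro x b hx hb
      obtain ⟨b', hb', h⟩ := hsel x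
      obtain rfl : b = b' := Fin.ext (hb.symm.trans hb')
      simp only [H.lev_eq_dist hc, hkey', SimpleGraph.dist_eq_one_iff_adj] at h
      obtain ⟨h1, h2, h3⟩ := h (by omega)
      exact ⟨h1, h2, fun e he hex => h3 e he hex.le⟩
    obtain ⟨h1, h2, h3⟩ := hprop x b hx hb
    obtain ⟨h1', h2', h3'⟩ := hprop y b' hy hb'
    have := SimpleGraph.dist_lt_iff_of_max hc hH (hx.trans hy.symm) h1 h2 h3 h1' h2' h3'
    rw [← hx, this, hc.dist_le_one_iff, nadj_coe, Fin.ext_iff]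
  refine (run_cliqueTest hA hW (by omega) hs₅ (fun g hg => by
    by_cases h : 0 < s₅.arr 8 g
    · obtain ⟨v, hv, -, -, h⟩ := hmk.of_pos g hg h
      omega
    · omega)).mono ?_
  rintro t₆ s₆ hF₆ ⟨ht₆, hcl⟩
  refine ⟨by omega, ?_⟩
  rcases hcl with ⟨h10₆, hcl⟩ | ⟨g, hg, g', hg', hp, hp', hne, hnadj, h10₆⟩
  · refine ⟨z, h10₆.trans h10₅, fun u v => ?_⟩
    have hz := dist_le_ecc (G := G) z y
    suffices h : G.dist u v + 1 ≤ 2 * ecc G c by omega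
    by_cases huv : G.dist c u = ecc G c ∧ G.dist c v = ecc G c
    · obtain ⟨b, hb, -⟩ := hsel u
      obtain ⟨b', hb', -⟩ := hsel v
      refine (hiff u v b b' huv.1 huv.2 hb hb').2 ?_
      have h1 := hmk.pos u u.2 (by rw [H.lev_eq_dist hc, huv.1])
      have h2 := hmk.pos v v.2 (by rw [H.lev_eq_dist hc, huv.2])
      rw [hb] at h1
      rw [hb'] at h2
      exact hcl b b.2 b' b'.2 h1 h2
    · have h1 := hc.dist_triangle (u := u) (v := c) (w := v)
      rw [SimpleGraph.dist_comm (u := u) (v := c)] at h1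
      have h2 := dist_le_ecc (G := G) c u
      have h3 := dist_le_ecc (G := G) c v
      omega
  · obtain ⟨x, hx, hlx, hsx, hmx⟩ := hmk.of_pos g hg hp
    obtain ⟨x', hx', hlx', hsx', -⟩ := hmk.of_pos g' hg' hp'
    refine ⟨⟨x, hx⟩, by rw [h10₆, hmx]; rfl, fun u v => ?_⟩
    lift x to Fin n using hx
    lift x' to Fin n using hx'
    rw [H.lev_eq_dist hc] at hlx hlx'
    have h1 := hiff x x' ⟨g, hg⟩ ⟨g', hg'⟩ (by omega) (by omega) hsx hsx'
    have h2 : ¬ G.dist x x' + 1 ≤ 2 * ecc G c := by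
      rw [h1]
      rintro (h | h)
      · exact hne h
      · exact hnadj h
    have h3 := dist_le_two_mul_ecc hc c u v
    have h5 := dist_le_ecc (G := G) x x'
    simp only [Fin.eta]
    omega

theorem run_output (hA : IsAdjacencyLists G off nbr) (hc : G.Connected)
    (hW : n + off n + 4 ≤ W) {s : Mem} (hs : Loaded n off nbr s)
    {z : Fin n} (h10 : s.var 10 = z) (hz : ∀ u v, G.dist u v ≤ ecc G z) :
    Run W output s fun t s' => t ≤ 200 * (n + off n) ∧
      ∃ x y : Fin n, s'.var 0 = x ∧ s'.var 1 = y ∧ G.IsDiametralPair x y ∧ s'.var 2 = G.diam := by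
  have hzn := z.2
  refine run_seq ((run_bfsFrom hA hc hW hs h10 z.2).mono ?_)
  rintro t₁ s₁ hF₁ ⟨ht₁, H⟩
  have hs₁ := hs.frame hF₁ (by decide) (by decide) (by decide)
  have h10₁ : s₁.var 10 = z := (hF₁.var 10 (by decide)).trans h10
  obtain ⟨y, hyQ, hly, hdy⟩ := H.last_eq_ecc hc
  have hlyn := H.lev_lt y y.2
  have hdiam : G.dist z y = G.diam := by
    have : Nonempty (Fin n) := ⟨z⟩
    refine le_antisymm (SimpleGraph.dist_le_diam
      (SimpleGraph.connected_iff_ediam_ne_top.1 hc)) ?_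
    obtain ⟨u, v, huv⟩ := G.exists_dist_eq_diam
    rw [← huv, hdy]
    exact hz u v
  refine run_seq (run_lastVertex hs₁ hyQ (by omega) ?_)
  refine run_seq (run_assign (by simp [Expr.eval]; omega) ?_)
  refine run_assign (by simp [Expr.eval, h10₁]; omega) ?_
  simp only [Expr.eval, Expr.cost, setVar_var, setVar_arr, if_true, hly]
  refine ⟨by omega, z, y, by simpa using h10₁, by simp, hdiam, ?_⟩
  rw [← hdiam, hdy]
  simp

/-! ### The complete program -/

/-- The program that computes a diametral pair of a `C₄`-free Helly graph. -/
def diametralPair : Prog :=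
  .ite (.lt (.const 1) (.var 0))
    (.seq sweeps (.seq descent (.seq descent (.seq descent (.seq improve output)))))
    (.assign 0 (.const 0))

/-- A central vertex is not left by the descent step. -/
theorem DescentSpec.of_ecc_le {c : Fin n} {r : ℕ} {s : Mem} (hr : ∀ c, r ≤ ecc G c)
    (h : DescentSpec G c s) (hcr : ecc G c ≤ r) :
    s.var 9 = c ∧ ∃ z y : Fin n, s.var 10 = z ∧ 2 * ecc G c ≤ G.dist z y + 1 := by
  obtain ⟨c', h9, h | ⟨rfl, h⟩⟩ := h
  · have := hr c'
    omega
  · exact ⟨h9, h⟩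

/-- If the step finds a far vertex instead of descending, then `2 * ecc G c - 1` is at most `2 * r`,
which already gives eccentricity at most `r`. -/
theorem DescentSpec.exists_lt {c : Fin n} {r : ℕ} {s : Mem} (hr : ∀ u v, G.dist u v ≤ 2 * r)
    (h : DescentSpec G c s) : ∃ c' : Fin n, s.var 9 = c' ∧ ecc G c' ≤ max r (ecc G c - 1) := by
  obtain ⟨c', h9, h | ⟨rfl, z, y, -, h⟩⟩ := h
  · exact ⟨c', h9, by omega⟩
  · have := hr z y
    exact ⟨c', h9, by omega⟩

theorem run_diametralPair (hA : IsAdjacencyLists G off nbr) (hc : G.Connected) (hH : G.IsHelly)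
    (h4 : G.IsC4Free) (hW : n + off n + 4 ≤ W) {s : Mem} (hs : Loaded n off nbr s)
    (h1 : s.var 1 = 0) (h2 : s.var 2 = 0) :
    Run W diametralPair s fun t s' => t ≤ 5000 * (n + off n) ∧
      ∃ x y : Fin n, s'.var 0 = x ∧ s'.var 1 = y ∧ G.IsDiametralPair x y ∧ s'.var 2 = G.diam := by
  obtain ⟨⟨_, hn⟩⟩ := hc.nonempty
  have hn : 0 < n := by omega
  have hne : Nonempty (Fin n) := ⟨⟨0, hn⟩⟩
  refine run_ite (fun hb => ?_) (fun hb => ?_)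
  · simp only [Test.holds, Expr.eval, hs.var] at hb
    obtain ⟨x, y, hxy⟩ := G.exists_dist_eq_diam
    have hdiam : ∀ u v, G.dist u v ≤ G.dist x y := fun u v => by
      rw [hxy]
      exact SimpleGraph.dist_le_diam (SimpleGraph.connected_iff_ediam_ne_top.1 hc)
    -- Half the diameter, rounded up. No eccentricity is smaller.
    obtain ⟨r, hr1, hr2⟩ : ∃ r, G.dist x y ≤ 2 * r ∧ 2 * r ≤ G.dist x y + 1 :=
      ⟨(G.dist x y + 1) / 2, by omega, by omega⟩
    have hr : ∀ u v, G.dist u v ≤ 2 * r := fun u v => (hdiam u v).trans hr1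
    have hrad : ∀ c, r ≤ ecc G c := fun c => by
      have := dist_le_two_mul_ecc hc c x y
      omega
    refine run_seq ((run_sweeps hA hc hH h4 hW hn hs hr hr2).mono ?_)
    rintro t₁ s₁ hF₁ ⟨ht₁, c₁, h9₁, hc₁⟩
    have hs₁ := hs.frame hF₁ (by decide) (by decide) (by decide)
    refine run_seq ((run_descent hA hc hH h4 hW hb hs₁ h9₁).mono ?_)
    rintro t₂ s₂ hF₂ ⟨ht₂, hd₂⟩
    have hs₂ := hs₁.frame hF₂ (by decide) (by decide) (by decide)
    obtain ⟨c₂, h9₂, hc₂⟩ := hd₂.exists_lt hr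
    refine run_seq ((run_descent hA hc hH h4 hW hb hs₂ h9₂).mono ?_)
    rintro t₃ s₃ hF₃ ⟨ht₃, hd₃⟩
    have hs₃ := hs₂.frame hF₃ (by decide) (by decide) (by decide)
    obtain ⟨c₃, h9₃, hc₃⟩ := hd₃.exists_lt hr
    refine run_seq ((run_descent hA hc hH h4 hW hb hs₃ h9₃).mono ?_)
    rintro t₄ s₄ hF₄ ⟨ht₄, hd₄⟩
    have hs₄ := hs₃.frame hF₄ (by decide) (by decide) (by decide)
    -- The sweeps reach eccentricity at most `r + 2` and two descents at most `r`. The third cannot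
    -- descend, so it must yield a far vertex.
    obtain ⟨h9₄, z, y', h10, hzy⟩ := hd₄.of_ecc_le hrad (by omega)
    refine run_seq ((run_improve hA hc hH hW hb hs₄ h9₄ h10 hzy).mono ?_)
    rintro t₅ s₅ hF₅ ⟨ht₅, z', h10', hz'⟩
    have hs₅ := hs₄.frame hF₅ (by decide) (by decide) (by decide)
    refine (run_output hA hc hW hs₅ h10' hz').mono ?_
    rintro t₆ s₆ _ ⟨ht₆, h⟩
    simp only [Test.cost, Expr.cost]
    exact ⟨by omega, h⟩
  -- For a single vertex the zeros of the initial memory in variables `1` and `2` are the answer.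
  · simp only [Test.holds, Expr.eval, hs.var] at hb
    obtain rfl : n = 1 := by omega
    have hdiam : G.diam = 0 := SimpleGraph.diam_eq_zero.2 (.inr inferInstance)
    refine run_assign (by simp [Expr.eval]) ?_
    simp only [Expr.eval, Expr.cost, Test.cost]
    refine ⟨by omega, 0, 0, by simp, by simpa using h1, ?_, by simpa [hdiam] using h2⟩
    rw [SimpleGraph.IsDiametralPair, hdiam, SimpleGraph.dist_self]

end RAM

/-- There is one program which, on every connected `C₄`-free Helly graph with `n` vertices and `m`
edges, given by adjacency lists, halts within `C * (n + m)` time units on a machine whose words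
hold numbers up to `C * (n + m)`, with a diametral pair in the variables `0` and `1` and the
diameter in the variable `2`. -/
theorem theorem3p6 :
    ∃ (P : RAM.Prog) (C : ℕ), ∀ (n : ℕ) (G : SimpleGraph (Fin n)),
      G.Connected → G.IsHelly → G.IsC4Free →
      ∀ off nbr : ℕ → ℕ, RAM.IsAdjacencyLists G off nbr →
        ∃ (t : ℕ) (s : RAM.Mem),
          RAM.Exec (C * (n + G.edgeSet.ncard)) P (RAM.input n off nbr) t s ∧
          t ≤ C * (n + G.edgeSet.ncard) ∧
          ∃ x y : Fin n, s.var 0 = x ∧ s.var 1 = y ∧ G.IsDiametralPair x y ∧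
            s.var 2 = G.diam := by
  -- Since `off n` is twice the number of edges, the bound `5000 * (n + off n)` doubles at most; as
  -- `n` is positive, the word bound also exceeds `n + off n + 4`.
  refine ⟨RAM.diametralPair, 10000, fun n G hc hH h4 off nbr hA => ?_⟩
  obtain ⟨⟨_, hn⟩⟩ := hc.nonempty
  have hoff := hA.off_eq
  obtain ⟨t, s, he, ht, hs⟩ := RAM.run_diametralPair (W := 10000 * (n + G.edgeSet.ncard)) hA hc hH
    h4 (by omega) (s := RAM.input n off nbr) ⟨by simp [RAM.input], by simp [RAM.input],
      by simp [RAM.input]⟩ (by simp [RAM.input]) (by simp [RAM.input])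
  exact ⟨t, s, he, by omega, hs⟩
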